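/- Let $\mathbb M_2=\mathbb F_2[\tau,\rho]$ be bigraded by (degree, weight) with $|\tau|=(0,1)$, $|\rho|=(1,1)$, with the additive operations $\mathrm{Sq}^1(\tau^a\rho^b)=a\,\tau^{a-1}\rho^{b+1}$ and $\mathrm{Sq}^2(\tau^a\rho^b)=\binom a2\tau^{a-1}\rho^{b+2}$ of bidegrees $(1,0)$ and $(2,1)$. Let $\mathcal A(1)^{\mathbb R}$ be the $\mathbb R$-motivic algebra generated by $\mathbb M_2$, $\mathrm{Sq}^1$ and $\mathrm{Sq}^2$, i.e. the bigraded ring generated by the ring $\mathbb M_2$ and by $\mathrm{Sq}^1,\mathrm{Sq}^2$ with the relations, for $r\in\mathbb M_2$, $$\mathrm{Sq}^1 r=r\,\mathrm{Sq}^1+\mathrm{Sq}^1(r),\qquad \mathrm{Sq}^2 r=r\,\mathrm{Sq}^2+\tau\,\mathrm{Sq}^1(r)\,\mathrm{Sq}^1+\mathrm{Sq}^2(r),$$ $$\mathrm{Sq}^1\mathrm{Sq}^1=0,\qquad \mathrm{Sq}^2\mathrm{Sq}^2=\tau\,\mathrm{Sq}^3\mathrm{Sq}^1,\qquad \mathrm{Sq}^3\mathrm{Sq}^3=\mathrm{Sq}^2\mathrm{Sq}^3\mathrm{Sq}^1,\qquad\text{where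 }\mathrm{Sq}^3=\mathrm{Sq}^1\mathrm{Sq}^2.$$ Consider the bigraded left $\mathcal A(1)^{\mathbb R}$-modules that are finitely generated and projective over $\mathbb M_2$, with degree-preserving homomorphisms. The tensor product $M\otimes_{\mathbb M_2}N$ of two of them is again such a module, by the Cartan formulas $$\mathrm{Sq}^1(x\otimes y)=\mathrm{Sq}^1x\otimes y+x\otimes\mathrm{Sq}^1y,\qquad \mathrm{Sq}^2(x\otimes y)=\mathrm{Sq}^2x\otimes y+\tau\,\mathrm{Sq}^1x\otimes\mathrm{Sq}^1y+x\otimes\mathrm{Sq}^2y,$$ and $\mathbb M_2$ is the unit. Two modules $M,N$ are stably equivalent if $M\oplus P\cong N\oplus Q$ for some modules $P,Q$ of this kind that are projective over $\mathcal A(1)^{\mathbb R}$. A module $M$ is stably invertible if $M\otimes_{\mathbb M_2}N$ is stably equivalent to $\mathbb M_2$ for some $N$. The stable equivalence classes of the stably invertible modules form an abelian group $\mathrm{Pic}(\mathcal A(1)^{\mathbb R})$ under the tensor product. Let $\Sigma^dM$ denote the shift $(\Sigma^dM)_i=M_{i-d}$. Define all this in the same way for the classical algebra $\mathcal A(1)$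 over $\mathbb F_2$, graded by $\mathbb Z$ with $|\mathrm{Sq}^1|=1$, $|\mathrm{Sq}^2|=2$ (replace $\mathbb M_2$ by $\mathbb F_2$, $\tau$ by $1$, and let the operations vanish on $\mathbb F_2$). **Proposition.** The $\mathbb R$-motivic joker $J=\mathcal A(1)^{\mathbb R}/\mathcal A(1)^{\mathbb R}\mathrm{Sq}^3$ is stably invertible, and its class $[J]$ has infinite order in $\mathrm{Pic}(\mathcal A(1)^{\mathbb R})$; more generally, every shift $\Sigma^{d}J$, $d\in\mathbb Z^2$, is stably invertible and $[\Sigma^dJ]$ has infinite order. In contrast, the classical joker, placed symmetrically about degree $0$, that is $\Sigma^{-2}\bigl(\mathcal A(1)/\mathcal A(1)\mathrm{Sq}^3\bigr)$, is stably invertible and its class in $\mathrm{Pic}(\mathcal A(1))$ has order exactly $2$. -/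

import Mathlib

open scoped TensorProduct DirectSum

set_option linter.unusedSimpArgs false
set_option linter.unusedSectionVars false

/-- A graded commutative coefficient ring of characteristic two with an action of the two
Steenrod operations `Sq¹`, `Sq²` satisfying the Cartan formulas and the Adem relations.
The examples used below are `realBase` (the `ℝ`-motivic cohomology of a point) and
`classicalBase` (the field with two elements). -/
structure SteenrodBase where
  /-- the coefficient ring -/
  R : Type
  [commRing : CommRing R]
  /-- the group of degrees -/
  Γ : Type
  [addCommGroup : AddCommGroup Γ]
  [decEq : DecidableEq Γ]
  /-- the homogeneous components of the coefficient ring -/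
  gr : Γ → AddSubgroup R
  internal : DirectSum.IsInternal gr
  one_mem : (1 : R) ∈ gr 0
  mul_mem : ∀ {i j : Γ} {r s : R}, r ∈ gr i → s ∈ gr j → r * s ∈ gr (i + j)
  two_eq_zero : (2 : R) = 0
  /-- the degree of `Sq¹` -/
  e1 : Γ
  /-- the degree of `Sq²` -/
  e2 : Γ
  τ : R
  τ_mem : τ ∈ gr (e2 - (e1 + e1))
  /-- the operation `Sq¹` on the coefficient ring -/
  sq1 : R →+ R
  /-- the operation `Sq²` on the coefficient ring -/
  sq2 : R →+ R
  sq1_mem : ∀ {i : Γ} {r : R}, r ∈ gr i → sq1 r ∈ gr (i + e1)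
  sq2_mem : ∀ {i : Γ} {r : R}, r ∈ gr i → sq2 r ∈ gr (i + e2)
  sq1_mul : ∀ r s : R, sq1 (r * s) = r * sq1 s + sq1 r * s
  sq2_mul : ∀ r s : R, sq2 (r * s) = r * sq2 s + τ * sq1 r * sq1 s + sq2 r * s
  sq2_τ : sq2 τ = 0
  sq2_sq1_τ : sq2 (sq1 τ) = 0
  sq1_sq1 : ∀ r : R, sq1 (sq1 r) = 0
  sq2_sq2 : ∀ r : R, sq2 (sq2 r) = τ * sq1 (sq2 (sq1 r))
  braid : ∀ r : R, sq1 (sq2 (sq1 (sq2 r))) = sq2 (sq1 (sq2 (sq1 r)))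

attribute [instance] SteenrodBase.commRing SteenrodBase.addCommGroup SteenrodBase.decEq

namespace SteenrodBase

variable (B : SteenrodBase)

/-- Generators of the algebra `A(1)`: the coefficients `r`, and `Sq¹`, `Sq²`. -/
inductive Gen : Type
  | coeff (r : B.R) : Gen
  | sq1 : Gen
  | sq2 : Gen

/-- Words in the generators of `A(1)`. -/
abbrev Word : Type := FreeAlgebra ℤ B.Gen

/-- A coefficient, as a word. -/
abbrev wc (r : B.R) : B.Word := FreeAlgebra.ι ℤ (Gen.coeff r)

/-- `Sq¹`, as a word. -/
abbrev w1 : B.Word := FreeAlgebra.ι ℤ Gen.sq1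

/-- `Sq²`, as a word. -/
abbrev w2 : B.Word := FreeAlgebra.ι ℤ Gen.sq2

/-- The defining relations of `A(1)`: the coefficients form a subring, the operations commute
with the coefficients according to the Cartan formulas, and the Adem relations
`Sq¹Sq¹ = 0`, `Sq²Sq² = τ Sq¹Sq²Sq¹` and `Sq³Sq³ = Sq²Sq³Sq¹`, where `Sq³ = Sq¹Sq²`. -/
inductive Rel : B.Word → B.Word → Prop
  | coeff_one : Rel (B.wc 1) 1
  | coeff_add (r s : B.R) : Rel (B.wc (r + s)) (B.wc r + B.wc s)
  | coeff_mul (r s : B.R) : Rel (B.wc (r * s)) (B.wc r * B.wc s)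
  | sq1_coeff (r : B.R) : Rel (B.w1 * B.wc r) (B.wc r * B.w1 + B.wc (B.sq1 r))
  | sq2_coeff (r : B.R) : Rel (B.w2 * B.wc r)
      (B.wc r * B.w2 + B.wc (B.τ * B.sq1 r) * B.w1 + B.wc (B.sq2 r))
  | sq1_sq1 : Rel (B.w1 * B.w1) 0
  | sq2_sq2 : Rel (B.w2 * B.w2) (B.wc B.τ * (B.w1 * B.w2 * B.w1))
  | sq3_sq3 : Rel (B.w1 * B.w2 * (B.w1 * B.w2)) (B.w2 * (B.w1 * B.w2) * B.w1)

/-- The algebra `A(1)` over the given coefficient ring. -/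
def A : Type := RingQuot B.Rel

noncomputable instance : Ring B.A := inferInstanceAs (Ring (RingQuot B.Rel))

/-- The quotient map from words to `A(1)`. -/
noncomputable def proj : B.Word →+* B.A := RingQuot.mkRingHom B.Rel

/-- `Sq¹` as an element of `A(1)`. -/
noncomputable def Sq1 : B.A := B.proj B.w1

/-- `Sq²` as an element of `A(1)`. -/
noncomputable def Sq2 : B.A := B.proj B.w2

/-- `Sq³ = Sq¹Sq²` as an element of `A(1)`. -/
noncomputable def Sq3 : B.A := B.Sq1 * B.Sq2

variable {B} in
theorem proj_rel {x y : B.Word} (h : B.Rel x y) : B.proj x = B.proj y := RingQuot.mkRingHom_rel h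

/-- The inclusion of the coefficients (the left unit). -/
noncomputable def coeff : B.R →+* B.A where
  toFun r := B.proj (B.wc r)
  map_one' := by rw [proj_rel Rel.coeff_one, map_one]
  map_mul' r s := by rw [proj_rel (Rel.coeff_mul r s), map_mul]
  map_add' r s := by rw [proj_rel (Rel.coeff_add r s), map_add]
  map_zero' := by
    have h2 := proj_rel (Rel.coeff_add (B := B) 0 0)
    rw [add_zero, map_add] at h2
    exact left_eq_add.mp h2

/-- `A(1)` as a left module over the coefficients. -/
noncomputable instance : Module B.R B.A := Module.compHom B.A B.coeff

theorem smul_A (r : B.R) (a : B.A) : r • a = B.coeff r * a := rfl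

instance : IsScalarTower B.R B.A B.A := ⟨fun r a b => by
  simp only [smul_A, smul_eq_mul, mul_assoc]⟩

theorem Sq1_coeff (r : B.R) : B.Sq1 * B.coeff r = B.coeff r * B.Sq1 + B.coeff (B.sq1 r) := by
  have h := proj_rel (Rel.sq1_coeff (B := B) r)
  simp only [map_mul B.proj, map_add] at h
  exact h

theorem Sq2_coeff (r : B.R) : B.Sq2 * B.coeff r =
    B.coeff r * B.Sq2 + B.coeff (B.τ * B.sq1 r) * B.Sq1 + B.coeff (B.sq2 r) := by
  have h := proj_rel (Rel.sq2_coeff (B := B) r)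
  simp only [map_mul B.proj, map_add] at h
  exact h

theorem Sq1_Sq1 : B.Sq1 * B.Sq1 = 0 := by
  have h := proj_rel (Rel.sq1_sq1 (B := B))
  simp only [map_mul, map_zero] at h
  exact h

theorem Sq2_Sq2 : B.Sq2 * B.Sq2 = B.coeff B.τ * (B.Sq1 * B.Sq2 * B.Sq1) := by
  have h := proj_rel (Rel.sq2_sq2 (B := B))
  simp only [map_mul B.proj] at h
  exact h

theorem Sq3_Sq3 : B.Sq1 * B.Sq2 * (B.Sq1 * B.Sq2) = B.Sq2 * (B.Sq1 * B.Sq2) * B.Sq1 := by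
  have h := proj_rel (Rel.sq3_sq3 (B := B))
  simp only [map_mul B.proj] at h
  exact h

/-- A pair of additive operators on a module over the coefficients that satisfies the
relations of `Sq¹` and `Sq²`. -/
structure IsAction {M : Type} [AddCommGroup M] [Module B.R M] (s1 s2 : M →+ M) : Prop where
  sq1_smul : ∀ (r : B.R) (m : M), s1 (r • m) = r • s1 m + B.sq1 r • m
  sq2_smul : ∀ (r : B.R) (m : M),
    s2 (r • m) = r • s2 m + (B.τ * B.sq1 r) • s1 m + B.sq2 r • m
  sq1_sq1 : ∀ m : M, s1 (s1 m) = 0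
  sq2_sq2 : ∀ m : M, s2 (s2 m) = B.τ • s1 (s2 (s1 m))
  braid : ∀ m : M, s1 (s2 (s1 (s2 m))) = s2 (s1 (s2 (s1 m)))

section action

variable {B} {M : Type} [AddCommGroup M] [Module B.R M] {s1 s2 : M →+ M}

/-- The value of an action on a generator. -/
def IsAction.gen (_ : B.IsAction s1 s2) : B.Gen → AddMonoid.End M
  | .coeff r => DistribSMul.toAddMonoidHom M r
  | .sq1 => s1
  | .sq2 => s2

/-- The ring homomorphism defined by an action. -/
noncomputable def IsAction.hom (h : B.IsAction s1 s2) : B.A →+* AddMonoid.End M :=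
  RingQuot.lift ⟨(FreeAlgebra.lift ℤ h.gen : B.Word →ₐ[ℤ] AddMonoid.End M).toRingHom, by
    intro x y hxy
    cases hxy <;> ext m <;> simp only [AlgHom.toRingHom_eq_coe, RingHom.coe_coe, map_mul, map_add,
      map_one, map_zero, FreeAlgebra.lift_ι_apply]
    case coeff_one => exact one_smul B.R m
    case coeff_add r s => exact add_smul r s m
    case coeff_mul r s => exact mul_smul r s m
    case sq1_coeff r => exact h.sq1_smul r m
    case sq2_coeff r => exact h.sq2_smul r m
    case sq1_sq1 => exact h.sq1_sq1 m
    case sq2_sq2 => exact h.sq2_sq2 m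
    case sq3_sq3 => exact h.braid m⟩

/-- The `A(1)`-module defined by an action. -/
@[reducible] noncomputable def IsAction.module (h : B.IsAction s1 s2) : Module B.A M :=
  Module.compHom M h.hom

theorem IsAction.hom_proj (h : B.IsAction s1 s2) (w : B.Word) :
    h.hom (B.proj w) = FreeAlgebra.lift ℤ h.gen w :=
  RingQuot.lift_mkRingHom_apply _ _ _

theorem IsAction.coeff_smul (h : B.IsAction s1 s2) (r : B.R) (m : M) :
    letI := h.module; B.coeff r • m = r • m := by
  change h.hom (B.proj _) m = _
  rw [h.hom_proj, FreeAlgebra.lift_ι_apply]; rfl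

theorem IsAction.Sq1_smul (h : B.IsAction s1 s2) (m : M) :
    letI := h.module; B.Sq1 • m = s1 m := by
  change h.hom (B.proj _) m = _
  rw [h.hom_proj, FreeAlgebra.lift_ι_apply]; rfl

theorem IsAction.Sq2_smul (h : B.IsAction s1 s2) (m : M) :
    letI := h.module; B.Sq2 • m = s2 m := by
  change h.hom (B.proj _) m = _
  rw [h.hom_proj, FreeAlgebra.lift_ι_apply]; rfl

theorem IsAction.tower (h : B.IsAction s1 s2) :
    letI := h.module; IsScalarTower B.R B.A M := by
  let _ := h.module
  refine ⟨fun r a m => ?_⟩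
  rw [smul_A, mul_smul, h.coeff_smul]

end action

/-- The additive operator `Sq¹` of an `A(1)`-module. -/
noncomputable def op1 (M : Type) [AddCommGroup M] [Module B.A M] : M →+ M :=
  DistribSMul.toAddMonoidHom M B.Sq1

/-- The additive operator `Sq²` of an `A(1)`-module. -/
noncomputable def op2 (M : Type) [AddCommGroup M] [Module B.A M] : M →+ M :=
  DistribSMul.toAddMonoidHom M B.Sq2

variable {B} in
theorem op1_apply {M : Type} [AddCommGroup M] [Module B.A M] (m : M) :
    B.op1 M m = B.Sq1 • m := rfl

variable {B} in
theorem op2_apply {M : Type} [AddCommGroup M] [Module B.A M] (m : M) :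
    B.op2 M m = B.Sq2 • m := rfl

theorem isAction_unit : B.IsAction (M := B.R) B.sq1 B.sq2 where
  sq1_smul := B.sq1_mul
  sq2_smul := B.sq2_mul
  sq1_sq1 := B.sq1_sq1
  sq2_sq2 := B.sq2_sq2
  braid := B.braid

/-- The coefficient ring as an `A(1)`-module. -/
noncomputable instance : Module B.A B.R := B.isAction_unit.module

instance : IsScalarTower B.R B.A B.R := B.isAction_unit.tower

variable {B} in
theorem Sq1_unit (r : B.R) : B.Sq1 • r = B.sq1 r := B.isAction_unit.Sq1_smul r

variable {B} in
theorem Sq2_unit (r : B.R) : B.Sq2 • r = B.sq2 r := B.isAction_unit.Sq2_smul r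

section modules

variable {B} {M N : Type} [AddCommGroup M] [Module B.R M] [Module B.A M] [IsScalarTower B.R B.A M]
  [AddCommGroup N] [Module B.R N] [Module B.A N] [IsScalarTower B.R B.A N]

theorem coeff_smul (r : B.R) (m : M) : B.coeff r • m = r • m := by
  have h : r • (1 : B.A) = B.coeff r := by rw [smul_A, mul_one]
  rw [← h, smul_assoc, one_smul]

variable (B M) in
theorem isAction_op : B.IsAction (B.op1 M) (B.op2 M) where
  sq1_smul r m := by
    simp only [op1_apply, ← coeff_smul (B := B), ← mul_smul, ← add_smul, Sq1_coeff]
  sq2_smul r m := by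
    simp only [op1_apply, op2_apply, ← coeff_smul (B := B), ← mul_smul, ← add_smul, Sq2_coeff]
  sq1_sq1 m := by simp only [op1_apply, ← mul_smul, Sq1_Sq1, zero_smul]
  sq2_sq2 m := by
    simp only [op1_apply, op2_apply, ← coeff_smul (B := B), ← mul_smul, Sq2_Sq2, mul_assoc]
  braid m := by
    have h := B.Sq3_Sq3
    simp only [op1_apply, op2_apply, ← mul_smul, mul_assoc] at h ⊢
    rw [h]

/-- An additive map that commutes with coefficients, `Sq¹` and `Sq²` is `A(1)`-linear. -/
theorem map_smul_of_gen (f : M →+ N) (hr : ∀ (r : B.R) m, f (r • m) = r • f m)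
    (h1 : ∀ m, f (B.Sq1 • m) = B.Sq1 • f m) (h2 : ∀ m, f (B.Sq2 • m) = B.Sq2 • f m)
    (a : B.A) (m : M) : f (a • m) = a • f m := by
  obtain ⟨w, rfl⟩ : ∃ w, B.proj w = a := RingQuot.mkRingHom_surjective _ a
  induction w using FreeAlgebra.induction generalizing m with
  | grade0 z =>
    have : B.proj (algebraMap ℤ _ z) = (z : B.A) := by simp
    rw [this, Int.cast_smul_eq_zsmul, Int.cast_smul_eq_zsmul, map_zsmul]
  | grade1 g =>
    cases g with
    | coeff r => exact (congrArg f (coeff_smul r m)).trans ((hr r m).trans (coeff_smul r _).symm)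
    | sq1 => exact h1 m
    | sq2 => exact h2 m
  | mul x y hx hy => rw [map_mul, mul_smul, mul_smul, hx, hy]
  | add x y hx hy => rw [map_add, add_smul, add_smul, map_add, hx, hy]

/-- An additive equivalence that commutes with coefficients, `Sq¹` and `Sq²`, as an
`A(1)`-linear equivalence. -/
def equivOfGen (f : M ≃+ N) (hr : ∀ (r : B.R) m, f (r • m) = r • f m)
    (h1 : ∀ m, f (B.Sq1 • m) = B.Sq1 • f m) (h2 : ∀ m, f (B.Sq2 • m) = B.Sq2 • f m) :
    M ≃ₗ[B.A] N :=
  { f with map_smul' := map_smul_of_gen f.toAddMonoidHom hr h1 h2 }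

end modules


section grading

variable {Γ M : Type} [DecidableEq Γ] [AddCommGroup M] {gr : Γ → AddSubgroup M}

/-- The map that sends an element to the finitely supported family of its components. -/
noncomputable def components (h : DirectSum.IsInternal gr) : M →+ (Γ →₀ M) :=
  (DirectSum.toAddMonoid fun i => (Finsupp.singleAddHom i).comp (gr i).subtype).comp
    (AddEquiv.ofBijective _ h).symm.toAddMonoidHom

theorem components_of_mem (h : DirectSum.IsInternal gr) {i : Γ} {x : M} (hx : x ∈ gr i) :
    components h x = Finsupp.single i x := by
  have : (AddEquiv.ofBijective _ h).symm x = DirectSum.of (fun i => gr i) i ⟨x, hx⟩ := by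
    rw [AddEquiv.symm_apply_eq]
    exact (DirectSum.coeAddMonoidHom_of gr i ⟨x, hx⟩).symm
  change DirectSum.toAddMonoid _ ((AddEquiv.ofBijective _ h).symm x) = _
  rw [this, DirectSum.toAddMonoid_of]
  rfl

theorem graded_induction (h : DirectSum.IsInternal gr) {p : M → Prop} (m : M) (h0 : p 0)
    (hadd : ∀ x y, p x → p y → p (x + y)) (hom : ∀ i, ∀ x ∈ gr i, p x) : p m := by
  obtain ⟨x, rfl⟩ := h.2 m
  induction x using DirectSum.induction_on with
  | zero => simpa using h0
  | of i x => rw [DirectSum.coeAddMonoidHom_of]; exact hom i x x.2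
  | add x y hx hy => rw [map_add]; exact hadd _ _ hx hy

theorem isInternal_of_components (δ : M →+ (Γ →₀ M))
    (hgr : ∀ i, ∀ x ∈ gr i, δ x = Finsupp.single i x)
    (hspan : ∀ m, m ∈ AddSubgroup.closure {x | ∃ i, x ∈ gr i}) :
    DirectSum.IsInternal gr := by
  constructor
  · have key : ∀ (x : ⨁ i, gr i) (i : Γ), δ (DirectSum.coeAddMonoidHom gr x) i = x i := by
      intro x i
      induction x using DirectSum.induction_on with
      | zero => simp
      | of j x =>
        rw [DirectSum.coeAddMonoidHom_of, hgr j x x.2]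
        by_cases hij : j = i
        · subst hij; simp
        · rw [Finsupp.single_eq_of_ne (Ne.symm hij), DirectSum.of_eq_of_ne _ _ _ (Ne.symm hij)]; rfl
      | add x y hx hy => simp [hx, hy]
    intro x y hxy
    ext i
    rw [← key x i, ← key y i, hxy]
  · intro m
    refine AddSubgroup.closure_induction (p := fun m _ => ∃ x, DirectSum.coeAddMonoidHom gr x = m)
      ?_ ⟨0, map_zero _⟩ ?_ ?_ (hspan m)
    · rintro x ⟨i, hx⟩
      exact ⟨DirectSum.of (fun i => gr i) i ⟨x, hx⟩, DirectSum.coeAddMonoidHom_of gr i ⟨x, hx⟩⟩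
    · rintro _ _ _ _ ⟨x, rfl⟩ ⟨y, rfl⟩
      exact ⟨x + y, map_add _ _ _⟩
    · rintro _ _ ⟨x, rfl⟩
      exact ⟨-x, map_neg _ _⟩

end grading

/-- A graded left `A(1)`-module whose underlying module over the coefficients is finitely
generated and projective. -/
structure Obj : Type 1 where
  carrier : Type
  [addCommGroup : AddCommGroup carrier]
  [moduleR : Module B.R carrier]
  [moduleA : Module B.A carrier]
  [tower : IsScalarTower B.R B.A carrier]
  /-- the homogeneous components -/
  gr : B.Γ → AddSubgroup carrier
  internal : DirectSum.IsInternal gr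
  smul_mem : ∀ {i j : B.Γ} {r : B.R} {x : carrier}, r ∈ B.gr i → x ∈ gr j → r • x ∈ gr (i + j)
  Sq1_mem : ∀ {i : B.Γ} {x : carrier}, x ∈ gr i → B.Sq1 • x ∈ gr (i + B.e1)
  Sq2_mem : ∀ {i : B.Γ} {x : carrier}, x ∈ gr i → B.Sq2 • x ∈ gr (i + B.e2)
  [finite : Module.Finite B.R carrier]
  [projective : Module.Projective B.R carrier]

attribute [instance] Obj.addCommGroup Obj.moduleR Obj.moduleA Obj.tower Obj.finite Obj.projective

variable {B}

/-- Degree-preserving isomorphisms of graded `A(1)`-modules. -/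
structure Iso (X Y : Obj B) where
  /-- the underlying linear equivalence -/
  equiv : X.carrier ≃ₗ[B.A] Y.carrier
  map_mem : ∀ {i : B.Γ} {x : X.carrier}, x ∈ X.gr i → equiv x ∈ Y.gr i
  symm_mem : ∀ {i : B.Γ} {y : Y.carrier}, y ∈ Y.gr i → equiv.symm y ∈ X.gr i

namespace Iso

variable {X Y Z : Obj B}

/-- The identity isomorphism. -/
noncomputable def refl (X : Obj B) : Iso X X := ⟨LinearEquiv.refl _ _, id, id⟩

/-- The inverse isomorphism. -/
noncomputable def symm (e : Iso X Y) : Iso Y X := ⟨e.equiv.symm, e.symm_mem, e.map_mem⟩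

/-- The composition of isomorphisms. -/
noncomputable def trans (e : Iso X Y) (f : Iso Y Z) : Iso X Z :=
  ⟨e.equiv.trans f.equiv, fun h => f.map_mem (e.map_mem h), fun h => e.symm_mem (f.symm_mem h)⟩

end Iso

namespace Obj

/-- The direct sum. -/
noncomputable def sum (X Y : Obj B) : Obj B where
  carrier := X.carrier × Y.carrier
  gr i := (X.gr i).prod (Y.gr i)
  internal := by
    refine isInternal_of_components
      (((Finsupp.mapRange.addMonoidHom (AddMonoidHom.inl _ _)).comp
          (components X.internal)).coprod
        ((Finsupp.mapRange.addMonoidHom (AddMonoidHom.inr _ _)).comp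
          (components Y.internal))) ?_ ?_
    · rintro i ⟨x, y⟩ ⟨hx, hy⟩
      simp [components_of_mem X.internal hx, components_of_mem Y.internal hy,
        ← Finsupp.single_add]
    · rintro ⟨x, y⟩
      have hx : ((x, 0) : X.carrier × Y.carrier) ∈ AddSubgroup.closure
          {x | ∃ i, x ∈ (X.gr i).prod (Y.gr i)} :=
        graded_induction X.internal (p := fun x => ((x, 0) : X.carrier × Y.carrier) ∈ _) x
          (zero_mem _) (fun a b ha hb => by simpa using add_mem ha hb)
          (fun i a ha => AddSubgroup.subset_closure ⟨i, ha, zero_mem _⟩)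
      have hy : ((0, y) : X.carrier × Y.carrier) ∈ AddSubgroup.closure
          {x | ∃ i, x ∈ (X.gr i).prod (Y.gr i)} :=
        graded_induction Y.internal (p := fun y => ((0, y) : X.carrier × Y.carrier) ∈ _) y
          (zero_mem _) (fun a b ha hb => by simpa using add_mem ha hb)
          (fun i a ha => AddSubgroup.subset_closure ⟨i, zero_mem _, ha⟩)
      simpa using add_mem hx hy
  smul_mem hr hx := ⟨X.smul_mem hr hx.1, Y.smul_mem hr hx.2⟩
  Sq1_mem hx := ⟨X.Sq1_mem hx.1, Y.Sq1_mem hx.2⟩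
  Sq2_mem hx := ⟨X.Sq2_mem hx.1, Y.Sq2_mem hx.2⟩

/-- The coefficient ring, the tensor unit. -/
noncomputable def unit (B : SteenrodBase) : Obj B where
  carrier := B.R
  gr := B.gr
  internal := B.internal
  smul_mem := B.mul_mem
  Sq1_mem {i x} hx := by rw [Sq1_unit]; exact B.sq1_mem hx
  Sq2_mem {i x} hx := by rw [Sq2_unit]; exact B.sq2_mem hx

/-- The degree shift: `(Σᵈ X)ᵢ = Xᵢ₋d`. -/
noncomputable def shift (d : B.Γ) (X : Obj B) : Obj B where
  carrier := X.carrier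
  gr i := X.gr (i - d)
  internal := by
    refine isInternal_of_components
      ((Finsupp.mapDomain.addMonoidHom (fun i => i + d)).comp (components X.internal)) ?_ ?_
    · intro i x hx
      simp [components_of_mem X.internal hx, Finsupp.mapDomain_single]
    · intro x
      refine graded_induction X.internal (p := fun x => x ∈ _) x (zero_mem _)
        (fun a b ha hb => add_mem ha hb) (fun i a ha => AddSubgroup.subset_closure ⟨i + d, ?_⟩)
      rwa [add_sub_cancel_right]
  smul_mem {i j r x} hr hx := by
    have := X.smul_mem hr hx
    rwa [← add_sub_assoc] at this
  Sq1_mem {i x} hx := by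
    have := X.Sq1_mem hx
    rwa [sub_add_eq_add_sub] at this
  Sq2_mem {i x} hx := by
    have := X.Sq2_mem hx
    rwa [sub_add_eq_add_sub] at this

end Obj

section tensor

variable {M N : Type} [AddCommGroup M] [Module B.R M] [Module B.A M] [IsScalarTower B.R B.A M]
  [AddCommGroup N] [Module B.R N] [Module B.A N] [IsScalarTower B.R B.A N]

theorem Sq1_smul_smul (r : B.R) (m : M) : B.Sq1 • r • m = r • B.Sq1 • m + B.sq1 r • m :=
  (B.isAction_op M).sq1_smul r m

theorem Sq2_smul_smul (r : B.R) (m : M) :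
    B.Sq2 • r • m = r • B.Sq2 • m + (B.τ * B.sq1 r) • B.Sq1 • m + B.sq2 r • m :=
  (B.isAction_op M).sq2_smul r m

theorem Sq1_Sq1_smul (m : M) : B.Sq1 • B.Sq1 • m = 0 :=
  (B.isAction_op M).sq1_sq1 m

theorem Sq2_Sq2_smul (m : M) : B.Sq2 • B.Sq2 • m = B.τ • B.Sq1 • B.Sq2 • B.Sq1 • m :=
  (B.isAction_op M).sq2_sq2 m

theorem braid_smul (m : M) :
    B.Sq1 • B.Sq2 • B.Sq1 • B.Sq2 • m = B.Sq2 • B.Sq1 • B.Sq2 • B.Sq1 • m :=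
  (B.isAction_op M).braid m

variable (B M N) in
/-- `Sq¹` on a tensor product: `Sq¹(x ⊗ y) = Sq¹x ⊗ y + x ⊗ Sq¹y`. -/
noncomputable def tsq1 : M ⊗[B.R] N →+ M ⊗[B.R] N :=
  TensorProduct.liftAddHom
    (AddMonoidHom.mk' (fun x => AddMonoidHom.mk'
      (fun y => (B.Sq1 • x) ⊗ₜ[B.R] y + x ⊗ₜ[B.R] (B.Sq1 • y))
      (fun a b => by simp only [smul_add, TensorProduct.tmul_add]; abel))
      (fun a b => by
        ext y
        simp only [smul_add, TensorProduct.add_tmul, AddMonoidHom.mk'_apply,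
          AddMonoidHom.add_apply]; abel))
    (fun r x y => by
      simp only [AddMonoidHom.mk'_apply, Sq1_smul_smul, TensorProduct.add_tmul,
        TensorProduct.tmul_add, TensorProduct.smul_tmul]; abel)

variable (B M N) in
/-- `Sq²` on a tensor product: `Sq²(x ⊗ y) = Sq²x ⊗ y + τ (Sq¹x ⊗ Sq¹y) + x ⊗ Sq²y`. -/
noncomputable def tsq2 : M ⊗[B.R] N →+ M ⊗[B.R] N :=
  TensorProduct.liftAddHom
    (AddMonoidHom.mk' (fun x => AddMonoidHom.mk'
      (fun y => (B.Sq2 • x) ⊗ₜ[B.R] y + B.τ • ((B.Sq1 • x) ⊗ₜ[B.R] (B.Sq1 • y)) +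
        x ⊗ₜ[B.R] (B.Sq2 • y))
      (fun a b => by simp only [smul_add, TensorProduct.tmul_add]; abel))
      (fun a b => by
        ext y
        simp only [smul_add, TensorProduct.add_tmul, AddMonoidHom.mk'_apply,
          AddMonoidHom.add_apply]; abel))
    (fun r x y => by
      simp only [AddMonoidHom.mk'_apply, Sq1_smul_smul, Sq2_smul_smul, TensorProduct.add_tmul,
        TensorProduct.tmul_add, ← TensorProduct.smul_tmul', TensorProduct.tmul_smul]; module)

theorem tsq1_tmul (x : M) (y : N) :
    tsq1 B M N (x ⊗ₜ y) = (B.Sq1 • x) ⊗ₜ[B.R] y + x ⊗ₜ[B.R] (B.Sq1 • y) := rfl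

theorem tsq2_tmul (x : M) (y : N) :
    tsq2 B M N (x ⊗ₜ y) = (B.Sq2 • x) ⊗ₜ[B.R] y + B.τ • ((B.Sq1 • x) ⊗ₜ[B.R] (B.Sq1 • y)) +
      x ⊗ₜ[B.R] (B.Sq2 • y) := rfl

variable (B) in
theorem two_zsmul_eq_zero {T : Type} [AddCommGroup T] [Module B.R T] (t : T) :
    (2 : ℤ) • t = 0 := by
  rw [two_zsmul, ← two_smul B.R t, B.two_eq_zero, zero_smul]

variable (B) in
theorem four_zsmul_eq_zero {T : Type} [AddCommGroup T] [Module B.R T] (t : T) :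
    (4 : ℤ) • t = 0 := by
  rw [show (4 : ℤ) = 2 * 2 from rfl, mul_smul, two_zsmul_eq_zero B]

variable (B) in
theorem eq_of_add_eq_zero {T : Type} [AddCommGroup T] [Module B.R T] {s t : T}
    (h : s + t = 0) : s = t := by
  have h2 := two_zsmul_eq_zero B t
  rw [two_zsmul] at h2
  exact add_right_cancel (h.trans h2.symm)

theorem tsq1_smul (r : B.R) (t : M ⊗[B.R] N) :
    tsq1 B M N (r • t) = r • tsq1 B M N t + B.sq1 r • t := by
  induction t with
  | zero => simp
  | tmul x y =>
    rw [TensorProduct.smul_tmul', tsq1_tmul, tsq1_tmul, Sq1_smul_smul]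
    simp only [TensorProduct.add_tmul, smul_add, ← TensorProduct.smul_tmul']
    abel
  | add x y hx hy => simp only [smul_add, map_add, hx, hy]; abel

theorem tsq2_smul (r : B.R) (t : M ⊗[B.R] N) :
    tsq2 B M N (r • t) =
      r • tsq2 B M N t + (B.τ * B.sq1 r) • tsq1 B M N t + B.sq2 r • t := by
  induction t with
  | zero => simp
  | tmul x y =>
    rw [TensorProduct.smul_tmul', tsq2_tmul, tsq2_tmul, tsq1_tmul, Sq1_smul_smul, Sq2_smul_smul]
    simp only [TensorProduct.add_tmul, smul_add, ← TensorProduct.smul_tmul', mul_smul,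
      smul_comm r B.τ]
    abel
  | add x y hx hy => simp only [smul_add, map_add, hx, hy]; abel

variable (B M N) in
theorem isAction_tensor : B.IsAction (tsq1 B M N) (tsq2 B M N) where
  sq1_smul := tsq1_smul
  sq2_smul := tsq2_smul
  sq1_sq1 t := by
    induction t with
    | zero => simp
    | tmul x y =>
      simp only [tsq1_tmul, map_add, Sq1_Sq1_smul, TensorProduct.zero_tmul,
        TensorProduct.tmul_zero, zero_add, add_zero]
      rw [← two_smul B.R, B.two_eq_zero, zero_smul]
    | add x y hx hy => simp only [map_add, hx, hy, add_zero]
  sq2_sq2 t := by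
    induction t with
    | zero => simp
    | tmul x y =>
      have hR : ∀ (r s : B.R) (t : M ⊗[B.R] N), r • s • t = (r * s) • t := fun r s t =>
        smul_smul r s t
      simp only [tsq1_tmul, tsq2_tmul, map_add, Sq1_Sq1_smul, Sq2_Sq2_smul, tsq2_smul, hR,
        TensorProduct.zero_tmul, TensorProduct.tmul_zero, zero_add, add_zero, B.sq2_τ, zero_smul,
        smul_zero, smul_add, ← TensorProduct.smul_tmul', TensorProduct.tmul_smul]
      apply eq_of_add_eq_zero B
      abel_nf
      simp only [two_zsmul_eq_zero B, zero_add, add_zero]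
    | add x y hx hy => simp only [map_add, hx, hy, smul_add]
  braid t := by
    induction t with
    | zero => simp
    | tmul x y =>
      have hR : ∀ (r s : B.R) (t : M ⊗[B.R] N), r • s • t = (r * s) • t := fun r s t =>
        smul_smul r s t
      simp only [tsq1_tmul, tsq2_tmul, map_add, Sq1_Sq1_smul, Sq2_Sq2_smul, tsq2_smul, tsq1_smul,
        TensorProduct.zero_tmul, TensorProduct.tmul_zero, zero_add, add_zero, B.sq2_τ, zero_smul,
        smul_zero, smul_add, B.sq1_sq1, B.sq2_sq1_τ, B.sq1_mul, add_smul, mul_zero,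
        zero_mul, braid_smul, Sq1_smul_smul, TensorProduct.add_tmul, TensorProduct.tmul_add,
        ← TensorProduct.smul_tmul', TensorProduct.tmul_smul, hR]
      apply eq_of_add_eq_zero B
      abel_nf
      simp only [two_zsmul_eq_zero B, add_zero, zero_add]
    | add x y hx hy => simp only [map_add, hx, hy]

/-- The `A(1)`-module structure on a tensor product over the coefficients. -/
noncomputable instance : Module B.A (M ⊗[B.R] N) := (isAction_tensor B M N).module

instance : IsScalarTower B.R B.A (M ⊗[B.R] N) := (isAction_tensor B M N).tower

theorem Sq1_tmul (x : M) (y : N) :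
    B.Sq1 • (x ⊗ₜ[B.R] y) = (B.Sq1 • x) ⊗ₜ[B.R] y + x ⊗ₜ[B.R] (B.Sq1 • y) :=
  (isAction_tensor B M N).Sq1_smul _

theorem Sq2_tmul (x : M) (y : N) :
    B.Sq2 • (x ⊗ₜ[B.R] y) = (B.Sq2 • x) ⊗ₜ[B.R] y + B.τ • ((B.Sq1 • x) ⊗ₜ[B.R] (B.Sq1 • y)) +
      x ⊗ₜ[B.R] (B.Sq2 • y) :=
  (isAction_tensor B M N).Sq2_smul _

end tensor

section internalHom

variable {M N P : Type} [AddCommGroup M] [Module B.R M] [Module B.A M] [IsScalarTower B.R B.A M]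
  [AddCommGroup N] [Module B.R N] [Module B.A N] [IsScalarTower B.R B.A N]
  [AddCommGroup P] [Module B.R P] [Module B.A P] [IsScalarTower B.R B.A P]

variable (B M N) in
/-- `Sq¹` on the internal hom. -/
noncomputable def hsq1 : (M →ₗ[B.R] N) →+ (M →ₗ[B.R] N) :=
  AddMonoidHom.mk' (fun f =>
    { toFun := fun m => B.Sq1 • f m + f (B.Sq1 • m)
      map_add' := fun a b => by simp only [map_add, smul_add]; abel
      map_smul' := fun r m => by
        apply eq_of_add_eq_zero B
        simp only [map_add, map_smul, smul_add, Sq1_smul_smul, RingHom.id_apply]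
        abel_nf
        simp only [two_zsmul_eq_zero B, zero_add, add_zero] })
    (fun f g => by
      ext m
      simp only [LinearMap.coe_mk, AddHom.coe_mk, LinearMap.add_apply, smul_add]; abel)

variable (B M N) in
/-- `Sq²` on the internal hom. -/
noncomputable def hsq2 : (M →ₗ[B.R] N) →+ (M →ₗ[B.R] N) :=
  AddMonoidHom.mk' (fun f =>
    { toFun := fun m => B.Sq2 • f m + B.τ • B.Sq1 • f (B.Sq1 • m) + f (B.Sq2 • m)
      map_add' := fun a b => by simp only [map_add, smul_add]; abel
      map_smul' := fun r m => by
        apply eq_of_add_eq_zero B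
        simp only [map_add, map_smul, smul_add, Sq1_smul_smul, Sq2_smul_smul, RingHom.id_apply,
          mul_smul, smul_comm r B.τ, B.sq1_sq1, zero_smul, add_zero]
        abel_nf
        simp only [two_zsmul_eq_zero B, zero_add, add_zero] })
    (fun f g => by
      ext m
      simp only [LinearMap.coe_mk, AddHom.coe_mk, LinearMap.add_apply, smul_add]; abel)

theorem hsq1_apply (f : M →ₗ[B.R] N) (m : M) :
    hsq1 B M N f m = B.Sq1 • f m + f (B.Sq1 • m) := rfl

theorem hsq2_apply (f : M →ₗ[B.R] N) (m : M) :
    hsq2 B M N f m = B.Sq2 • f m + B.τ • B.Sq1 • f (B.Sq1 • m) + f (B.Sq2 • m) := rfl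

variable (B M N) in
theorem isAction_hom : B.IsAction (hsq1 B M N) (hsq2 B M N) where
  sq1_smul r f := by
    ext m
    simp only [hsq1_apply, LinearMap.add_apply, LinearMap.smul_apply, Sq1_smul_smul, smul_add]
    abel
  sq2_smul r f := by
    ext m
    apply eq_of_add_eq_zero B
    simp only [hsq1_apply, hsq2_apply, LinearMap.add_apply, LinearMap.smul_apply, Sq1_smul_smul,
      Sq2_smul_smul, smul_add, mul_smul, smul_comm r B.τ]
    abel_nf
    simp only [two_zsmul_eq_zero B, zero_add, add_zero]
  sq1_sq1 f := by
    ext m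
    simp only [hsq1_apply, Sq1_Sq1_smul, smul_add, map_zero, zero_add, add_zero,
      LinearMap.zero_apply]
    abel_nf
    simp only [two_zsmul_eq_zero B, zero_add, add_zero]
  sq2_sq2 f := by
    ext m
    apply eq_of_add_eq_zero B
    simp only [hsq1_apply, hsq2_apply, LinearMap.smul_apply, smul_add, map_add, map_smul,
      Sq1_Sq1_smul, Sq2_Sq2_smul, Sq1_smul_smul, Sq2_smul_smul, map_zero, smul_zero,
      zero_add, add_zero, B.sq2_τ, zero_smul, mul_smul]
    abel_nf
    simp only [two_zsmul_eq_zero B, zero_add, add_zero]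
  braid f := by
    ext m
    apply eq_of_add_eq_zero B
    simp only [hsq1_apply, hsq2_apply, LinearMap.smul_apply, smul_add, map_add, map_smul,
      Sq1_Sq1_smul, Sq2_Sq2_smul, Sq1_smul_smul, Sq2_smul_smul, map_zero, smul_zero,
      zero_add, add_zero, B.sq2_τ, zero_smul, mul_smul, braid_smul, B.sq1_sq1, B.sq2_sq1_τ]
    abel_nf
    simp only [two_zsmul_eq_zero B, four_zsmul_eq_zero B, zero_add, add_zero]

/-- The `A(1)`-module structure on the internal hom. -/
noncomputable instance : Module B.A (M →ₗ[B.R] N) := (isAction_hom B M N).module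

instance : IsScalarTower B.R B.A (M →ₗ[B.R] N) := (isAction_hom B M N).tower

theorem Sq1_hom (f : M →ₗ[B.R] N) (m : M) :
    (B.Sq1 • f) m = B.Sq1 • f m + f (B.Sq1 • m) :=
  congrArg (fun g : M →ₗ[B.R] N => g m) ((isAction_hom B M N).Sq1_smul f)

theorem Sq2_hom (f : M →ₗ[B.R] N) (m : M) :
    (B.Sq2 • f) m = B.Sq2 • f m + B.τ • B.Sq1 • f (B.Sq1 • m) + f (B.Sq2 • m) :=
  congrArg (fun g : M →ₗ[B.R] N => g m) ((isAction_hom B M N).Sq2_smul f)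

theorem map_coeff_smul (f : M →ₗ[B.A] N) (r : B.R) (m : M) : f (r • m) = r • f m := by
  rw [← coeff_smul, map_smul, coeff_smul]

/-- The tensor product of a projective `A(1)`-module with a module that is projective over the
coefficients is a projective `A(1)`-module. -/
theorem projective_tensor [Module.Projective B.A P] [Module.Projective B.R M] :
    Module.Projective B.A (P ⊗[B.R] M) := by
  refine Module.Projective.of_lifting_property'' fun f hf => ?_
  let q : P →ₗ[B.A] (M →ₗ[B.R] P ⊗[B.R] M) :=
    { toFun := fun p => TensorProduct.mk B.R P M p
      map_add' := fun a b => map_add _ a b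
      map_smul' := map_smul_of_gen (TensorProduct.mk B.R P M).toAddMonoidHom
        (fun r m => (TensorProduct.mk B.R P M).map_smul r m)
        (fun p => by
          ext m
          apply eq_of_add_eq_zero B
          simp only [LinearMap.toAddMonoidHom_coe, Sq1_hom, TensorProduct.mk_apply, Sq1_tmul]
          abel_nf
          simp only [two_zsmul_eq_zero B, zero_add, add_zero])
        (fun p => by
          ext m
          apply eq_of_add_eq_zero B
          simp only [LinearMap.toAddMonoidHom_coe, Sq2_hom, TensorProduct.mk_apply, Sq1_tmul,
            Sq2_tmul, Sq1_Sq1_smul, TensorProduct.tmul_zero, add_zero]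
          abel_nf
          simp only [two_zsmul_eq_zero B, zero_add, add_zero]) }
  let fR : (P ⊗[B.R] M →₀ B.A) →ₗ[B.R] P ⊗[B.R] M :=
    { toFun := f, map_add' := map_add f, map_smul' := map_coeff_smul f }
  let fs : (M →ₗ[B.R] (P ⊗[B.R] M →₀ B.A)) →ₗ[B.A] (M →ₗ[B.R] P ⊗[B.R] M) :=
    { toFun := fun g => fR.comp g
      map_add' := fun a b => LinearMap.comp_add _ _ _
      map_smul' := map_smul_of_gen
        (AddMonoidHom.mk' (fun g => fR.comp g) (fun a b => LinearMap.comp_add _ _ _))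
        (fun r g => LinearMap.comp_smul _ _ _)
        (fun g => by
          ext m
          simp only [AddMonoidHom.mk'_apply, Sq1_hom, LinearMap.comp_apply, map_add]
          simp only [fR, LinearMap.coe_mk, AddHom.coe_mk, map_smul])
        (fun g => by
          ext m
          simp only [AddMonoidHom.mk'_apply, Sq2_hom, LinearMap.comp_apply, map_add]
          simp only [fR, LinearMap.coe_mk, AddHom.coe_mk, map_smul, map_coeff_smul]) }
  obtain ⟨g, hg⟩ := Module.projective_lifting_property fs q fun k => by
    obtain ⟨l, hl⟩ := Module.projective_lifting_property fR k hf
    exact ⟨l, hl⟩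
  let gR : P →ₗ[B.R] M →ₗ[B.R] (P ⊗[B.R] M →₀ B.A) :=
    { toFun := g, map_add' := map_add g, map_smul' := map_coeff_smul g }
  have hgR : ∀ (p : P) (m : M), f (gR p m) = p ⊗ₜ m := fun p m =>
    congrArg (fun k : M →ₗ[B.R] P ⊗[B.R] M => k m) (LinearMap.congr_fun hg p)
  have hg1 : ∀ (p : P) (m : M), gR (B.Sq1 • p) m = B.Sq1 • gR p m + gR p (B.Sq1 • m) :=
    fun p m => by
      have : gR (B.Sq1 • p) = B.Sq1 • gR p := map_smul g _ _
      rw [this, Sq1_hom]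
  have hg2 : ∀ (p : P) (m : M), gR (B.Sq2 • p) m =
      B.Sq2 • gR p m + B.τ • B.Sq1 • gR p (B.Sq1 • m) + gR p (B.Sq2 • m) :=
    fun p m => by
      have : gR (B.Sq2 • p) = B.Sq2 • gR p := map_smul g _ _
      rw [this, Sq2_hom]
  let h := TensorProduct.lift gR
  refine ⟨{ toFun := h, map_add' := map_add h, map_smul' := (map_smul_of_gen h.toAddMonoidHom
    (fun r t => h.map_smul r t) ?_ ?_) }, ?_⟩
  · intro t
    change h _ = B.Sq1 • h _
    induction t with
    | zero => simp
    | tmul p m =>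
      apply eq_of_add_eq_zero B
      simp only [Sq1_tmul, map_add, h, TensorProduct.lift.tmul, hg1]
      abel_nf
      simp only [two_zsmul_eq_zero B, zero_add, add_zero]
    | add x y hx hy => simp only [smul_add, map_add, hx, hy]
  · intro t
    change h _ = B.Sq2 • h _
    induction t with
    | zero => simp
    | tmul p m =>
      apply eq_of_add_eq_zero B
      simp only [Sq2_tmul, map_add, map_smul, h, TensorProduct.lift.tmul, hg1, hg2,
        Sq1_Sq1_smul, map_zero, add_zero, smul_add]
      abel_nf
      simp only [two_zsmul_eq_zero B, zero_add, add_zero]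
    | add x y hx hy => simp only [smul_add, map_add, hx, hy]
  · ext t
    change f (h t) = t
    induction t with
    | zero => simp
    | tmul p m => exact hgR p m
    | add x y hx hy => simp only [map_add, hx, hy]

end internalHom

namespace Obj

/-- The additive map underlying the tensor product. -/
noncomputable def tmulHom (X Y : Obj B) :
    X.carrier →+ Y.carrier →+ X.carrier ⊗[B.R] Y.carrier :=
  AddMonoidHom.mk' (fun x => (TensorProduct.mk B.R X.carrier Y.carrier x).toAddMonoidHom)
    (fun a b => by ext y; exact TensorProduct.add_tmul a b y)

/-- The components of an element of a tensor product, before passing to the tensor product. -/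
noncomputable def preComponents (X Y : Obj B) :
    X.carrier →+ Y.carrier →+ (B.Γ →₀ X.carrier ⊗[B.R] Y.carrier) :=
  let p : (B.Γ →₀ X.carrier) →+ (B.Γ →₀ Y.carrier) →+ (B.Γ →₀ X.carrier ⊗[B.R] Y.carrier) :=
    Finsupp.liftAddHom fun i => AddMonoidHom.flip (Finsupp.liftAddHom fun j =>
      AddMonoidHom.flip ((tmulHom X Y).compr₂ (Finsupp.singleAddHom (i + j))))
  (((p.comp (components X.internal)).flip).comp (components Y.internal)).flip

theorem preComponents_apply (X Y : Obj B) {i j : B.Γ} {x : X.carrier} {y : Y.carrier}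
    (hx : x ∈ X.gr i) (hy : y ∈ Y.gr j) :
    preComponents X Y x y = Finsupp.single (i + j) (x ⊗ₜ y) := by
  simp [preComponents, components_of_mem X.internal hx, components_of_mem Y.internal hy, tmulHom]

theorem preComponents_smul (X Y : Obj B) (r : B.R) (x : X.carrier) (y : Y.carrier) :
    preComponents X Y (r • x) y = preComponents X Y x (r • y) := by
  refine graded_induction B.internal (p := fun r =>
    preComponents X Y (r • x) y = preComponents X Y x (r • y)) r (by simp)
    (fun r s hr hs => by simp only [add_smul, map_add, AddMonoidHom.add_apply, hr, hs]) ?_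
  intro k r hr
  refine graded_induction X.internal (p := fun x =>
    preComponents X Y (r • x) y = preComponents X Y x (r • y)) x (by simp)
    (fun a b ha hb => by simp only [smul_add, map_add, AddMonoidHom.add_apply, ha, hb]) ?_
  intro i x hx
  refine graded_induction Y.internal (p := fun y =>
    preComponents X Y (r • x) y = preComponents X Y x (r • y)) y (by simp)
    (fun a b ha hb => by simp only [smul_add, map_add, ha, hb]) ?_
  intro j y hy
  rw [preComponents_apply X Y (X.smul_mem hr hx) hy, preComponents_apply X Y hx (Y.smul_mem hr hy),
    TensorProduct.smul_tmul, add_comm k i, add_assoc]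

/-- The homogeneous components of a tensor product: the component of degree `d` is generated by
the `x ⊗ y` with `x`, `y` homogeneous of degrees adding up to `d`. -/
def tensorGr (X Y : Obj B) (d : B.Γ) : AddSubgroup (X.carrier ⊗[B.R] Y.carrier) :=
  AddSubgroup.closure {t | ∃ i j x y, x ∈ X.gr i ∧ y ∈ Y.gr j ∧ i + j = d ∧ x ⊗ₜ y = t}

theorem tmul_mem (X Y : Obj B) {i j d : B.Γ} {x : X.carrier} {y : Y.carrier}
    (hx : x ∈ X.gr i) (hy : y ∈ Y.gr j) (h : i + j = d) : x ⊗ₜ y ∈ tensorGr X Y d :=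
  AddSubgroup.subset_closure ⟨i, j, x, y, hx, hy, h, rfl⟩

theorem tensorGr_induction (X Y : Obj B) {T : Type} [AddCommGroup T]
    (f : X.carrier ⊗[B.R] Y.carrier →+ T) (S : AddSubgroup T) {d : B.Γ}
    (h : ∀ i j x y, x ∈ X.gr i → y ∈ Y.gr j → i + j = d → f (x ⊗ₜ y) ∈ S)
    {t : X.carrier ⊗[B.R] Y.carrier} (ht : t ∈ tensorGr X Y d) : f t ∈ S := by
  have : tensorGr X Y d ≤ S.comap f := by
    rw [tensorGr, AddSubgroup.closure_le]
    rintro _ ⟨i, j, x, y, hx, hy, hd, rfl⟩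
    exact h i j x y hx hy hd
  exact this ht

/-- The tensor product over the coefficients. -/
noncomputable def tensor (X Y : Obj B) : Obj B where
  carrier := X.carrier ⊗[B.R] Y.carrier
  gr := tensorGr X Y
  internal := by
    refine isInternal_of_components
      (TensorProduct.liftAddHom (preComponents X Y) (preComponents_smul X Y)) ?_ ?_
    · intro d t ht
      have := tensorGr_induction X Y
        (TensorProduct.liftAddHom (preComponents X Y) (preComponents_smul X Y) -
          Finsupp.singleAddHom d) ⊥ (fun i j x y hx hy hd => by
            subst hd
            rw [AddSubgroup.mem_bot, AddMonoidHom.sub_apply, TensorProduct.liftAddHom_tmul,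
              preComponents_apply X Y hx hy, Finsupp.singleAddHom_apply, sub_self]) ht
      rwa [AddSubgroup.mem_bot, AddMonoidHom.sub_apply, sub_eq_zero] at this
    · intro t
      induction t with
      | zero => exact zero_mem _
      | add a b ha hb => exact add_mem ha hb
      | tmul x y =>
        refine graded_induction X.internal (p := fun x => x ⊗ₜ[B.R] y ∈ _) x
          (by simp only [TensorProduct.zero_tmul]; exact zero_mem _)
          (fun a b ha hb => by simp only [TensorProduct.add_tmul]; exact add_mem ha hb) ?_
        intro i x hx
        refine graded_induction Y.internal (p := fun y => x ⊗ₜ[B.R] y ∈ _) y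
          (by simp only [TensorProduct.tmul_zero]; exact zero_mem _)
          (fun a b ha hb => by simp only [TensorProduct.tmul_add]; exact add_mem ha hb) ?_
        intro j y hy
        exact AddSubgroup.subset_closure ⟨i + j, tmul_mem X Y hx hy rfl⟩
  smul_mem {k d r t} hr ht :=
    tensorGr_induction X Y (DistribSMul.toAddMonoidHom _ r) _ (fun i j x y hx hy hd => by
      change r • (x ⊗ₜ[B.R] y) ∈ _
      rw [TensorProduct.smul_tmul']
      exact tmul_mem X Y (X.smul_mem hr hx) hy (by rw [← hd, add_assoc])) ht
  Sq1_mem {d t} ht :=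
    tensorGr_induction X Y (DistribSMul.toAddMonoidHom _ B.Sq1) _ (fun i j x y hx hy hd => by
      change B.Sq1 • (x ⊗ₜ[B.R] y) ∈ _
      rw [Sq1_tmul]
      exact add_mem (tmul_mem X Y (X.Sq1_mem hx) hy (by rw [← hd]; abel))
        (tmul_mem X Y hx (Y.Sq1_mem hy) (by rw [← hd]; abel))) ht
  Sq2_mem {d t} ht :=
    tensorGr_induction X Y (DistribSMul.toAddMonoidHom _ B.Sq2) _ (fun i j x y hx hy hd => by
      change B.Sq2 • (x ⊗ₜ[B.R] y) ∈ _
      rw [Sq2_tmul, TensorProduct.smul_tmul']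
      exact add_mem (add_mem (tmul_mem X Y (X.Sq2_mem hx) hy (by rw [← hd]; abel))
        (tmul_mem X Y (X.smul_mem B.τ_mem (X.Sq1_mem hx)) (Y.Sq1_mem hy) (by rw [← hd]; abel)))
        (tmul_mem X Y hx (Y.Sq2_mem hy) (by rw [← hd]; abel))) ht

end Obj

namespace Iso

/-- An isomorphism from a linear equivalence over the coefficients that commutes with the
operations. -/
noncomputable def ofEquiv {X Y : Obj B} (e : X.carrier ≃ₗ[B.R] Y.carrier)
    (h1 : ∀ x, e (B.Sq1 • x) = B.Sq1 • e x) (h2 : ∀ x, e (B.Sq2 • x) = B.Sq2 • e x)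
    (hm : ∀ i x, x ∈ X.gr i → e x ∈ Y.gr i) (hs : ∀ i y, y ∈ Y.gr i → e.symm y ∈ X.gr i) :
    Iso X Y where
  equiv := equivOfGen e.toAddEquiv (fun r t => e.map_smul r t) h1 h2
  map_mem {i x} hx := hm i x hx
  symm_mem {i y} hy := hs i y hy

/-- The linear equivalence over the coefficients. -/
noncomputable def equivR {X Y : Obj B} (e : Iso X Y) : X.carrier ≃ₗ[B.R] Y.carrier :=
  { e.equiv.toAddEquiv with
    map_smul' := map_coeff_smul e.equiv.toLinearMap }

theorem equivR_Sq1 {X Y : Obj B} (e : Iso X Y) (x : X.carrier) :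
    e.equivR (B.Sq1 • x) = B.Sq1 • e.equivR x := e.equiv.map_smul _ _

theorem equivR_Sq2 {X Y : Obj B} (e : Iso X Y) (x : X.carrier) :
    e.equivR (B.Sq2 • x) = B.Sq2 • e.equivR x := e.equiv.map_smul _ _

end Iso

section tensorMaps

variable {M N P M' N' : Type} [AddCommGroup M] [Module B.R M] [Module B.A M]
  [IsScalarTower B.R B.A M]
  [AddCommGroup N] [Module B.R N] [Module B.A N] [IsScalarTower B.R B.A N]
  [AddCommGroup P] [Module B.R P] [Module B.A P] [IsScalarTower B.R B.A P]
  [AddCommGroup M'] [Module B.R M'] [Module B.A M'] [IsScalarTower B.R B.A M']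
  [AddCommGroup N'] [Module B.R N'] [Module B.A N'] [IsScalarTower B.R B.A N']

theorem map_smul_of_tmul (a : B.A) (f : M ⊗[B.R] N →ₗ[B.R] P)
    (h : ∀ x y, f (a • (x ⊗ₜ y)) = a • f (x ⊗ₜ y)) (t : M ⊗[B.R] N) : f (a • t) = a • f t := by
  induction t with
  | zero => simp only [smul_zero, map_zero]
  | tmul x y => exact h x y
  | add x y hx hy => simp only [smul_add, map_add, hx, hy]

theorem congr_Sq1 (e : M ≃ₗ[B.R] M') (f : N ≃ₗ[B.R] N')
    (he : ∀ x, e (B.Sq1 • x) = B.Sq1 • e x) (hf : ∀ x, f (B.Sq1 • x) = B.Sq1 • f x)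
    (t : M ⊗[B.R] N) :
    TensorProduct.congr e f (B.Sq1 • t) = B.Sq1 • TensorProduct.congr e f t :=
  map_smul_of_tmul _ (TensorProduct.congr e f).toLinearMap (fun x y => by
    simp only [LinearEquiv.coe_coe, Sq1_tmul, map_add, TensorProduct.congr_tmul, he, hf]) t

theorem congr_Sq2 (e : M ≃ₗ[B.R] M') (f : N ≃ₗ[B.R] N')
    (he : ∀ x, e (B.Sq1 • x) = B.Sq1 • e x) (hf : ∀ x, f (B.Sq1 • x) = B.Sq1 • f x)
    (he2 : ∀ x, e (B.Sq2 • x) = B.Sq2 • e x) (hf2 : ∀ x, f (B.Sq2 • x) = B.Sq2 • f x)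
    (t : M ⊗[B.R] N) :
    TensorProduct.congr e f (B.Sq2 • t) = B.Sq2 • TensorProduct.congr e f t :=
  map_smul_of_tmul _ (TensorProduct.congr e f).toLinearMap (fun x y => by
    simp only [LinearEquiv.coe_coe, Sq2_tmul, map_add, map_smul, TensorProduct.congr_tmul, he, hf,
      he2, hf2]) t

theorem comm_Sq1 (t : M ⊗[B.R] N) :
    TensorProduct.comm B.R M N (B.Sq1 • t) = B.Sq1 • TensorProduct.comm B.R M N t :=
  map_smul_of_tmul _ (TensorProduct.comm B.R M N).toLinearMap (fun x y => by
    simp only [LinearEquiv.coe_coe, Sq1_tmul, map_add, TensorProduct.comm_tmul]; abel) t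

theorem comm_Sq2 (t : M ⊗[B.R] N) :
    TensorProduct.comm B.R M N (B.Sq2 • t) = B.Sq2 • TensorProduct.comm B.R M N t :=
  map_smul_of_tmul _ (TensorProduct.comm B.R M N).toLinearMap (fun x y => by
    simp only [LinearEquiv.coe_coe, Sq2_tmul, map_add, map_smul, TensorProduct.comm_tmul]; abel) t

theorem assoc_Sq1 (t : (M ⊗[B.R] N) ⊗[B.R] P) :
    TensorProduct.assoc B.R M N P (B.Sq1 • t) = B.Sq1 • TensorProduct.assoc B.R M N P t :=
  map_smul_of_tmul _ (TensorProduct.assoc B.R M N P).toLinearMap (fun s z => by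
    induction s with
    | zero => simp only [TensorProduct.zero_tmul, smul_zero, map_zero]
    | tmul x y =>
      simp only [LinearEquiv.coe_coe, Sq1_tmul, map_add, TensorProduct.add_tmul,
        TensorProduct.tmul_add, TensorProduct.assoc_tmul]
      abel
    | add x y hx hy => simp only [TensorProduct.add_tmul, smul_add, map_add, hx, hy]) t

theorem assoc_Sq2 (t : (M ⊗[B.R] N) ⊗[B.R] P) :
    TensorProduct.assoc B.R M N P (B.Sq2 • t) = B.Sq2 • TensorProduct.assoc B.R M N P t :=
  map_smul_of_tmul _ (TensorProduct.assoc B.R M N P).toLinearMap (fun s z => by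
    induction s with
    | zero => simp only [TensorProduct.zero_tmul, smul_zero, map_zero]
    | tmul x y =>
      simp only [LinearEquiv.coe_coe, Sq1_tmul, Sq2_tmul, map_add, map_smul, smul_add,
        TensorProduct.add_tmul, TensorProduct.tmul_add, ← TensorProduct.smul_tmul',
        TensorProduct.tmul_smul, TensorProduct.assoc_tmul]
      abel
    | add x y hx hy => simp only [TensorProduct.add_tmul, smul_add, map_add, hx, hy]) t

theorem lid_Sq1 (t : B.R ⊗[B.R] M) :
    TensorProduct.lid B.R M (B.Sq1 • t) = B.Sq1 • TensorProduct.lid B.R M t :=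
  map_smul_of_tmul _ (TensorProduct.lid B.R M).toLinearMap (fun r x => by
    simp only [LinearEquiv.coe_coe, Sq1_tmul, map_add, TensorProduct.lid_tmul, Sq1_unit,
      Sq1_smul_smul]
    abel) t

theorem lid_Sq2 (t : B.R ⊗[B.R] M) :
    TensorProduct.lid B.R M (B.Sq2 • t) = B.Sq2 • TensorProduct.lid B.R M t :=
  map_smul_of_tmul _ (TensorProduct.lid B.R M).toLinearMap (fun r x => by
    simp only [LinearEquiv.coe_coe, Sq2_tmul, map_add, map_smul, TensorProduct.lid_tmul, Sq1_unit,
      Sq2_unit, Sq2_smul_smul, mul_smul]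
    abel) t

theorem prodLeft_Sq1 (t : (M × N) ⊗[B.R] P) :
    TensorProduct.prodLeft B.R B.R M N P (B.Sq1 • t) =
      B.Sq1 • TensorProduct.prodLeft B.R B.R M N P t :=
  map_smul_of_tmul _ (TensorProduct.prodLeft B.R B.R M N P).toLinearMap (fun p z => by
    obtain ⟨x, y⟩ := p
    simp only [LinearEquiv.coe_coe, Sq1_tmul, map_add, TensorProduct.prodLeft_tmul, Prod.smul_mk,
      Prod.mk_add_mk]) t

theorem prodLeft_Sq2 (t : (M × N) ⊗[B.R] P) :
    TensorProduct.prodLeft B.R B.R M N P (B.Sq2 • t) =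
      B.Sq2 • TensorProduct.prodLeft B.R B.R M N P t :=
  map_smul_of_tmul _ (TensorProduct.prodLeft B.R B.R M N P).toLinearMap (fun p z => by
    obtain ⟨x, y⟩ := p
    simp only [LinearEquiv.coe_coe, Sq2_tmul, map_add, map_smul, TensorProduct.prodLeft_tmul,
      Prod.smul_mk, Prod.mk_add_mk]) t

end tensorMaps

namespace Iso

/-- Functoriality of the tensor product. -/
noncomputable def tensorCongr {X X' Y Y' : Obj B} (e : Iso X X') (f : Iso Y Y') :
    Iso (X.tensor Y) (X'.tensor Y') :=
  ofEquiv (X := X.tensor Y) (Y := X'.tensor Y') (TensorProduct.congr e.equivR f.equivR)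
    (congr_Sq1 _ _ e.equivR_Sq1 f.equivR_Sq1)
    (congr_Sq2 _ _ e.equivR_Sq1 f.equivR_Sq1 e.equivR_Sq2 f.equivR_Sq2)
    (fun d t ht => Obj.tensorGr_induction X Y
      (TensorProduct.congr e.equivR f.equivR).toLinearMap.toAddMonoidHom _
      (fun i j x y hx hy hd => Obj.tmul_mem X' Y' (e.map_mem hx) (f.map_mem hy) hd) ht)
    (fun d t ht => Obj.tensorGr_induction X' Y'
      (TensorProduct.congr e.equivR f.equivR).symm.toLinearMap.toAddMonoidHom _
      (fun i j x y hx hy hd => Obj.tmul_mem X Y (e.symm_mem hx) (f.symm_mem hy) hd) ht)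

/-- Commutativity of the tensor product. -/
noncomputable def tensorComm (X Y : Obj B) : Iso (X.tensor Y) (Y.tensor X) :=
  ofEquiv (X := X.tensor Y) (Y := Y.tensor X) (TensorProduct.comm B.R X.carrier Y.carrier)
    comm_Sq1 comm_Sq2
    (fun d t ht => Obj.tensorGr_induction X Y
      (TensorProduct.comm B.R X.carrier Y.carrier).toLinearMap.toAddMonoidHom _
      (fun i j x y hx hy hd => Obj.tmul_mem Y X hy hx ((add_comm j i).trans hd)) ht)
    (fun d t ht => Obj.tensorGr_induction Y X
      (TensorProduct.comm B.R X.carrier Y.carrier).symm.toLinearMap.toAddMonoidHom _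
      (fun i j x y hx hy hd => Obj.tmul_mem X Y hy hx ((add_comm j i).trans hd)) ht)

/-- Associativity of the tensor product. -/
noncomputable def tensorAssoc (X Y Z : Obj B) :
    Iso ((X.tensor Y).tensor Z) (X.tensor (Y.tensor Z)) :=
  ofEquiv (X := (X.tensor Y).tensor Z) (Y := X.tensor (Y.tensor Z))
    (TensorProduct.assoc B.R X.carrier Y.carrier Z.carrier) assoc_Sq1 assoc_Sq2
    (fun d t ht => Obj.tensorGr_induction (X.tensor Y) Z
      (TensorProduct.assoc B.R X.carrier Y.carrier Z.carrier).toLinearMap.toAddMonoidHom _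
      (fun i k s z hs hz hd => Obj.tensorGr_induction X Y
        ((TensorProduct.assoc B.R X.carrier Y.carrier Z.carrier).toLinearMap.toAddMonoidHom.comp
          ((TensorProduct.mk B.R _ Z.carrier).flip z).toAddMonoidHom) _
        (fun a b x y hx hy hab => Obj.tmul_mem X (Y.tensor Z) hx (Obj.tmul_mem Y Z hy hz rfl)
          (by rw [← hd, ← hab, add_assoc])) hs) ht)
    (fun d t ht => Obj.tensorGr_induction X (Y.tensor Z)
      (TensorProduct.assoc B.R X.carrier Y.carrier Z.carrier).symm.toLinearMap.toAddMonoidHom _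
      (fun i k x s hx hs hd => Obj.tensorGr_induction Y Z
        ((TensorProduct.assoc B.R X.carrier Y.carrier
            Z.carrier).symm.toLinearMap.toAddMonoidHom.comp
          (TensorProduct.mk B.R X.carrier _ x).toAddMonoidHom) _
        (fun a b y z hy hz hab => Obj.tmul_mem (X.tensor Y) Z (Obj.tmul_mem X Y hx hy rfl) hz
          (by rw [← hd, ← hab, add_assoc])) hs) ht)

/-- The coefficient ring is a unit for the tensor product. -/
noncomputable def unitTensor (X : Obj B) : Iso ((Obj.unit B).tensor X) X :=
  ofEquiv (X := (Obj.unit B).tensor X) (TensorProduct.lid B.R X.carrier) lid_Sq1 lid_Sq2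
    (fun d t ht => Obj.tensorGr_induction (Obj.unit B) X
      (TensorProduct.lid B.R X.carrier).toLinearMap.toAddMonoidHom _
      (fun i j r x hr hx hd => by subst hd; exact X.smul_mem hr hx) ht)
    (fun d x hx => Obj.tmul_mem (Obj.unit B) X B.one_mem hx (zero_add d))

/-- Functoriality of the direct sum. -/
noncomputable def sumCongr {X X' Y Y' : Obj B} (e : Iso X X') (f : Iso Y Y') :
    Iso (X.sum Y) (X'.sum Y') where
  equiv := LinearEquiv.prodCongr e.equiv f.equiv
  map_mem h := ⟨e.map_mem h.1, f.map_mem h.2⟩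
  symm_mem h := ⟨e.symm_mem h.1, f.symm_mem h.2⟩

/-- Commutativity of the direct sum. -/
noncomputable def sumComm (X Y : Obj B) : Iso (X.sum Y) (Y.sum X) where
  equiv := LinearEquiv.prodComm B.A X.carrier Y.carrier
  map_mem h := ⟨h.2, h.1⟩
  symm_mem h := ⟨h.2, h.1⟩

/-- Associativity of the direct sum. -/
noncomputable def sumAssoc (X Y Z : Obj B) : Iso ((X.sum Y).sum Z) (X.sum (Y.sum Z)) where
  equiv := LinearEquiv.prodAssoc B.A X.carrier Y.carrier Z.carrier
  map_mem h := ⟨h.1.1, h.1.2, h.2⟩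
  symm_mem h := ⟨⟨h.1, h.2.1⟩, h.2.2⟩

/-- The direct sum of the first and last summand, followed by the middle one. -/
noncomputable def sumRight (X Y Z : Obj B) : Iso ((X.sum Y).sum Z) ((X.sum Z).sum Y) :=
  ((sumAssoc X Y Z).trans (sumCongr (refl X) (sumComm Y Z))).trans (sumAssoc X Z Y).symm

/-- Distributivity. -/
noncomputable def sumTensor (X Y Z : Obj B) :
    Iso ((X.sum Y).tensor Z) ((X.tensor Z).sum (Y.tensor Z)) :=
  ofEquiv (X := (X.sum Y).tensor Z) (Y := (X.tensor Z).sum (Y.tensor Z))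
    (TensorProduct.prodLeft B.R B.R X.carrier Y.carrier Z.carrier)
    prodLeft_Sq1 prodLeft_Sq2
    (fun d t ht => Obj.tensorGr_induction (X.sum Y) Z
      (TensorProduct.prodLeft B.R B.R X.carrier Y.carrier Z.carrier).toLinearMap.toAddMonoidHom
      (((X.tensor Z).sum (Y.tensor Z)).gr d)
      (fun i j p z hp hz hd => ⟨Obj.tmul_mem X Z hp.1 hz hd, Obj.tmul_mem Y Z hp.2 hz hd⟩) ht)
    (fun d t ht => by
      let e := TensorProduct.prodLeft B.R B.R X.carrier Y.carrier Z.carrier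
      have h1 : e.symm ((t.1, 0) : X.carrier ⊗[B.R] Z.carrier × Y.carrier ⊗[B.R] Z.carrier) ∈
          Obj.tensorGr (X.sum Y) Z d := Obj.tensorGr_induction X Z
        (e.symm.toLinearMap.toAddMonoidHom.comp (AddMonoidHom.inl _ _)) _
        (fun i j x z hx hz hd => by
          have : e.symm ((x ⊗ₜ z, 0) : X.carrier ⊗[B.R] Z.carrier × Y.carrier ⊗[B.R] Z.carrier) =
              ((x, 0) : X.carrier × Y.carrier) ⊗ₜ z := by
            rw [LinearEquiv.symm_apply_eq]
            exact Prod.ext rfl (TensorProduct.zero_tmul _ _).symm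
          exact this ▸ Obj.tmul_mem (X.sum Y) Z (i := i) ⟨hx, zero_mem _⟩ hz hd) ht.1
      have h2 : e.symm ((0, t.2) : X.carrier ⊗[B.R] Z.carrier × Y.carrier ⊗[B.R] Z.carrier) ∈
          Obj.tensorGr (X.sum Y) Z d := Obj.tensorGr_induction Y Z
        (e.symm.toLinearMap.toAddMonoidHom.comp (AddMonoidHom.inr _ _)) _
        (fun i j x z hx hz hd => by
          have : e.symm ((0, x ⊗ₜ z) : X.carrier ⊗[B.R] Z.carrier × Y.carrier ⊗[B.R] Z.carrier) =
              ((0, x) : X.carrier × Y.carrier) ⊗ₜ z := by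
            rw [LinearEquiv.symm_apply_eq]
            exact Prod.ext (TensorProduct.zero_tmul _ _).symm rfl
          exact this ▸ Obj.tmul_mem (X.sum Y) Z (i := i) ⟨zero_mem _, hx⟩ hz hd) ht.2
      have h3 := add_mem h1 h2
      have h4 : e.symm t = e.symm (t.1, 0) + e.symm (0, t.2) := by
        rw [← e.symm.map_add]
        exact congrArg e.symm (Prod.ext (add_zero _).symm (zero_add _).symm)
      exact h4 ▸ h3)

end Iso

/-- Stable equivalence: `X ⊕ P ≅ Y ⊕ Q` for some projectives `P` and `Q`. -/
def StableEquiv (X Y : Obj B) : Prop :=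
  ∃ P Q : Obj B, Module.Projective B.A P.carrier ∧ Module.Projective B.A Q.carrier ∧
    Nonempty (Iso (X.sum P) (Y.sum Q))

namespace StableEquiv

variable {X Y Z X' Y' : Obj B}

/-- The zero object. -/
noncomputable def _root_.SteenrodBase.Obj.zero (B : SteenrodBase) : Obj B where
  carrier := PUnit
  gr _ := ⊤
  internal := isInternal_of_components 0
    (fun _ _ _ => Finsupp.ext fun _ => rfl) (fun m => Subsingleton.elim 0 m ▸ zero_mem _)
  smul_mem _ _ := trivial
  Sq1_mem _ := trivial
  Sq2_mem _ := trivial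

theorem of_iso (e : Iso X Y) : StableEquiv X Y :=
  have h : Module.Projective B.A (Obj.zero B).carrier :=
    inferInstanceAs (Module.Projective B.A PUnit)
  ⟨Obj.zero B, Obj.zero B, h, h, ⟨Iso.sumCongr e (Iso.refl _)⟩⟩

theorem symm (h : StableEquiv X Y) : StableEquiv Y X := by
  obtain ⟨P, Q, hP, hQ, ⟨e⟩⟩ := h
  exact ⟨Q, P, hQ, hP, ⟨e.symm⟩⟩

theorem trans (h : StableEquiv X Y) (h' : StableEquiv Y Z) : StableEquiv X Z := by
  obtain ⟨P, Q, hP, hQ, ⟨e⟩⟩ := h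
  obtain ⟨P', Q', hP', hQ', ⟨e'⟩⟩ := h'
  refine ⟨P.sum P', Q'.sum Q, inferInstanceAs (Module.Projective B.A (P.carrier × P'.carrier)),
    inferInstanceAs (Module.Projective B.A (Q'.carrier × Q.carrier)), ⟨?_⟩⟩
  exact (Iso.sumAssoc X P P').symm.trans <| (Iso.sumCongr e (Iso.refl P')).trans <|
    (Iso.sumRight Y Q P').trans <| (Iso.sumCongr e' (Iso.refl Q)).trans (Iso.sumAssoc Z Q' Q)

theorem tensor_right (h : StableEquiv X Y) (Z : Obj B) :
    StableEquiv (X.tensor Z) (Y.tensor Z) := by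
  obtain ⟨P, Q, hP, hQ, ⟨e⟩⟩ := h
  exact ⟨P.tensor Z, Q.tensor Z, projective_tensor, projective_tensor,
    ⟨(Iso.sumTensor X P Z).symm.trans <| (Iso.tensorCongr e (Iso.refl Z)).trans
      (Iso.sumTensor Y Q Z)⟩⟩

theorem tensor (h : StableEquiv X X') (h' : StableEquiv Y Y') :
    StableEquiv (X.tensor Y) (X'.tensor Y') :=
  (h.tensor_right Y).trans <| (of_iso (Iso.tensorComm X' Y)).trans <|
    (h'.tensor_right X').trans (of_iso (Iso.tensorComm Y' X'))

end StableEquiv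

variable (B) in
/-- Stable equivalence as an equivalence relation. -/
def stableSetoid : Setoid (Obj B) where
  r := StableEquiv
  iseqv := ⟨fun X => .of_iso (.refl X), StableEquiv.symm, StableEquiv.trans⟩

variable (B) in
/-- The stable equivalence classes, i.e. the isomorphism classes of the stable module category. -/
def StableClass : Type 1 := Quotient (stableSetoid B)

/-- The stable equivalence class of an object. -/
def Obj.cls (X : Obj B) : StableClass B := Quotient.mk (stableSetoid B) X

/-- The stable equivalence classes form a commutative monoid under the tensor product. -/
noncomputable instance : CommMonoid (StableClass B) where
  mul := Quotient.map₂ Obj.tensor fun _ _ h _ _ h' => StableEquiv.tensor h h'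
  one := (Obj.unit B).cls
  mul_assoc := by
    rintro ⟨X⟩ ⟨Y⟩ ⟨Z⟩
    exact Quotient.sound (s := stableSetoid B) (.of_iso (Iso.tensorAssoc X Y Z))
  one_mul := by
    rintro ⟨X⟩
    exact Quotient.sound (s := stableSetoid B) (.of_iso (Iso.unitTensor X))
  mul_one := by
    rintro ⟨X⟩
    exact Quotient.sound (s := stableSetoid B)
      (.of_iso ((Iso.tensorComm X (Obj.unit B)).trans (Iso.unitTensor X)))
  mul_comm := by
    rintro ⟨X⟩ ⟨Y⟩
    exact Quotient.sound (s := stableSetoid B) (.of_iso (Iso.tensorComm X Y))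

variable (B) in
/-- The stable Picard group: the group of invertible stable equivalence classes under the tensor
product. -/
abbrev Pic : Type 1 := (StableClass B)ˣ

/-- An object is stably invertible if its tensor product with some object is stably equivalent to
the tensor unit. -/
def StablyInvertible (X : Obj B) : Prop := ∃ Y : Obj B, StableEquiv (X.tensor Y) (Obj.unit B)

theorem StablyInvertible.isUnit {X : Obj B} (h : StablyInvertible X) : IsUnit X.cls := by
  obtain ⟨Y, hY⟩ := h
  exact IsUnit.of_mul_eq_one Y.cls (Quotient.sound (s := stableSetoid B) hY)

/-- The class of a stably invertible object in the Picard group. -/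
noncomputable def StablyInvertible.picClass {X : Obj B} (h : StablyInvertible X) : Pic B :=
  h.isUnit.unit

section joker

variable (B)

/-- The elements of `A(1)` that are products of homogeneous coefficients, `Sq¹`s and `Sq²`s, with
their degrees. -/
inductive HomogeneousWord : B.Γ → B.A → Prop
  | coeff {i : B.Γ} {r : B.R} : r ∈ B.gr i → HomogeneousWord i (B.coeff r)
  | sq1 : HomogeneousWord B.e1 B.Sq1
  | sq2 : HomogeneousWord B.e2 B.Sq2
  | mul {i j : B.Γ} {a b : B.A} : HomogeneousWord i a → HomogeneousWord j b →
      HomogeneousWord (i + j) (a * b)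

/-- The homogeneous components of `A(1)`. -/
noncomputable def grA (d : B.Γ) : AddSubgroup B.A := AddSubgroup.closure {a | B.HomogeneousWord d a}

/-- The left `A(1)`-module `A(1) / A(1) Sq³`. -/
abbrev JokerModule : Type := B.A ⧸ Submodule.span B.A {B.Sq3}

/-- The quotient map onto the joker. -/
noncomputable abbrev jokerMk : B.A →ₗ[B.A] B.JokerModule := (Submodule.span B.A {B.Sq3}).mkQ

/-- The homogeneous components of the joker. -/
noncomputable def jokerGr (d : B.Γ) : AddSubgroup B.JokerModule :=
  (B.grA d).map B.jokerMk.toAddMonoidHom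

/-- Coordinates for the joker. -/
def JokerCoord : Type := Fin 5 → B.R

instance : AddCommGroup B.JokerCoord := inferInstanceAs (AddCommGroup (Fin 5 → B.R))

instance : Module B.R B.JokerCoord := inferInstanceAs (Module B.R (Fin 5 → B.R))

/-- A coordinate. -/
def jc (i : Fin 5) : B.JokerCoord →ₗ[B.R] B.R := LinearMap.proj i

variable {B} in
theorem jext {v w : B.JokerCoord} (h0 : B.jc 0 v = B.jc 0 w) (h1 : B.jc 1 v = B.jc 1 w)
    (h2 : B.jc 2 v = B.jc 2 w) (h3 : B.jc 3 v = B.jc 3 w) (h4 : B.jc 4 v = B.jc 4 w) : v = w := by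
  funext i
  fin_cases i
  exacts [h0, h1, h2, h3, h4]

/-- An element given by its coordinates. -/
def jmk (a b c d e : B.R) : B.JokerCoord := ![a, b, c, d, e]

section
variable (a b c d e : B.R)
@[simp] theorem jc0 : B.jc 0 (B.jmk a b c d e) = a := rfl
@[simp] theorem jc1 : B.jc 1 (B.jmk a b c d e) = b := rfl
@[simp] theorem jc2 : B.jc 2 (B.jmk a b c d e) = c := rfl
@[simp] theorem jc3 : B.jc 3 (B.jmk a b c d e) = d := rfl
@[simp] theorem jc4 : B.jc 4 (B.jmk a b c d e) = e := rfl
end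

/-- `Sq¹` in coordinates. -/
def jsq1 : B.JokerCoord →+ B.JokerCoord :=
  AddMonoidHom.mk' (fun v => B.jmk (B.sq1 (B.jc 0 v)) (B.sq1 (B.jc 1 v) + B.jc 0 v)
    (B.sq1 (B.jc 2 v)) (B.sq1 (B.jc 3 v)) (B.sq1 (B.jc 4 v) + B.jc 3 v))
    (fun v w => by apply jext <;> simp <;> abel)

/-- `Sq²` in coordinates. -/
def jsq2 : B.JokerCoord →+ B.JokerCoord :=
  AddMonoidHom.mk' (fun v => B.jmk (B.sq2 (B.jc 0 v)) (B.sq2 (B.jc 1 v) + B.τ * B.sq1 (B.jc 0 v))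
    (B.sq2 (B.jc 2 v) + B.jc 0 v) (B.sq2 (B.jc 3 v) + B.jc 1 v)
    (B.sq2 (B.jc 4 v) + B.τ * B.sq1 (B.jc 3 v) + B.τ * B.jc 2 v))
    (fun v w => by apply jext <;> simp <;> ring)

theorem jsq1_apply (v : B.JokerCoord) : B.jsq1 v = B.jmk (B.sq1 (B.jc 0 v))
    (B.sq1 (B.jc 1 v) + B.jc 0 v) (B.sq1 (B.jc 2 v)) (B.sq1 (B.jc 3 v))
    (B.sq1 (B.jc 4 v) + B.jc 3 v) := rfl

theorem jsq2_apply (v : B.JokerCoord) : B.jsq2 v = B.jmk (B.sq2 (B.jc 0 v))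
    (B.sq2 (B.jc 1 v) + B.τ * B.sq1 (B.jc 0 v))
    (B.sq2 (B.jc 2 v) + B.jc 0 v) (B.sq2 (B.jc 3 v) + B.jc 1 v)
    (B.sq2 (B.jc 4 v) + B.τ * B.sq1 (B.jc 3 v) + B.τ * B.jc 2 v) := rfl

theorem isAction_jokerCoord : B.IsAction B.jsq1 B.jsq2 where
  sq1_smul r v := by
    apply jext <;> simp [jsq1_apply, B.sq1_mul] <;> ring
  sq2_smul r v := by
    apply jext <;> simp [jsq1_apply, jsq2_apply, B.sq1_mul, B.sq2_mul] <;> ring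
  sq1_sq1 v := by
    have h2 := B.two_eq_zero
    apply jext <;> apply eq_of_add_eq_zero B <;>
      simp only [jsq1_apply, jc0, jc1, jc2, jc3, jc4, map_add, map_zero, B.sq1_sq1] <;>
      ring_nf <;> simp only [h2, mul_zero, add_zero]
  sq2_sq2 v := by
    have h2 := B.two_eq_zero
    apply jext <;> apply eq_of_add_eq_zero B <;>
      simp only [jsq1_apply, jsq2_apply, jc0, jc1, jc2, jc3, jc4, map_add, map_zero, B.sq1_sq1,
        B.sq2_sq2, B.sq1_mul, B.sq2_mul, B.sq2_τ, map_smul, smul_eq_mul] <;>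
      ring_nf <;> simp only [h2, mul_zero, zero_add, add_zero]
  braid v := by
    have h2 := B.two_eq_zero
    apply jext <;> apply eq_of_add_eq_zero B <;>
      simp only [jsq1_apply, jsq2_apply, jc0, jc1, jc2, jc3, jc4, map_add, map_zero, B.sq1_sq1,
        B.sq2_sq2, B.sq1_mul, B.sq2_mul, B.sq2_τ, B.sq2_sq1_τ, map_smul, smul_eq_mul, B.braid] <;>
      ring_nf <;> simp only [h2, mul_zero, zero_add, add_zero]

/-- The coordinates of the joker as an `A(1)`-module. -/
noncomputable instance : Module B.A B.JokerCoord := B.isAction_jokerCoord.module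

instance : IsScalarTower B.R B.A B.JokerCoord := B.isAction_jokerCoord.tower

theorem Sq1_jokerCoord (v : B.JokerCoord) : B.Sq1 • v = B.jsq1 v :=
  B.isAction_jokerCoord.Sq1_smul v

theorem Sq2_jokerCoord (v : B.JokerCoord) : B.Sq2 • v = B.jsq2 v :=
  B.isAction_jokerCoord.Sq2_smul v

theorem sq1_one : B.sq1 1 = 0 := by
  have h := B.sq1_mul 1 1
  simp only [one_mul, mul_one] at h
  exact left_eq_add.mp h

theorem sq2_one : B.sq2 1 = 0 := by
  have h := B.sq2_mul 1 1
  simp only [one_mul, mul_one, sq1_one, mul_zero, add_zero] at h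
  exact left_eq_add.mp h

/-- The element of the joker with given coordinates with respect to
`1, Sq¹, Sq², Sq²Sq¹, Sq¹Sq²Sq¹`. -/
noncomputable def jokerOfCoord : B.JokerCoord →+ B.JokerModule :=
  AddMonoidHom.mk' (fun v => B.jokerMk (B.coeff (B.jc 0 v) + B.coeff (B.jc 1 v) * B.Sq1 +
    B.coeff (B.jc 2 v) * B.Sq2 + B.coeff (B.jc 3 v) * (B.Sq2 * B.Sq1) +
    B.coeff (B.jc 4 v) * (B.Sq1 * (B.Sq2 * B.Sq1)))) (fun v w => by
      rw [← map_add]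
      simp only [map_add, add_mul]
      abel)

/-- The coordinates of an element of the joker. -/
noncomputable def coordOfJoker : B.JokerModule →ₗ[B.A] B.JokerCoord :=
  (Submodule.span B.A {B.Sq3}).liftQ
    (LinearMap.toSpanSingleton B.A B.JokerCoord (B.jmk 1 0 0 0 0)) (by
      rw [Submodule.span_singleton_le_iff_mem, LinearMap.mem_ker, LinearMap.toSpanSingleton_apply,
        Sq3, mul_smul, Sq2_jokerCoord, Sq1_jokerCoord]
      apply jext <;> simp [jsq1_apply, jsq2_apply, sq1_one, sq2_one])

theorem coordOfJoker_mk (a : B.A) : B.coordOfJoker (B.jokerMk a) = a • B.jmk 1 0 0 0 0 := rfl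

theorem jokerOfCoord_apply (v : B.JokerCoord) : B.jokerOfCoord v = B.jokerMk
    (B.coeff (B.jc 0 v) + B.coeff (B.jc 1 v) * B.Sq1 +
    B.coeff (B.jc 2 v) * B.Sq2 + B.coeff (B.jc 3 v) * (B.Sq2 * B.Sq1) +
    B.coeff (B.jc 4 v) * (B.Sq1 * (B.Sq2 * B.Sq1))) := rfl

theorem coordOfJoker_jokerOfCoord (v : B.JokerCoord) :
    B.coordOfJoker (B.jokerOfCoord v) = v := by
  rw [jokerOfCoord_apply, coordOfJoker_mk]
  simp only [add_smul, mul_smul, coeff_smul, Sq1_jokerCoord, Sq2_jokerCoord]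
  apply jext <;> simp [jsq1_apply, jsq2_apply, sq1_one, sq2_one]

theorem jokerMk_mul_Sq3 (a : B.A) : B.jokerMk (a * (B.Sq1 * B.Sq2)) = 0 :=
  (Submodule.Quotient.mk_eq_zero _).mpr (Submodule.mem_span_singleton.mpr ⟨a, rfl⟩)

theorem jokerOfCoord_Sq1 (v : B.JokerCoord) :
    B.jokerOfCoord (B.Sq1 • v) = B.Sq1 • B.jokerOfCoord v := by
  have e3 : ∀ r, B.jokerMk (B.coeff r * (B.Sq1 * B.Sq2)) = 0 := fun r => jokerMk_mul_Sq3 B _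
  have e1 : ∀ a : B.A, B.Sq1 * (B.Sq1 * a) = 0 := fun a => by rw [← mul_assoc, Sq1_Sq1, zero_mul]
  have c1 : ∀ (r : B.R) (a : B.A),
      B.Sq1 * (B.coeff r * a) = B.coeff r * (B.Sq1 * a) + B.coeff (B.sq1 r) * a := fun r a => by
    rw [← mul_assoc, Sq1_coeff, add_mul, mul_assoc]
  rw [Sq1_jokerCoord, jokerOfCoord_apply, jokerOfCoord_apply, ← map_smul, smul_eq_mul]
  simp only [jsq1_apply, jc0, jc1, jc2, jc3, jc4, mul_add, c1, Sq1_coeff, Sq1_Sq1, e1, map_add,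
    add_mul, e3, mul_zero, map_zero]
  abel

theorem jokerOfCoord_Sq2 (v : B.JokerCoord) :
    B.jokerOfCoord (B.Sq2 • v) = B.Sq2 • B.jokerOfCoord v := by
  have e3 : ∀ r, B.jokerMk (B.coeff r * (B.Sq1 * B.Sq2)) = 0 := fun r => jokerMk_mul_Sq3 B _
  have e1 : ∀ a : B.A, B.Sq1 * (B.Sq1 * a) = 0 := fun a => by rw [← mul_assoc, Sq1_Sq1, zero_mul]
  have e22 : ∀ a : B.A, B.Sq2 * (B.Sq2 * a) = B.coeff B.τ * (B.Sq1 * (B.Sq2 * (B.Sq1 * a))) :=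
    fun a => by rw [← mul_assoc, Sq2_Sq2]; simp only [mul_assoc]
  have e33 : ∀ r, B.jokerMk (B.coeff r * (B.Sq2 * (B.Sq1 * (B.Sq2 * B.Sq1)))) = 0 := fun r => by
    have := B.Sq3_Sq3
    rw [mul_assoc B.Sq2, mul_assoc B.Sq1 B.Sq2 B.Sq1] at this
    rw [← this, ← mul_assoc]
    exact jokerMk_mul_Sq3 B _
  have c2 : ∀ (r : B.R) (a : B.A), B.Sq2 * (B.coeff r * a) = B.coeff r * (B.Sq2 * a) +
      B.coeff (B.τ * B.sq1 r) * (B.Sq1 * a) + B.coeff (B.sq2 r) * a := fun r a => by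
    rw [← mul_assoc, Sq2_coeff, add_mul, add_mul, mul_assoc, mul_assoc]
  have e2 : B.Sq2 * B.Sq2 = B.coeff B.τ * (B.Sq1 * (B.Sq2 * B.Sq1)) := by
    rw [Sq2_Sq2, mul_assoc B.Sq1]
  have ct : ∀ a : B.A, ∀ r, B.coeff r * (B.coeff B.τ * a) = B.coeff (B.τ * r) * a := fun a r => by
    rw [← mul_assoc, ← map_mul, mul_comm r]
  rw [Sq2_jokerCoord, jokerOfCoord_apply, jokerOfCoord_apply, ← map_smul, smul_eq_mul]
  simp only [jsq2_apply, jc0, jc1, jc2, jc3, jc4, mul_add, c2, Sq2_coeff, Sq1_Sq1, e1, e22, e2,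
    map_add, add_mul, e3, mul_zero, map_zero, ct, e33]
  abel

theorem jokerOfCoord_coeff (r : B.R) (v : B.JokerCoord) :
    B.jokerOfCoord (r • v) = r • B.jokerOfCoord v := by
  rw [← coeff_smul (B := B) r (B.jokerOfCoord v), jokerOfCoord_apply, jokerOfCoord_apply,
    ← map_smul, smul_eq_mul]
  simp only [map_smul, smul_eq_mul, map_mul, mul_add, mul_assoc]

/-- The coordinates on the joker as a linear equivalence. -/
noncomputable def jokerEquiv : B.JokerModule ≃ₗ[B.A] B.JokerCoord :=
  LinearEquiv.ofLinearMap B.coordOfJoker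
    { B.jokerOfCoord with
      map_smul' := map_smul_of_gen B.jokerOfCoord B.jokerOfCoord_coeff B.jokerOfCoord_Sq1
        B.jokerOfCoord_Sq2 }
    (LinearMap.ext B.coordOfJoker_jokerOfCoord)
    (by
      apply Submodule.linearMap_qext
      apply LinearMap.ext_ring
      change B.jokerOfCoord (B.coordOfJoker (B.jokerMk 1)) = B.jokerMk 1
      rw [coordOfJoker_mk, one_smul, jokerOfCoord_apply]
      simp)

/-- The coordinates on the joker as a linear equivalence over the coefficients. -/
noncomputable def jokerEquivR : B.JokerModule ≃ₗ[B.R] (Fin 5 → B.R) :=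
  { B.jokerEquiv.toAddEquiv with
    map_smul' := map_coeff_smul B.jokerEquiv.toLinearMap }

instance : Module.Finite B.R B.JokerModule := Module.Finite.equiv B.jokerEquivR.symm

instance : Module.Projective B.R B.JokerModule := Module.Projective.of_equiv B.jokerEquivR.symm

/-- The degrees of the basis elements `1, Sq¹, Sq², Sq²Sq¹, Sq¹Sq²Sq¹`. -/
def jdeg : Fin 5 → B.Γ := ![0, B.e1, B.e2, B.e2 + B.e1, B.e1 + (B.e2 + B.e1)]

/-- The grading in coordinates. -/
def jokerCoordGr (d : B.Γ) : AddSubgroup B.JokerCoord where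
  carrier := {v | ∀ i, B.jc i v ∈ B.gr (d - B.jdeg i)}
  zero_mem' i := by rw [map_zero]; exact zero_mem _
  add_mem' ha hb i := by rw [map_add]; exact add_mem (ha i) (hb i)
  neg_mem' ha i := by rw [map_neg]; exact neg_mem (ha i)

variable {B} in
theorem jokerCoordGr_Sq1 {d : B.Γ} {v : B.JokerCoord} (hv : v ∈ B.jokerCoordGr d) :
    B.Sq1 • v ∈ B.jokerCoordGr (d + B.e1) := by
  have h : ∀ i, B.jc i v ∈ B.gr (d - B.jdeg i) := hv
  have hs : ∀ i, B.sq1 (B.jc i v) ∈ B.gr (d + B.e1 - B.jdeg i) := fun i => by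
    have := B.sq1_mem (h i)
    rwa [sub_add_eq_add_sub] at this
  have h0 : B.jc 0 v ∈ B.gr (d + B.e1 - B.jdeg 1) := by
    have e : d + B.e1 - B.jdeg 1 = d - B.jdeg 0 := by simp [jdeg]
    rw [e]; exact h 0
  have h3 : B.jc 3 v ∈ B.gr (d + B.e1 - B.jdeg 4) := by
    have e : d + B.e1 - B.jdeg 4 = d - B.jdeg 3 := by simp [jdeg]; abel
    rw [e]; exact h 3
  rw [Sq1_jokerCoord, jsq1_apply]
  intro i
  fin_cases i
  exacts [hs 0, add_mem (hs 1) h0, hs 2, hs 3, add_mem (hs 4) h3]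

variable {B} in
theorem jokerCoordGr_Sq2 {d : B.Γ} {v : B.JokerCoord} (hv : v ∈ B.jokerCoordGr d) :
    B.Sq2 • v ∈ B.jokerCoordGr (d + B.e2) := by
  have h : ∀ i, B.jc i v ∈ B.gr (d - B.jdeg i) := hv
  have hs : ∀ i, B.sq2 (B.jc i v) ∈ B.gr (d + B.e2 - B.jdeg i) := fun i => by
    have := B.sq2_mem (h i)
    rwa [sub_add_eq_add_sub] at this
  have h01 : B.τ * B.sq1 (B.jc 0 v) ∈ B.gr (d + B.e2 - B.jdeg 1) := by
    have e : d + B.e2 - B.jdeg 1 = B.e2 - (B.e1 + B.e1) + (d - B.jdeg 0 + B.e1) := by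
      simp [jdeg]; abel
    rw [e]; exact B.mul_mem B.τ_mem (B.sq1_mem (h 0))
  have h02 : B.jc 0 v ∈ B.gr (d + B.e2 - B.jdeg 2) := by
    have e : d + B.e2 - B.jdeg 2 = d - B.jdeg 0 := by simp [jdeg]
    rw [e]; exact h 0
  have h13 : B.jc 1 v ∈ B.gr (d + B.e2 - B.jdeg 3) := by
    have e : d + B.e2 - B.jdeg 3 = d - B.jdeg 1 := by simp [jdeg]; abel
    rw [e]; exact h 1
  have h34 : B.τ * B.sq1 (B.jc 3 v) ∈ B.gr (d + B.e2 - B.jdeg 4) := by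
    have e : d + B.e2 - B.jdeg 4 = B.e2 - (B.e1 + B.e1) + (d - B.jdeg 3 + B.e1) := by
      simp [jdeg]; abel
    rw [e]; exact B.mul_mem B.τ_mem (B.sq1_mem (h 3))
  have h24 : B.τ * B.jc 2 v ∈ B.gr (d + B.e2 - B.jdeg 4) := by
    have e : d + B.e2 - B.jdeg 4 = B.e2 - (B.e1 + B.e1) + (d - B.jdeg 2) := by
      simp [jdeg]; abel
    rw [e]; exact B.mul_mem B.τ_mem (h 2)
  rw [Sq2_jokerCoord, jsq2_apply]
  intro i
  fin_cases i
  exacts [hs 0, add_mem (hs 1) h01, add_mem (hs 2) h02, add_mem (hs 3) h13,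
    add_mem (add_mem (hs 4) h34) h24]

variable {B} in
theorem jokerCoordGr_smul {k d : B.Γ} {r : B.R} {v : B.JokerCoord} (hr : r ∈ B.gr k)
    (hv : v ∈ B.jokerCoordGr d) : r • v ∈ B.jokerCoordGr (k + d) := fun i => by
  rw [map_smul, smul_eq_mul, add_sub_assoc]
  exact B.mul_mem hr (hv i)

variable {B} in
theorem HomogeneousWord.smul_mem {k : B.Γ} {a : B.A} (ha : B.HomogeneousWord k a) :
    ∀ {d : B.Γ} {v : B.JokerCoord}, v ∈ B.jokerCoordGr d → a • v ∈ B.jokerCoordGr (k + d) := by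
  induction ha with
  | coeff hr => intro d v hv; rw [coeff_smul]; exact jokerCoordGr_smul hr hv
  | sq1 => intro d v hv; rw [add_comm]; exact jokerCoordGr_Sq1 hv
  | sq2 => intro d v hv; rw [add_comm]; exact jokerCoordGr_Sq2 hv
  | mul _ _ iha ihb => intro d v hv; rw [mul_smul, add_assoc]; exact iha (ihb hv)

theorem coord_one_mem : B.jmk 1 0 0 0 0 ∈ B.jokerCoordGr 0 := fun i => by
  fin_cases i
  · change (1 : B.R) ∈ B.gr (0 - 0)
    rw [sub_zero]; exact B.one_mem
  all_goals exact zero_mem _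

variable {B} in
theorem coordOfJoker_mem {d : B.Γ} {x : B.JokerModule} (hx : x ∈ B.jokerGr d) :
    B.coordOfJoker x ∈ B.jokerCoordGr d := by
  obtain ⟨a, ha, rfl⟩ := hx
  change a • B.jmk 1 0 0 0 0 ∈ _
  have : B.grA d ≤ (B.jokerCoordGr d).comap
      ((LinearMap.toSpanSingleton B.A B.JokerCoord (B.jmk 1 0 0 0 0)).toAddMonoidHom) := by
    rw [grA, AddSubgroup.closure_le]
    intro w hw
    have := hw.smul_mem B.coord_one_mem
    rw [add_zero] at this
    exact this
  exact this ha

variable {B} in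
theorem grA_mul {i j d : B.Γ} {a b : B.A} (ha : B.HomogeneousWord i a)
    (hb : B.HomogeneousWord j b) (h : i + j = d) : a * b ∈ B.grA d :=
  AddSubgroup.subset_closure (h ▸ ha.mul hb)

variable {B} in
theorem jokerOfCoord_mem {d : B.Γ} {v : B.JokerCoord} (hv : v ∈ B.jokerCoordGr d) :
    B.jokerOfCoord v ∈ B.jokerGr d := by
  have h : ∀ i, B.HomogeneousWord (d - B.jdeg i) (B.coeff (B.jc i v)) := fun i => .coeff (hv i)
  refine ⟨_, ?_, (B.jokerOfCoord_apply v).symm⟩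
  have h0 : B.coeff (B.jc 0 v) ∈ B.grA d := by
    have := h 0
    rw [show d - B.jdeg 0 = d by simp [jdeg]] at this
    exact AddSubgroup.subset_closure this
  exact add_mem (add_mem (add_mem (add_mem h0 (grA_mul (h 1) .sq1 (sub_add_cancel _ _)))
    (grA_mul (h 2) .sq2 (sub_add_cancel _ _)))
    (grA_mul (h 3) (.mul .sq2 .sq1) (sub_add_cancel _ _)))
    (grA_mul (h 4) (.mul .sq1 (.mul .sq2 .sq1)) (sub_add_cancel _ _))

/-- The inclusion of a coordinate. -/
def jsingle (i : Fin 5) : B.R →+ B.JokerCoord :=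
  AddMonoidHom.single (fun _ : Fin 5 => B.R) i

theorem jc_jsingle (i k : Fin 5) (r : B.R) : B.jc k (B.jsingle i r) = if k = i then r else 0 := by
  change (Pi.single i r : Fin 5 → B.R) k = _
  rw [Pi.single_apply]

variable {B} in
theorem jsingle_mem {d : B.Γ} {i : Fin 5} {r : B.R} (hr : r ∈ B.gr d) :
    B.jsingle i r ∈ B.jokerCoordGr (d + B.jdeg i) := fun k => by
  rw [jc_jsingle]
  split_ifs with h
  · subst h; rwa [add_sub_cancel_right]
  · exact zero_mem _

theorem sum_jsingle (v : B.JokerCoord) : ∑ i, B.jsingle i (B.jc i v) = v :=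
  Finset.univ_sum_single (M := fun _ : Fin 5 => B.R) v

theorem jokerCoord_internal : DirectSum.IsInternal B.jokerCoordGr := by
  refine isInternal_of_components
    (∑ i, (Finsupp.mapDomain.addMonoidHom (fun d => d + B.jdeg i)).comp
      ((Finsupp.mapRange.addMonoidHom (B.jsingle i)).comp
        ((components B.internal).comp (B.jc i).toAddMonoidHom))) ?_ ?_
  · intro d v hv
    have h : ∀ i, components B.internal (B.jc i v) = Finsupp.single (d - B.jdeg i) (B.jc i v) :=
      fun i => components_of_mem B.internal (hv i)
    simp only [AddMonoidHom.finsetSum_apply, AddMonoidHom.comp_apply,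
      LinearMap.toAddMonoidHom_coe, h, Finsupp.mapRange.addMonoidHom_apply,
      Finsupp.mapRange_single, Finsupp.mapDomain.addMonoidHom_apply, Finsupp.mapDomain_single,
      sub_add_cancel]
    rw [← Finsupp.single_finsetSum, sum_jsingle]
  · intro v
    rw [← B.sum_jsingle v]
    refine sum_mem fun i _ => ?_
    exact graded_induction B.internal (p := fun r => B.jsingle i r ∈ _) (B.jc i v)
      (by rw [map_zero]; exact zero_mem _) (fun a b ha hb => by rw [map_add]; exact add_mem ha hb)
      (fun d r hr => AddSubgroup.subset_closure ⟨_, jsingle_mem hr⟩)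

theorem jokerOfCoord_coordOfJoker (x : B.JokerModule) :
    B.jokerOfCoord (B.coordOfJoker x) = x := B.jokerEquiv.symm_apply_apply x

theorem joker_internal : DirectSum.IsInternal B.jokerGr := by
  refine isInternal_of_components
    ((Finsupp.mapRange.addMonoidHom B.jokerOfCoord).comp
      ((components B.jokerCoord_internal).comp B.coordOfJoker.toAddMonoidHom)) ?_ ?_
  · intro d x hx
    simp only [AddMonoidHom.comp_apply, LinearMap.toAddMonoidHom_coe,
      components_of_mem B.jokerCoord_internal (coordOfJoker_mem hx),
      Finsupp.mapRange.addMonoidHom_apply, Finsupp.mapRange_single, jokerOfCoord_coordOfJoker]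
  · intro x
    rw [← B.jokerOfCoord_coordOfJoker x]
    exact graded_induction B.jokerCoord_internal (p := fun v => B.jokerOfCoord v ∈ _)
      (B.coordOfJoker x)
      (by rw [map_zero]; exact zero_mem _) (fun a b ha hb => by rw [map_add]; exact add_mem ha hb)
      (fun d v hv => AddSubgroup.subset_closure ⟨d, jokerOfCoord_mem hv⟩)

variable {B} in
theorem jokerGr_word {k d : B.Γ} {a : B.A} (ha : B.HomogeneousWord k a) {x : B.JokerModule}
    (hx : x ∈ B.jokerGr d) : a • x ∈ B.jokerGr (k + d) := by
  have h := jokerOfCoord_mem (ha.smul_mem (coordOfJoker_mem hx))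
  rwa [← map_smul, jokerOfCoord_coordOfJoker] at h

/-- The joker `J = A(1) / A(1) Sq³`, with the grading inherited from `A(1)`. -/
noncomputable def joker : Obj B where
  carrier := B.A ⧸ Submodule.span B.A {B.Sq3}
  gr := B.jokerGr
  internal := B.joker_internal
  smul_mem {i j r x} hr hx := by
    rw [← coeff_smul (B := B) r x]; exact jokerGr_word (.coeff hr) hx
  Sq1_mem {i x} hx := by rw [add_comm]; exact jokerGr_word .sq1 hx
  Sq2_mem {i x} hx := by rw [add_comm]; exact jokerGr_word .sq2 hx
  finite := inferInstanceAs (Module.Finite B.R B.JokerModule)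
  projective := inferInstanceAs (Module.Projective B.R B.JokerModule)

end joker


section classical

/-- The classical coefficients: the field with two elements, concentrated in degree `0`, with
`|Sq¹| = 1`, `|Sq²| = 2` and `τ = 1`, so that `A` is the classical algebra `A(1)`. -/
def classicalBase : SteenrodBase where
  R := ZMod 2
  Γ := ℤ
  gr i := if i = 0 then ⊤ else ⊥
  internal := by
    refine isInternal_of_components (Finsupp.singleAddHom 0) ?_ ?_
    · intro i x hx
      split_ifs at hx with h
      · rw [h]; rfl
      · rw [AddSubgroup.mem_bot] at hx
        rw [hx, map_zero, Finsupp.single_zero]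
    · intro x
      exact AddSubgroup.subset_closure ⟨0, by rw [if_pos rfl]; trivial⟩
  one_mem := by rw [if_pos rfl]; trivial
  mul_mem {i j r s} hr hs := by
    split_ifs at hr hs with hi hj hj
    · rw [hi, hj, add_zero, if_pos rfl]; trivial
    all_goals
      simp only [AddSubgroup.mem_bot] at hr hs
      simp only [hr, hs, zero_mul, mul_zero, zero_mem]
  two_eq_zero := rfl
  e1 := 1
  e2 := 2
  τ := 1
  τ_mem := by rw [if_pos (by norm_num)]; trivial
  sq1 := 0
  sq2 := 0
  sq1_mem _ := zero_mem _
  sq2_mem _ := zero_mem _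
  sq1_mul r s := by simp
  sq2_mul r s := by simp
  sq2_τ := rfl
  sq2_sq1_τ := rfl
  sq1_sq1 _ := rfl
  sq2_sq2 r := by simp
  braid _ := rfl

end classical

section real

open MvPolynomial

/-- The `ℝ`-motivic cohomology of a point: the polynomial ring `𝔽₂[τ, ρ]`, with `τ` and `ρ` the
variables number `0` and `1`. -/
abbrev MReal : Type := MvPolynomial (Fin 2) (ZMod 2)

/-- The bidegrees (internal degree, weight) of `τ` and `ρ`. -/
def realWeight : Fin 2 → ℤ × ℤ := ![(0, 1), (1, 1)]

/-- The bihomogeneous components of `𝔽₂[τ, ρ]`. -/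
noncomputable def realGr (d : ℤ × ℤ) : AddSubgroup MReal :=
  (weightedHomogeneousSubmodule (ZMod 2) realWeight d).toAddSubgroup

/-- The additive operator on `𝔽₂[τ, ρ]` with given values on the monomials `τᵃρᵇ`. -/
noncomputable def realOp (f : ℕ → ℕ → MReal) : MReal →ₗ[ZMod 2] MReal :=
  (basisMonomials (Fin 2) (ZMod 2)).constr (ZMod 2) fun m => f (m 0) (m 1)

/-- `Sq¹(τᵃρᵇ) = a τᵃ⁻¹ρᵇ⁺¹`. -/
noncomputable def realSq1 : MReal →ₗ[ZMod 2] MReal :=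
  realOp fun a b => (a : MReal) * (X 0 ^ (a - 1) * X 1 ^ (b + 1))

/-- `Sq²(τᵃρᵇ) = (a choose 2) τᵃ⁻¹ρᵇ⁺²`. -/
noncomputable def realSq2 : MReal →ₗ[ZMod 2] MReal :=
  realOp fun a b => (a.choose 2 : MReal) * (X 0 ^ (a - 1) * X 1 ^ (b + 2))

theorem monomial_eq_real (m : Fin 2 →₀ ℕ) :
    (monomial m (1 : ZMod 2) : MReal) = X 0 ^ m 0 * X 1 ^ m 1 := by
  rw [monomial_eq, map_one, one_mul, Finsupp.prod_fintype _ _ (fun i => pow_zero _),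
    Fin.prod_univ_two]

theorem realOp_apply (f : ℕ → ℕ → MReal) (a b : ℕ) : realOp f (X 0 ^ a * X 1 ^ b) = f a b := by
  let m : Fin 2 →₀ ℕ := Finsupp.equivFunOnFinite.symm ![a, b]
  have h : (X 0 ^ a * X 1 ^ b : MReal) = basisMonomials (Fin 2) (ZMod 2) m := by
    rw [coe_basisMonomials]
    exact (monomial_eq_real m).symm
  rw [h, realOp, Module.Basis.constr_basis]
  rfl

theorem realSq1_apply (a b : ℕ) : realSq1 (X 0 ^ a * X 1 ^ b) =
    (a : MReal) * (X 0 ^ (a - 1) * X 1 ^ (b + 1)) := realOp_apply _ a b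

theorem realSq2_apply (a b : ℕ) : realSq2 (X 0 ^ a * X 1 ^ b) =
    (a.choose 2 : MReal) * (X 0 ^ (a - 1) * X 1 ^ (b + 2)) := realOp_apply _ a b

theorem real_induction {p : MReal → Prop} (r : MReal) (h0 : p 0)
    (hadd : ∀ x y, p x → p y → p (x + y)) (hmono : ∀ a b : ℕ, p (X 0 ^ a * X 1 ^ b)) : p r := by
  induction r using MvPolynomial.induction_on' with
  | monomial u a =>
    have h : a = 0 ∨ a = 1 := by revert a; decide
    rcases h with rfl | rfl
    · rwa [monomial_zero]
    · rw [monomial_eq_real]; exact hmono _ _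
  | add x y hx hy => exact hadd x y hx hy

theorem real_two : (2 : MReal) = 0 := by
  have : ((2 : ZMod 2)) = 0 := rfl
  rw [← map_ofNat (C : ZMod 2 →+* MReal) 2, this, map_zero]

theorem cast_congr {m n : ℕ} (h : m % 2 = n % 2) : (m : MReal) = n := by
  have key : ∀ k : ℕ, (k : MReal) = (k % 2 : ℕ) := fun k => by
    conv_lhs => rw [← Nat.div_add_mod k 2]
    rw [Nat.cast_add, Nat.cast_mul, Nat.cast_ofNat, real_two, zero_mul, zero_add]
  rw [key m, key n, h]

theorem choose_two_succ (n : ℕ) : (n + 1).choose 2 = n + n.choose 2 := by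
  rw [Nat.choose_succ_succ' n 1, Nat.choose_one_right]

theorem choose_two_add (m n : ℕ) : (m + n).choose 2 = m.choose 2 + m * n + n.choose 2 := by
  induction n with
  | zero => simp
  | succ n ih => rw [← add_assoc, choose_two_succ, choose_two_succ, ih]; ring

theorem choose_two_parity (n : ℕ) : n.choose 2 % 2 = n / 2 % 2 := by
  induction n with
  | zero => rfl
  | succ n ih =>
    rw [choose_two_succ, Nat.add_mod, ih]
    obtain h | h | h | h : n % 4 = 0 ∨ n % 4 = 1 ∨ n % 4 = 2 ∨ n % 4 = 3 := by omega
    all_goals omega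

theorem realSq1_mul (r s : MReal) : realSq1 (r * s) = r * realSq1 s + realSq1 r * s := by
  refine real_induction (p := fun r => realSq1 (r * s) = r * realSq1 s + realSq1 r * s)
    r (by simp) (fun x y hx hy => by
    simp only [add_mul, map_add, hx, hy]; ring) fun a b => ?_
  refine real_induction (p := fun s => realSq1 (X 0 ^ a * X 1 ^ b * s) = X 0 ^ a * X 1 ^ b * realSq1 s +
      realSq1 (X 0 ^ a * X 1 ^ b) * s)
    s (by simp) (fun x y hx hy => by
    simp only [mul_add, map_add, hx, hy]; ring) fun c d => ?_
  have h : (X 0 ^ a * X 1 ^ b * (X 0 ^ c * X 1 ^ d) : MReal) = X 0 ^ (a + c) * X 1 ^ (b + d) := by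
    ring
  rw [h, realSq1_apply, realSq1_apply, realSq1_apply]
  rcases a with _ | a <;> rcases c with _ | c
  · simp
  · simp; ring
  · simp; ring
  · rw [show a + 1 + (c + 1) - 1 = a + c + 1 by omega, Nat.add_sub_cancel, Nat.add_sub_cancel]
    push_cast; ring

theorem realSq2_mul (r s : MReal) :
    realSq2 (r * s) = r * realSq2 s + X 0 * realSq1 r * realSq1 s + realSq2 r * s := by
  refine real_induction (p := fun r => realSq2 (r * s) =
      r * realSq2 s + X 0 * realSq1 r * realSq1 s + realSq2 r * s)
    r (by simp) (fun x y hx hy => by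
    simp only [add_mul, mul_add, map_add, hx, hy]; ring) fun a b => ?_
  refine real_induction (p := fun s => realSq2 (X 0 ^ a * X 1 ^ b * s) = X 0 ^ a * X 1 ^ b * realSq2 s +
      X 0 * realSq1 (X 0 ^ a * X 1 ^ b) * realSq1 s + realSq2 (X 0 ^ a * X 1 ^ b) * s)
    s (by simp) (fun x y hx hy => by
    simp only [mul_add, map_add, hx, hy]; ring) fun c d => ?_
  have h : (X 0 ^ a * X 1 ^ b * (X 0 ^ c * X 1 ^ d) : MReal) = X 0 ^ (a + c) * X 1 ^ (b + d) := by
    ring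
  rw [h, realSq1_apply, realSq1_apply, realSq2_apply, realSq2_apply, realSq2_apply]
  rcases a with _ | a <;> rcases c with _ | c
  · simp
  · simp; ring
  · simp; ring
  · rw [show a + 1 + (c + 1) - 1 = a + c + 1 by omega, Nat.add_sub_cancel, Nat.add_sub_cancel,
      choose_two_add]
    push_cast; ring

theorem realOp_mem {f : ℕ → ℕ → MReal} {e : ℤ × ℤ}
    (hf : ∀ a b : ℕ, f a b ∈ realGr (((b : ℤ), (a : ℤ) + b) + e)) {d : ℤ × ℤ} {r : MReal}
    (hr : r ∈ realGr d) : realOp f r ∈ realGr (d + e) := by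
  rw [r.as_sum, map_sum]
  refine sum_mem fun m hm => ?_
  have hd : Finsupp.weight realWeight m = d := hr (mem_support_iff.mp hm)
  have hw : Finsupp.weight realWeight m = ((m 1 : ℤ), (m 0 : ℤ) + m 1) := by
    rw [Finsupp.weight_apply, Finsupp.sum_fintype _ _ (by simp), Fin.sum_univ_two]
    simp [realWeight]
  have hc : monomial m (MvPolynomial.coeff m r) = MvPolynomial.coeff m r • (X 0 ^ m 0 * X 1 ^ m 1 : MReal) := by
    rw [← monomial_eq_real, smul_monomial, smul_eq_mul, mul_one]
  rw [hc, map_smul, realOp_apply, ← hd, hw]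
  exact Submodule.smul_mem (weightedHomogeneousSubmodule (ZMod 2) realWeight _) _ (hf _ _)

theorem real_mono_mem (n a b : ℕ) {d : ℤ × ℤ} (h : d = ((b : ℤ), (a : ℤ) + b)) :
    (n : MReal) * (X 0 ^ a * X 1 ^ b) ∈ realGr d := by
  rw [← nsmul_eq_mul]
  refine nsmul_mem ?_ n
  have h0 : IsWeightedHomogeneous realWeight (X 0 ^ a * X 1 ^ b : MReal)
      (a • realWeight 0 + b • realWeight 1) :=
    ((isWeightedHomogeneous_X _ _ _).pow a).mul ((isWeightedHomogeneous_X _ _ _).pow b)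
  have e : a • realWeight 0 + b • realWeight 1 = d := by
    rw [h]; simp [realWeight]
  rw [e] at h0
  exact h0

theorem realSq1_mem {d : ℤ × ℤ} {r : MReal} (hr : r ∈ realGr d) :
    realSq1 r ∈ realGr (d + (1, 0)) := by
  refine realOp_mem (fun a b => ?_) hr
  rcases a with _ | a
  · simp
  · exact real_mono_mem _ _ _ (by simp; ring)

theorem realSq2_mem {d : ℤ × ℤ} {r : MReal} (hr : r ∈ realGr d) :
    realSq2 r ∈ realGr (d + (2, 1)) := by
  refine realOp_mem (fun a b => ?_) hr
  rcases a with _ | a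
  · simp
  · exact real_mono_mem _ _ _ (by simp; ring)

theorem real_internal : DirectSum.IsInternal realGr := by
  let _ := weightedDecomposition (ZMod 2) realWeight
  exact DirectSum.Decomposition.isInternal (weightedHomogeneousSubmodule (ZMod 2) realWeight)

theorem realSq1_cast_mul (n : ℕ) (r : MReal) : realSq1 (n * r) = n * realSq1 r := by
  rw [← nsmul_eq_mul, map_nsmul, nsmul_eq_mul]

theorem realSq2_cast_mul (n : ℕ) (r : MReal) : realSq2 (n * r) = n * realSq2 r := by
  rw [← nsmul_eq_mul, map_nsmul, nsmul_eq_mul]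

theorem realSq1_realSq1 (r : MReal) : realSq1 (realSq1 r) = 0 := by
  refine real_induction (p := fun r => realSq1 (realSq1 r) = 0)
    r (by simp) (fun x y hx hy => by simp only [map_add, hx, hy, add_zero])
    fun a b => ?_
  rw [realSq1_apply, realSq1_cast_mul, realSq1_apply, ← mul_assoc, ← Nat.cast_mul]
  have h : a * (a - 1) % 2 = 0 % 2 := by
    rcases a with _ | a
    · rfl
    · rw [Nat.add_sub_cancel, mul_comm, Nat.zero_mod]
      exact Nat.even_iff.mp (Nat.even_mul_succ_self a)
  rw [cast_congr h, Nat.cast_zero, zero_mul]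

theorem parity_mul (m n : ℕ) : m * n % 2 = (m % 2) * (n % 2) := by
  rw [Nat.mul_mod]
  rcases Nat.mod_two_eq_zero_or_one m with h | h <;>
    rcases Nat.mod_two_eq_zero_or_one n with h' | h' <;> simp [h, h']

theorem realSq2_realSq2 (r : MReal) :
    realSq2 (realSq2 r) = X 0 * realSq1 (realSq2 (realSq1 r)) := by
  refine real_induction (p := fun r => realSq2 (realSq2 r) = X 0 * realSq1 (realSq2 (realSq1 r)))
    r (by simp) (fun x y hx hy => by simp only [map_add, hx, hy, mul_add])
    fun a b => ?_
  rw [realSq1_apply, realSq2_apply, realSq2_cast_mul, realSq2_cast_mul, realSq2_apply,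
    realSq2_apply, realSq1_cast_mul, realSq1_cast_mul, realSq1_apply]
  obtain h | h : a < 3 ∨ ∃ k, a = k + 3 := by
    rcases lt_or_ge a 3 with h | h
    · exact .inl h
    · exact .inr ⟨a - 3, by omega⟩
  · interval_cases a <;> simp
  · obtain ⟨k, rfl⟩ := h
    have e : ((k + 3).choose 2 * (k + 3 - 1).choose 2) % 2 =
        ((k + 3) * ((k + 3 - 1).choose 2 * (k + 3 - 1 - 1))) % 2 := by
      simp only [parity_mul, choose_two_parity]
      rcases Nat.mod_two_eq_zero_or_one ((k + 3) / 2) with h1 | h1 <;>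
      rcases Nat.mod_two_eq_zero_or_one ((k + 3 - 1) / 2) with h2 | h2 <;>
      rcases Nat.mod_two_eq_zero_or_one (k + 3) with h3 | h3 <;>
      rcases Nat.mod_two_eq_zero_or_one (k + 3 - 1 - 1) with h4 | h4 <;>
      simp only [h1, h2, h3, h4] <;> omega
    have e' := cast_congr e
    rw [show k + 3 - 1 - 1 = k + 1 by omega] at e' ⊢
    rw [Nat.add_sub_cancel]
    simp only [Nat.cast_mul] at e'
    rw [← mul_assoc, e']
    ring

theorem real_braid (r : MReal) :
    realSq1 (realSq2 (realSq1 (realSq2 r))) = realSq2 (realSq1 (realSq2 (realSq1 r))) := by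
  refine real_induction (p := fun r => realSq1 (realSq2 (realSq1 (realSq2 r))) =
      realSq2 (realSq1 (realSq2 (realSq1 r))))
    r (by simp) (fun x y hx hy => by simp only [map_add, hx, hy])
    fun a b => ?_
  simp only [realSq1_apply, realSq2_apply, realSq2_cast_mul, realSq1_cast_mul]
  have e1 : (a.choose 2 * ((a - 1) * ((a - 1 - 1).choose 2 * (a - 1 - 1 - 1)))) % 2 = 0 % 2 := by
    simp only [parity_mul, choose_two_parity]
    rcases Nat.mod_two_eq_zero_or_one (a / 2) with h1 | h1 <;>
    rcases Nat.mod_two_eq_zero_or_one (a - 1) with h2 | h2 <;>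
    rcases Nat.mod_two_eq_zero_or_one ((a - 1 - 1) / 2) with h3 | h3 <;>
    rcases Nat.mod_two_eq_zero_or_one (a - 1 - 1 - 1) with h4 | h4 <;>
    simp only [h1, h2, h3, h4] <;> omega
  have e2 : (a * ((a - 1).choose 2 * ((a - 1 - 1) * (a - 1 - 1 - 1).choose 2))) % 2 = 0 % 2 := by
    simp only [parity_mul, choose_two_parity]
    rcases Nat.mod_two_eq_zero_or_one (a) with h1 | h1 <;>
    rcases Nat.mod_two_eq_zero_or_one ((a - 1) / 2) with h2 | h2 <;>
    rcases Nat.mod_two_eq_zero_or_one (a - 1 - 1) with h3 | h3 <;>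
    rcases Nat.mod_two_eq_zero_or_one ((a - 1 - 1 - 1) / 2) with h4 | h4 <;>
    simp only [h1, h2, h3, h4] <;> omega
  have e1' := cast_congr e1
  have e2' := cast_congr e2
  rw [Nat.cast_zero] at e1' e2'
  simp only [Nat.cast_mul] at e1' e2'
  simp only [← mul_assoc] at e1' e2' ⊢
  simp only [e1', e2', zero_mul]

/-- The `ℝ`-motivic coefficients `𝔽₂[τ, ρ]` with `|τ| = (0,1)`, `|ρ| = (1,1)`, `|Sq¹| = (1,0)`
and `|Sq²| = (2,1)`, where `Sq¹τ = ρ`, `Sq²τ = 0` and `Sq¹ρ = Sq²ρ = 0`; then `A` is the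
`ℝ`-motivic algebra `A(1)`. -/
noncomputable def realBase : SteenrodBase where
  R := MReal
  Γ := ℤ × ℤ
  gr := realGr
  internal := real_internal
  one_mem := isWeightedHomogeneous_one (ZMod 2) realWeight
  mul_mem hr hs := IsWeightedHomogeneous.mul hr hs
  two_eq_zero := real_two
  e1 := (1, 0)
  e2 := (2, 1)
  τ := X 0
  τ_mem := isWeightedHomogeneous_X (ZMod 2) realWeight 0
  sq1 := realSq1.toAddMonoidHom
  sq2 := realSq2.toAddMonoidHom
  sq1_mem := realSq1_mem
  sq2_mem := realSq2_mem
  sq1_mul := realSq1_mul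
  sq2_mul := realSq2_mul
  sq2_τ := by
    have h := realSq2_apply 1 0
    rw [pow_one, pow_zero, mul_one] at h
    exact h.trans (by simp)
  sq2_sq1_τ := by
    have h := realSq1_apply 1 0
    have h2 := realSq2_apply 0 1
    simp only [pow_one, pow_zero, mul_one, Nat.cast_one, one_mul, tsub_self, zero_add] at h h2
    change realSq2 (realSq1 (X 0)) = 0
    rw [h, h2]; simp
  sq1_sq1 := realSq1_realSq1
  sq2_sq2 := realSq2_realSq2
  braid := real_braid

end real

end SteenrodBase

/-!
The tensor product of the joker `J` with its dual splits off the tensor unit along the evaluation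
and the coevaluation, because the rank `5` of `J` is odd. The complement, the kernel of the
evaluation, is free of rank `3` over `A(1)`. Indeed, with the basis `x₀, …, x₄` of `J` and the dual
basis `f₀, …, f₄`, the `A(1)`-multiples of `x₀ ⊗ f₂`, `x₀ ⊗ f₃`, `x₀ ⊗ f₄` together with the
coevaluation span `J ⊗ J*` (`jokerUnit_mem`). Since eight monomials span `A(1)` over the
coefficients (`exists_sum_monomial`), this exhibits `25 = 1 + 3 · 8` elements that span a free
module of rank `25`, so they form a basis (`jokerFamily_injective`). Hence `J` is stably invertible
with inverse `J*`, over any coefficients. As a by-product the eight monomials are linearly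
independent (`linearIndependent_monomial`), which is what exactness arguments in `A(1)` need.

For the infinite order, reduce modulo `(τ, ρ)`. There `Sq¹` and `Sq²` are derivations of square
zero on tensor products, and both are exact on projective modules, since each pairs off the eight
monomials (`ExactAlong`). The `Sq¹`-homology of `J` contains the class of `x₂ = Sq²`, and the
`Sq²`-homology the class of `x₄ = Sq¹Sq²Sq¹`. That these classes, and their tensor powers, do not
vanish is witnessed by functionals which are multiplied under tensor products
(`HasHomologyClass.tensor`). If the `n`-th tensor power is stably trivial, then these classes live
in degree `0` (`HasHomologyClass.eq_zero`), which is impossible for `n > 0`, because the degrees of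
`x₂` and `x₄` differ and a shift changes both by the same amount.

Over the classical coefficients `τ = 1`, and reversing the basis identifies the symmetric joker
with its dual (`jokerSelfDual`), so the square of its class is trivial. The class itself is not: if
`J ⊕ P ≅ 𝔽₂ ⊕ Q`, then the element that corresponds to `1 ∈ 𝔽₂` is annihilated by `Sq¹` and `Sq²`.
Its component in `J` is a multiple of `x₄ = Sq¹x₃`, and its component in the projective module `P`
is a `Sq¹`-boundary as well, but boundaries vanish under the projection to `𝔽₂`
(`not_stableEquiv_shift_joker_unit`).
-/

namespace SteenrodBase

/-! ### The eight monomials that generate `A(1)` over the coefficients -/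

section monomials

variable (B : SteenrodBase)

/-- The monomials `1, Sq¹, Sq², Sq¹Sq², Sq²Sq¹, Sq¹Sq²Sq¹, Sq²Sq¹Sq², Sq¹Sq²Sq¹Sq²`.
Left multiplication by `Sq¹` pairs them off, and so does left multiplication by `Sq²`, up to
multiples of `τ`. -/
noncomputable def monomial : Fin 8 → B.A :=
  ![1, B.Sq1, B.Sq2, B.Sq1 * B.Sq2, B.Sq2 * B.Sq1, B.Sq1 * (B.Sq2 * B.Sq1),
    B.Sq2 * (B.Sq1 * B.Sq2), B.Sq1 * (B.Sq2 * (B.Sq1 * B.Sq2))]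

variable {B}

theorem Sq1_mul_Sq1_mul (a : B.A) : B.Sq1 * (B.Sq1 * a) = 0 := Sq1_Sq1_smul (B := B) (M := B.A) a

theorem Sq2_mul_Sq2_mul (a : B.A) :
    B.Sq2 * (B.Sq2 * a) = B.τ • (B.Sq1 * (B.Sq2 * (B.Sq1 * a))) := Sq2_Sq2_smul (B := B) (M := B.A) a

theorem Sq2_mul_Sq2_eq : B.Sq2 * B.Sq2 = B.τ • (B.Sq1 * (B.Sq2 * B.Sq1)) := by
  simpa using Sq2_mul_Sq2_mul (1 : B.A)

theorem Sq2_Sq1_Sq2_Sq1 :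
    B.Sq2 * (B.Sq1 * (B.Sq2 * B.Sq1)) = B.Sq1 * (B.Sq2 * (B.Sq1 * B.Sq2)) := by
  simpa using (braid_smul (B := B) (M := B.A) 1).symm

theorem Sq2_Sq1_Sq2_Sq1_Sq2 :
    B.Sq2 * (B.Sq1 * (B.Sq2 * (B.Sq1 * B.Sq2))) = 0 := by
  rw [← Sq2_Sq1_Sq2_Sq1, Sq2_mul_Sq2_mul, Sq1_mul_Sq1_mul, mul_zero, mul_zero, smul_zero]

theorem Sq1_mul_smul (r : B.R) (a : B.A) : B.Sq1 * (r • a) = r • (B.Sq1 * a) + B.sq1 r • a :=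
  Sq1_smul_smul r a

theorem Sq2_mul_smul (r : B.R) (a : B.A) :
    B.Sq2 * (r • a) = r • (B.Sq2 * a) + (B.τ * B.sq1 r) • (B.Sq1 * a) + B.sq2 r • a :=
  Sq2_smul_smul r a

theorem Sq1_mul_sum_monomial (c : Fin 8 → B.R) :
    B.Sq1 * ∑ i, c i • B.monomial i =
      ∑ i, (![B.sq1 (c 0), B.sq1 (c 1) + c 0, B.sq1 (c 2), B.sq1 (c 3) + c 2, B.sq1 (c 4),
        B.sq1 (c 5) + c 4, B.sq1 (c 6), B.sq1 (c 7) + c 6] : Fin 8 → B.R) i • B.monomial i := by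
  simp only [monomial, Fin.sum_univ_eight, mul_add, Sq1_mul_smul, Sq1_mul_Sq1_mul, Sq1_Sq1,
    mul_one, smul_zero, add_smul, Matrix.cons_val]
  abel

theorem Sq2_mul_sum_monomial (c : Fin 8 → B.R) :
    B.Sq2 * ∑ i, c i • B.monomial i =
      ∑ i, (![B.sq2 (c 0), B.sq2 (c 1) + B.τ * B.sq1 (c 0), B.sq2 (c 2) + c 0,
        B.sq2 (c 3) + B.τ * B.sq1 (c 2), B.sq2 (c 4) + c 1,
        B.sq2 (c 5) + B.τ * B.sq1 (c 4) + c 2 * B.τ, B.sq2 (c 6) + c 3,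
        B.sq2 (c 7) + B.τ * B.sq1 (c 6) + c 5] : Fin 8 → B.R) i • B.monomial i := by
  simp only [monomial, Fin.sum_univ_eight, mul_add, Sq2_mul_smul, Sq1_mul_Sq1_mul, Sq1_Sq1,
    Sq2_mul_Sq2_mul, Sq2_mul_Sq2_eq, Sq2_Sq1_Sq2_Sq1, Sq2_Sq1_Sq2_Sq1_Sq2, mul_zero,
    mul_one, smul_zero, add_smul, Matrix.cons_val, mul_smul, add_zero, zero_add]
  abel

theorem exists_sum_monomial (a : B.A) : ∃ c : Fin 8 → B.R, ∑ i, c i • B.monomial i = a := by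
  have key : ∀ (w : B.Word) (c : Fin 8 → B.R), ∃ d : Fin 8 → B.R,
      ∑ i, d i • B.monomial i = B.proj w * ∑ i, c i • B.monomial i := by
    intro w
    induction w using FreeAlgebra.induction with
    | grade0 z =>
      intro c
      refine ⟨fun i => (z : B.R) * c i, ?_⟩
      have h : B.proj (algebraMap ℤ _ z) = B.coeff z := by simp
      simp only [h, ← smul_A, Finset.smul_sum, mul_smul]
    | grade1 g =>
      intro c
      cases g with
      | coeff r =>
        refine ⟨fun i => r * c i, ?_⟩
        change _ = B.coeff r * _
        simp only [← smul_A, Finset.smul_sum, mul_smul]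
      | sq1 => exact ⟨_, (Sq1_mul_sum_monomial c).symm⟩
      | sq2 => exact ⟨_, (Sq2_mul_sum_monomial c).symm⟩
    | mul x y hx hy =>
      intro c
      obtain ⟨d, hd⟩ := hy c
      obtain ⟨e, he⟩ := hx d
      exact ⟨e, by rw [he, hd, map_mul, mul_assoc]⟩
    | add x y hx hy =>
      intro c
      obtain ⟨d, hd⟩ := hx c
      obtain ⟨e, he⟩ := hy c
      exact ⟨d + e, by simp only [Pi.add_apply, add_smul, Finset.sum_add_distrib, hd, he, map_add,
        add_mul]⟩
  obtain ⟨w, rfl⟩ : ∃ w, B.proj w = a := RingQuot.mkRingHom_surjective _ a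
  obtain ⟨d, hd⟩ := key w (Pi.single 0 1)
  refine ⟨d, hd.trans ?_⟩
  simp [Pi.single_apply, monomial]

end monomials

/-! ### Exactness of `Sq¹` and `Sq²` on projective modules -/

section exactness

variable {B : SteenrodBase} {k : Type} [CommRing k]

/-- Exactness of left multiplication by `θ` on `A(1)` after base change along `ε : R → k`, in
dual form: a cycle of `θ` is annihilated by every additive functional to `k` that is semilinear
along `ε` and vanishes on the boundaries of `θ`. -/
def ExactAlong (ε : B.R →+* k) (θ : B.A) : Prop :=
  ∀ μ : B.A →+ k, (∀ (r : B.R) (a : B.A), μ (r • a) = ε r * μ a) → (∀ a, μ (θ * a) = 0) →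
    ∀ a, θ * a = 0 → μ a = 0

theorem ExactAlong.of_Sq1 (hli : LinearIndependent B.R B.monomial) (ε : B.R →+* k)
    (h1 : ∀ r, ε (B.sq1 r) = 0) : ExactAlong ε B.Sq1 := by
  intro μ hμ hb a ha
  obtain ⟨c, rfl⟩ := exists_sum_monomial a
  rw [Sq1_mul_sum_monomial] at ha
  have hd := Fintype.linearIndependent_iff.mp hli _ ha
  -- the coordinates of `Sq¹a` at `Sq¹m` show that the coordinate of `a` at `m` lies in `ker ε`
  have e0 := congrArg ε (hd 1)
  have e2 := congrArg ε (hd 3)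
  have e4 := congrArg ε (hd 5)
  have e6 := congrArg ε (hd 7)
  simp only [Matrix.cons_val, map_add, h1, zero_add, map_zero] at e0 e2 e4 e6
  have b1 : μ B.Sq1 = 0 := by simpa using hb 1
  simp only [Fin.sum_univ_eight, map_add, hμ, e0, e2, e4, e6, monomial, Matrix.cons_val, hb, b1,
    zero_mul, mul_zero, add_zero]

theorem ExactAlong.of_Sq2 (hli : LinearIndependent B.R B.monomial) (ε : B.R →+* k)
    (h2 : ∀ r, ε (B.sq2 r) = 0) (hτ : ε B.τ = 0) :
    ExactAlong ε B.Sq2 := by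
  intro μ hμ hb a ha
  obtain ⟨c, rfl⟩ := exists_sum_monomial a
  rw [Sq2_mul_sum_monomial] at ha
  have hd := Fintype.linearIndependent_iff.mp hli _ ha
  -- the coordinates of `Sq²a` at `Sq²m` show that the coordinate of `a` at `m` lies in `ker ε`
  have e0 := congrArg ε (hd 2)
  have e1 := congrArg ε (hd 4)
  have e3 := congrArg ε (hd 6)
  have e5 := congrArg ε (hd 7)
  simp only [Matrix.cons_val, map_add, map_mul, h2, hτ, zero_mul, zero_add, map_zero]
    at e0 e1 e3 e5
  have b2 : μ B.Sq2 = 0 := by simpa using hb 1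
  have b7 : μ (B.Sq1 * (B.Sq2 * (B.Sq1 * B.Sq2))) = 0 := by
    rw [← Sq2_Sq1_Sq2_Sq1]; exact hb _
  simp only [Fin.sum_univ_eight, map_add, hμ, e0, e1, e3, e5, monomial, Matrix.cons_val, hb, b2,
    b7, zero_mul, mul_zero, add_zero]

/-- A projective module is a summand of a free one, so exactness passes from `A(1)` to it. -/
theorem ExactAlong.projective {ε : B.R →+* k} {θ : B.A} (h : ExactAlong ε θ) {Q : Type}
    [AddCommGroup Q] [Module B.R Q] [Module B.A Q] [IsScalarTower B.R B.A Q]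
    [Module.Projective B.A Q] (μ : Q →+ k) (hμ : ∀ (r : B.R) (q : Q), μ (r • q) = ε r * μ q)
    (hb : ∀ q, μ (θ • q) = 0) (q : Q) (hq : θ • q = 0) : μ q = 0 := by
  obtain ⟨s, hs⟩ := Module.projective_def'.mp (inferInstance : Module.Projective B.A Q)
  have hsq : Finsupp.linearCombination B.A id (s q) = q := LinearMap.congr_fun hs q
  have hc : ∀ j, θ * s q j = 0 := fun j => by
    have : θ • s q = 0 := by rw [← map_smul, hq, map_zero]
    exact DFunLike.congr_fun this j
  rw [← hsq, Finsupp.linearCombination_apply, Finsupp.sum, map_sum]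
  refine Finset.sum_eq_zero fun j _ => ?_
  exact h (μ.comp ((LinearMap.toSpanSingleton B.A Q j).toAddMonoidHom))
    (fun r a => by
      change μ ((r • a) • j) = ε r * μ (a • j)
      rw [smul_assoc, hμ])
    (fun a => by
      change μ ((θ * a) • j) = 0
      rw [mul_smul, hb]) _ (hc j)

end exactness

end SteenrodBase

namespace SteenrodBase

variable {B : SteenrodBase}

/-! ### Splitting off a copy of the coefficients -/

/-- A copy of the tensor unit that is a direct summand of `X`: a degree-preserving `A(1)`-linear
map to the coefficients, together with an invariant element of degree `0` that splits it. -/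
structure UnitSummand (X : Obj B) where
  /-- the retraction onto the unit -/
  p : X.carrier →ₗ[B.A] B.R
  p_mem : ∀ {i : B.Γ} {x : X.carrier}, x ∈ X.gr i → p x ∈ B.gr i
  /-- the image of `1` under the inclusion of the unit -/
  c : X.carrier
  c_mem : c ∈ X.gr 0
  Sq1_c : B.Sq1 • c = 0
  Sq2_c : B.Sq2 • c = 0
  p_c : p c = 1

namespace UnitSummand

variable {X : Obj B} (u : UnitSummand X)

theorem p_smul (r : B.R) (x : X.carrier) : u.p (r • x) = r * u.p x := map_coeff_smul u.p r x

/-- The projection onto the kernel of the retraction. -/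
noncomputable def proj : X.carrier →ₗ[B.R] LinearMap.ker u.p where
  toFun x := ⟨x - u.p x • u.c, by
    rw [LinearMap.mem_ker, map_sub, u.p_smul, u.p_c, mul_one, sub_self]⟩
  map_add' x y := by
    ext
    simp only [map_add, add_smul, Submodule.coe_add]
    abel
  map_smul' r x := by
    ext
    change r • x - u.p (r • x) • u.c = r • (x - u.p x • u.c)
    rw [u.p_smul, mul_smul, smul_sub]

theorem coe_proj (x : X.carrier) : (u.proj x : X.carrier) = x - u.p x • u.c := rfl

theorem proj_coe (x : LinearMap.ker u.p) : u.proj x = x := by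
  ext
  rw [coe_proj, LinearMap.mem_ker.mp x.2, zero_smul, sub_zero]

theorem proj_mem {i : B.Γ} {x : X.carrier} (hx : x ∈ X.gr i) :
    (u.proj x : X.carrier) ∈ X.gr i := by
  refine sub_mem hx ?_
  have := X.smul_mem (u.p_mem hx) u.c_mem
  rwa [add_zero] at this

theorem proj_surjective : Function.Surjective u.proj := fun x => ⟨x, u.proj_coe x⟩

/-- The kernel of the retraction, the complementary summand. -/
noncomputable def complement : Obj B where
  carrier := LinearMap.ker u.p
  gr i := (X.gr i).comap (LinearMap.ker u.p).subtype.toAddMonoidHom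
  internal := by
    refine isInternal_of_components
      ((Finsupp.mapRange.addMonoidHom u.proj.toAddMonoidHom).comp
        ((components X.internal).comp (LinearMap.ker u.p).subtype.toAddMonoidHom)) ?_ ?_
    · intro i x hx
      have hx' : (x : X.carrier) ∈ X.gr i := hx
      simp only [AddMonoidHom.comp_apply, LinearMap.toAddMonoidHom_coe, Submodule.subtype_apply,
        components_of_mem X.internal hx', Finsupp.mapRange.addMonoidHom_apply,
        Finsupp.mapRange_single, u.proj_coe]
    · intro x
      rw [← u.proj_coe x]
      exact graded_induction X.internal (p := fun y => u.proj y ∈ _) x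
        (by rw [map_zero]; exact zero_mem _) (fun a b ha hb => by rw [map_add]; exact add_mem ha hb)
        (fun i y hy => AddSubgroup.subset_closure ⟨i, u.proj_mem hy⟩)
  smul_mem hr hx := X.smul_mem hr hx
  Sq1_mem hx := X.Sq1_mem hx
  Sq2_mem hx := X.Sq2_mem hx
  finite := Module.Finite.of_surjective u.proj u.proj_surjective
  projective := Module.Projective.of_split
    ((LinearMap.ker u.p).subtype.restrictScalars B.R) u.proj (LinearMap.ext u.proj_coe)

/-- The linear equivalence underlying the splitting. -/
noncomputable def splitEquiv : X.carrier ≃ₗ[B.R] B.R × LinearMap.ker u.p where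
  toFun x := (u.p x, u.proj x)
  invFun y := y.1 • u.c + y.2
  map_add' x y := by rw [map_add, map_add, Prod.mk_add_mk]
  map_smul' r x := by rw [u.p_smul, map_smul u.proj]; rfl
  left_inv x := by
    change u.p x • u.c + (u.proj x : X.carrier) = x
    rw [coe_proj, add_sub_cancel]
  right_inv y := by
    obtain ⟨r, k⟩ := y
    have h : u.p (r • u.c + k) = r := by
      rw [map_add, u.p_smul, u.p_c, mul_one, LinearMap.mem_ker.mp k.2, add_zero]
    refine Prod.ext h (Subtype.ext ?_)
    rw [coe_proj, h, add_sub_cancel_left]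

/-- A unit summand splits off. -/
noncomputable def iso : Iso X ((Obj.unit B).sum u.complement) :=
  Iso.ofEquiv (X := X) (Y := (Obj.unit B).sum u.complement) u.splitEquiv
    (fun x => by
      refine Prod.ext (u.p.map_smul _ _) (Subtype.ext ?_)
      change B.Sq1 • x - u.p (B.Sq1 • x) • u.c = B.Sq1 • (x - u.p x • u.c)
      rw [smul_sub, Sq1_smul_smul, u.Sq1_c, smul_zero, zero_add, map_smul, Sq1_unit])
    (fun x => by
      refine Prod.ext (u.p.map_smul _ _) (Subtype.ext ?_)
      change B.Sq2 • x - u.p (B.Sq2 • x) • u.c = B.Sq2 • (x - u.p x • u.c)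
      rw [smul_sub, Sq2_smul_smul, u.Sq2_c, u.Sq1_c, smul_zero, smul_zero, zero_add, zero_add,
        map_smul, Sq2_unit])
    (fun i x hx => ⟨u.p_mem hx, u.proj_mem hx⟩)
    (fun i y hy => by
      refine add_mem ?_ hy.2
      have := X.smul_mem hy.1 u.c_mem
      rwa [add_zero] at this)

theorem stableEquiv (h : Module.Projective B.A (LinearMap.ker u.p)) :
    StableEquiv X (Obj.unit B) :=
  have h0 : Module.Projective B.A (Obj.zero B).carrier :=
    inferInstanceAs (Module.Projective B.A PUnit)
  ⟨Obj.zero B, u.complement.sum (Obj.zero B), h0,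
    inferInstanceAs (Module.Projective B.A (LinearMap.ker u.p × (Obj.zero B).carrier)),
    ⟨(Iso.sumCongr u.iso (Iso.refl _)).trans (Iso.sumAssoc _ _ _)⟩⟩

end UnitSummand

/-! ### Shifts and duals -/

/-- Opposite shifts cancel in a tensor product. -/
noncomputable def Iso.shiftTensorShift (X Y : Obj B) {a b : B.Γ} (h : a + b = 0) :
    Iso ((X.shift a).tensor (Y.shift b)) (X.tensor Y) :=
  ofEquiv (X := (X.shift a).tensor (Y.shift b)) (Y := X.tensor Y)
    (LinearEquiv.refl B.R (X.carrier ⊗[B.R] Y.carrier)) (fun _ => rfl) (fun _ => rfl)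
    (fun d _ ht => Obj.tensorGr_induction (X.shift a) (Y.shift b)
      (AddMonoidHom.id (X.carrier ⊗[B.R] Y.carrier)) (Obj.tensorGr X Y d)
      (fun i j x y hx hy hd => Obj.tmul_mem X Y hx hy (by
        rw [← hd, sub_add_sub_comm, h, sub_zero])) ht)
    (fun d _ ht => Obj.tensorGr_induction X Y
      (AddMonoidHom.id (X.carrier ⊗[B.R] Y.carrier))
      (Obj.tensorGr (X.shift a) (Y.shift b) d)
      (fun i j x y hx hy hd => Obj.tmul_mem (X.shift a) (Y.shift b) (i := i + a) (j := j + b)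
        (by change x ∈ X.gr _; rwa [add_sub_cancel_right])
        (by change y ∈ Y.gr _; rwa [add_sub_cancel_right])
        (by rw [add_add_add_comm, h, add_zero, hd])) ht)

/-- A basis of homogeneous elements whose coordinate functions are homogeneous. -/
structure HomogeneousBasis (X : Obj B) (ι : Type) where
  /-- the basis -/
  basis : Module.Basis ι B.R X.carrier
  /-- the degrees of the basis elements -/
  deg : ι → B.Γ
  mem : ∀ i, basis i ∈ X.gr (deg i)
  coord_mem : ∀ (i : ι) {d : B.Γ} {x : X.carrier}, x ∈ X.gr d → basis.coord i x ∈ B.gr (d - deg i)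

/-- The linear functionals of degree `d`. -/
def Obj.dualGr (X : Obj B) (d : B.Γ) : AddSubgroup (X.carrier →ₗ[B.R] B.R) where
  carrier := {f | ∀ (k : B.Γ) (x : X.carrier), x ∈ X.gr k → f x ∈ B.gr (k + d)}
  zero_mem' _ _ _ := zero_mem _
  add_mem' ha hb k x hx := add_mem (ha k x hx) (hb k x hx)
  neg_mem' ha k x hx := neg_mem (ha k x hx)

namespace HomogeneousBasis

variable {X : Obj B} {ι : Type} [Fintype ι] (b : HomogeneousBasis X ι)

theorem smul_coord_mem (i : ι) {d : B.Γ} {r : B.R} (hr : r ∈ B.gr d) :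
    r • b.basis.coord i ∈ X.dualGr (d - b.deg i) := fun k x hx => by
  have h := B.mul_mem hr (b.coord_mem i hx)
  rwa [add_sub_left_comm] at h

theorem coord_mem_dualGr (i : ι) : b.basis.coord i ∈ X.dualGr (-b.deg i) := by
  have := b.smul_coord_mem i B.one_mem
  rwa [one_smul, zero_sub] at this

theorem sum_smul_coord (f : X.carrier →ₗ[B.R] B.R) :
    ∑ i, f (b.basis i) • b.basis.coord i = f := by
  classical
  refine b.basis.ext fun j => ?_
  simp [LinearMap.sum_apply, Finsupp.single_apply]

/-- The additive map that multiplies a coordinate function by coefficients. -/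
noncomputable def smulCoord (i : ι) : B.R →+ (X.carrier →ₗ[B.R] B.R) :=
  (LinearMap.toSpanSingleton B.R _ (b.basis.coord i)).toAddMonoidHom

theorem smulCoord_apply (i : ι) (r : B.R) : b.smulCoord i r = r • b.basis.coord i := rfl

theorem dual_internal (b : HomogeneousBasis X ι) : DirectSum.IsInternal X.dualGr := by
  refine isInternal_of_components
    (∑ i, (Finsupp.mapDomain.addMonoidHom (fun d => d - b.deg i)).comp
      ((Finsupp.mapRange.addMonoidHom (b.smulCoord i)).comp
        ((components B.internal).comp (LinearMap.applyₗ (b.basis i)).toAddMonoidHom))) ?_ ?_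
  · intro d f hf
    have h : ∀ i, components B.internal (f (b.basis i)) =
        Finsupp.single (b.deg i + d) (f (b.basis i)) :=
      fun i => components_of_mem B.internal (hf _ _ (b.mem i))
    simp only [AddMonoidHom.finsetSum_apply, AddMonoidHom.comp_apply, LinearMap.applyₗ_apply_apply,
      LinearMap.toAddMonoidHom_coe, h, Finsupp.mapRange.addMonoidHom_apply,
      Finsupp.mapRange_single, Finsupp.mapDomain.addMonoidHom_apply, Finsupp.mapDomain_single,
      add_sub_cancel_left, smulCoord_apply]
    rw [← Finsupp.single_finsetSum, b.sum_smul_coord]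
  · intro f
    rw [← b.sum_smul_coord f]
    refine sum_mem fun i _ => ?_
    rw [← smulCoord_apply]
    exact graded_induction B.internal (p := fun r => b.smulCoord i r ∈ _) (f (b.basis i))
      (by rw [map_zero]; exact zero_mem _) (fun a b ha hb => by rw [map_add]; exact add_mem ha hb)
      (fun d r hr => AddSubgroup.subset_closure ⟨_, b.smul_coord_mem i hr⟩)

/-- The dual module, with the operations of the internal hom. -/
noncomputable def dual : Obj B where
  carrier := X.carrier →ₗ[B.R] B.R
  gr := X.dualGr
  internal := b.dual_internal
  smul_mem {i j r f} hr hf k x hx := by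
    have := B.mul_mem hr (hf k x hx)
    rwa [add_left_comm] at this
  Sq1_mem {i f} hf k x hx := by
    rw [Sq1_hom, Sq1_unit]
    refine add_mem ?_ ?_
    · have := B.sq1_mem (hf k x hx)
      rwa [add_assoc] at this
    · have := hf _ _ (X.Sq1_mem hx)
      rwa [add_assoc, add_comm B.e1] at this
  Sq2_mem {i f} hf k x hx := by
    rw [Sq2_hom, Sq2_unit, Sq1_unit]
    refine add_mem (add_mem ?_ ?_) ?_
    · have := B.sq2_mem (hf k x hx)
      rwa [add_assoc] at this
    · have := B.mul_mem B.τ_mem (B.sq1_mem (hf _ _ (X.Sq1_mem hx)))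
      have e : B.e2 - (B.e1 + B.e1) + (k + B.e1 + i + B.e1) = k + (i + B.e2) := by abel
      rwa [e] at this
    · have := hf _ _ (X.Sq2_mem hx)
      rwa [add_assoc, add_comm B.e2] at this
  finite := have := Module.Finite.of_basis b.basis
    have := Module.Free.of_basis b.basis
    inferInstance
  projective := have := Module.Finite.of_basis b.basis
    have := Module.Free.of_basis b.basis
    inferInstance

/-- The evaluation pairing of a module with its dual. -/
noncomputable def ev : X.carrier ⊗[B.R] (X.carrier →ₗ[B.R] B.R) →ₗ[B.A] B.R :=
  { contractRight B.R X.carrier with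
    map_smul' := map_smul_of_gen (contractRight B.R X.carrier).toAddMonoidHom
      (fun r t => (contractRight B.R X.carrier).map_smul r t)
      (map_smul_of_tmul _ (contractRight B.R X.carrier) fun x f => by
        apply eq_of_add_eq_zero B
        simp only [Sq1_tmul, map_add, contractRight_apply, Sq1_hom]
        abel_nf
        simp only [two_zsmul_eq_zero B, zero_add, add_zero])
      (map_smul_of_tmul _ (contractRight B.R X.carrier) fun x f => by
        apply eq_of_add_eq_zero B
        simp only [Sq2_tmul, map_add, map_smul, contractRight_apply, Sq1_hom, Sq2_hom,
          Sq1_Sq1_smul, map_zero, add_zero, smul_add]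
        abel_nf
        simp only [two_zsmul_eq_zero B, zero_add, add_zero]) }

theorem ev_mem {d : B.Γ} {t : X.carrier ⊗[B.R] (X.carrier →ₗ[B.R] B.R)}
    (ht : t ∈ (X.tensor b.dual).gr d) : ev t ∈ B.gr d :=
  Obj.tensorGr_induction X b.dual (ev (X := X)).toAddMonoidHom _
    (fun i j x f hx hf hd => by
      subst hd
      exact hf i x hx) ht

end HomogeneousBasis

end SteenrodBase

namespace SteenrodBase

variable (B : SteenrodBase)

/-! ### The homogeneous basis of the joker and its dual -/

/-- The basis `1, Sq¹, Sq², Sq²Sq¹, Sq¹Sq²Sq¹` of the joker over the coefficients. -/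
noncomputable def jokerBasis : Module.Basis (Fin 5) B.R B.JokerModule :=
  .ofEquivFun B.jokerEquivR

theorem coordOfJoker_jokerBasis (i : Fin 5) :
    B.coordOfJoker (B.jokerBasis i) = B.jsingle i 1 :=
  (congrArg B.jokerEquivR (Module.Basis.coe_ofEquivFun B.jokerEquivR ▸ rfl)).trans
    (B.jokerEquivR.apply_symm_apply (Pi.single i 1))

theorem jokerBasis_coord (i : Fin 5) (x : B.JokerModule) :
    B.jokerBasis.coord i x = B.jc i (B.coordOfJoker x) := rfl

/-- The basis of the joker as a homogeneous basis. -/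
noncomputable def jokerHomogeneousBasis : HomogeneousBasis B.joker (Fin 5) where
  basis := B.jokerBasis
  deg := B.jdeg
  mem i := by
    have h := jokerOfCoord_mem (jsingle_mem (i := i) B.one_mem)
    rwa [← coordOfJoker_jokerBasis, jokerOfCoord_coordOfJoker, zero_add] at h
  coord_mem i _ _ hx := coordOfJoker_mem hx i

theorem Sq1_jokerBasis (i : Fin 5) : B.Sq1 • B.jokerBasis i =
    (![B.jokerBasis 1, 0, 0, B.jokerBasis 4, 0] : Fin 5 → B.JokerModule) i := by
  apply B.jokerEquiv.injective
  change B.coordOfJoker _ = B.coordOfJoker _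
  rw [map_smul, Sq1_jokerCoord, coordOfJoker_jokerBasis, jsq1_apply]
  fin_cases i <;> apply jext <;>
    simp [coordOfJoker_jokerBasis, jc_jsingle, sq1_one]

theorem Sq2_jokerBasis (i : Fin 5) : B.Sq2 • B.jokerBasis i =
    (![B.jokerBasis 2, B.jokerBasis 3, B.τ • B.jokerBasis 4, 0, 0] : Fin 5 → B.JokerModule) i := by
  apply B.jokerEquiv.injective
  change B.coordOfJoker _ = B.coordOfJoker _
  rw [map_smul, Sq2_jokerCoord, coordOfJoker_jokerBasis, jsq2_apply]
  fin_cases i <;> apply jext <;>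
    simp [coordOfJoker_jokerBasis, jc_jsingle, sq1_one, sq2_one, map_coeff_smul]

theorem jokerBasis_coord_jokerBasis (i j : Fin 5) :
    B.jokerBasis.coord i (B.jokerBasis j) = if i = j then 1 else 0 := by
  rw [jokerBasis_coord, coordOfJoker_jokerBasis, jc_jsingle]

theorem Sq1_jokerBasis_coord (i : Fin 5) : B.Sq1 • B.jokerBasis.coord i =
    (![0, B.jokerBasis.coord 0, 0, 0, B.jokerBasis.coord 3] :
      Fin 5 → B.JokerModule →ₗ[B.R] B.R) i := by
  refine B.jokerBasis.ext fun j => ?_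
  rw [Sq1_hom, Sq1_unit, Sq1_jokerBasis, jokerBasis_coord_jokerBasis]
  fin_cases i <;> fin_cases j <;>
    simp [-Module.Basis.coord_apply, jokerBasis_coord_jokerBasis, sq1_one]

theorem Sq2_jokerBasis_coord (i : Fin 5) : B.Sq2 • B.jokerBasis.coord i =
    (![0, 0, B.jokerBasis.coord 0, B.jokerBasis.coord 1, B.τ • B.jokerBasis.coord 2] :
      Fin 5 → B.JokerModule →ₗ[B.R] B.R) i := by
  refine B.jokerBasis.ext fun j => ?_
  rw [Sq2_hom, Sq2_unit, Sq1_unit, Sq1_jokerBasis, Sq2_jokerBasis, jokerBasis_coord_jokerBasis]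
  fin_cases i <;> fin_cases j <;>
    simp [-Module.Basis.coord_apply, jokerBasis_coord_jokerBasis, sq1_one, sq2_one]

/-! ### The tensor product of the joker with its dual -/

/-- The underlying module of the tensor product of the joker with its dual. -/
abbrev JokerEnd : Type := B.JokerModule ⊗[B.R] (B.JokerModule →ₗ[B.R] B.R)

/-- The basis elements of the tensor product of the joker with its dual. -/
noncomputable def jokerUnit (i j : Fin 5) : B.JokerEnd :=
  B.jokerBasis i ⊗ₜ B.jokerBasis.coord j

/-- The evaluation of the tensor product of the joker with its dual. -/
noncomputable def jokerEv : B.JokerEnd →ₗ[B.A] B.R := HomogeneousBasis.ev (X := B.joker)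

theorem jokerEv_jokerUnit (i j : Fin 5) :
    B.jokerEv (B.jokerUnit i j) = if j = i then 1 else 0 :=
  B.jokerBasis_coord_jokerBasis j i

/-- The element that corresponds to the identity of the joker. -/
noncomputable def jokerId : B.JokerEnd := ∑ i, B.jokerUnit i i

theorem jokerEv_jokerId : B.jokerEv B.jokerId = 1 := by
  have h2 := B.two_eq_zero
  rw [jokerId, map_sum]
  simp only [jokerEv_jokerUnit, if_true, Fin.sum_univ_five]
  linear_combination 2 * h2

theorem Sq1_jokerUnit (i j : Fin 5) : B.Sq1 • B.jokerUnit i j =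
    (![B.jokerBasis 1, 0, 0, B.jokerBasis 4, 0] : Fin 5 → B.JokerModule) i ⊗ₜ
      B.jokerBasis.coord j + B.jokerBasis i ⊗ₜ
      (![0, B.jokerBasis.coord 0, 0, 0, B.jokerBasis.coord 3] :
      Fin 5 → B.JokerModule →ₗ[B.R] B.R) j := by
  rw [jokerUnit, Sq1_tmul, Sq1_jokerBasis, Sq1_jokerBasis_coord]

theorem Sq2_jokerUnit (i j : Fin 5) : B.Sq2 • B.jokerUnit i j =
    (![B.jokerBasis 2, B.jokerBasis 3, B.τ • B.jokerBasis 4, 0, 0] :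
        Fin 5 → B.JokerModule) i ⊗ₜ B.jokerBasis.coord j +
      B.τ • ((![B.jokerBasis 1, 0, 0, B.jokerBasis 4, 0] : Fin 5 → B.JokerModule) i ⊗ₜ
      (![0, B.jokerBasis.coord 0, 0, 0, B.jokerBasis.coord 3] :
      Fin 5 → B.JokerModule →ₗ[B.R] B.R) j) + B.jokerBasis i ⊗ₜ
      (![0, 0, B.jokerBasis.coord 0, B.jokerBasis.coord 1, B.τ • B.jokerBasis.coord 2] :
      Fin 5 → B.JokerModule →ₗ[B.R] B.R) j := by
  rw [jokerUnit, Sq2_tmul, Sq1_jokerBasis, Sq1_jokerBasis_coord, Sq2_jokerBasis,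
    Sq2_jokerBasis_coord]

theorem Sq1_jokerId : B.Sq1 • B.jokerId = 0 := by
  rw [jokerId, Finset.smul_sum]
  simp only [Sq1_jokerUnit, Fin.sum_univ_five, Matrix.cons_val, TensorProduct.zero_tmul,
    TensorProduct.tmul_zero, zero_add, add_zero]
  abel_nf
  simp only [two_zsmul_eq_zero B, zero_add, add_zero]

theorem Sq2_jokerId : B.Sq2 • B.jokerId = 0 := by
  rw [jokerId, Finset.smul_sum]
  simp only [Sq2_jokerUnit, Fin.sum_univ_five, Matrix.cons_val, TensorProduct.zero_tmul,
    TensorProduct.tmul_zero, zero_add, add_zero, smul_zero, ← TensorProduct.smul_tmul',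
    TensorProduct.tmul_smul]
  abel_nf
  simp only [two_zsmul_eq_zero B, zero_add, add_zero]

/-- The tensor unit is a direct summand of the tensor product of the joker with its dual, since
the rank `5` of the joker is odd. -/
noncomputable def jokerUnitSummand :
    UnitSummand (B.joker.tensor B.jokerHomogeneousBasis.dual) where
  p := B.jokerEv
  p_mem := HomogeneousBasis.ev_mem _
  c := B.jokerId
  c_mem := sum_mem fun i _ => Obj.tmul_mem _ _ (B.jokerHomogeneousBasis.mem i)
    (B.jokerHomogeneousBasis.coord_mem_dualGr i) (add_neg_cancel _)
  Sq1_c := B.Sq1_jokerId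
  Sq2_c := B.Sq2_jokerId
  p_c := B.jokerEv_jokerId

/-- Generators of the kernel of the evaluation over `A(1)`. -/
noncomputable def jokerGen : Fin 3 → B.JokerEnd :=
  ![B.jokerUnit 0 2, B.jokerUnit 0 3, B.jokerUnit 0 4]

theorem jokerGen_mem_ker (k : Fin 3) : B.jokerEv (B.jokerGen k) = 0 := by
  fin_cases k <;> exact (B.jokerEv_jokerUnit _ _).trans (if_neg (by decide))

/-- The identity and the `A(1)`-multiples of the three generators span the tensor product of the
joker with its dual: applying `Sq¹` and `Sq²` to the generators yields every off-diagonal basis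
element, and the differences of the diagonal ones. -/
theorem jokerUnit_mem (S : Submodule B.A B.JokerEnd) (hS : ∀ k, B.jokerGen k ∈ S) (i j : Fin 5) :
    B.jokerUnit i j ∈ S.restrictScalars B.R ⊔ Submodule.span B.R {B.jokerId} := by
  have hf : ∀ i j, B.jokerBasis i ⊗ₜ[B.R] B.jokerBasis.coord j = B.jokerUnit i j :=
    fun _ _ => rfl
  have hr : ∀ (r : B.R) {t : B.JokerEnd}, t ∈ S → r • t ∈ S :=
    fun r t h => (S.restrictScalars B.R).smul_mem r h
  have q1 : ∀ {t : B.JokerEnd}, t ∈ S → B.Sq1 • t ∈ S := fun h => S.smul_mem _ h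
  have q2 : ∀ {t : B.JokerEnd}, t ∈ S → B.Sq2 • t ∈ S := fun h => S.smul_mem _ h
  have h02 : B.jokerUnit 0 2 ∈ S := hS 0
  have h03 : B.jokerUnit 0 3 ∈ S := hS 1
  have h04 : B.jokerUnit 0 4 ∈ S := hS 2
  have s02 := q1 h02
  have s03 := q1 h03
  have s04 := q1 h04
  have t02 := q2 h02
  have t03 := q2 h03
  have t04 := q2 h04
  simp only [Sq1_jokerUnit, Sq2_jokerUnit, Matrix.cons_val, TensorProduct.zero_tmul,
    TensorProduct.tmul_zero, zero_add, add_zero, smul_zero, ← TensorProduct.smul_tmul',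
    TensorProduct.tmul_smul, hf] at s02 s03 s04 t02 t03 t04
  have h14 := (S.add_mem_iff_left h03).mp s04
  have h24 := (S.add_mem_iff_left (hr B.τ s03)).mp ((S.add_mem_iff_left (hr B.τ h02)).mp t04)
  have s1 := q1 t02
  have s2 := q1 t03
  have s3 := q1 h24
  have t1 := q2 s02
  have t2 := q2 s03
  have t3 := q2 h14
  simp only [Sq1_jokerUnit, Sq2_jokerUnit, Matrix.cons_val, TensorProduct.zero_tmul, smul_add,
    TensorProduct.tmul_zero, zero_add, add_zero, smul_zero, ← TensorProduct.smul_tmul',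
    TensorProduct.tmul_smul, hf] at s1 s2 s3 t1 t2 t3
  have h32 := (S.add_mem_iff_left s1).mp t1
  have h34 := (S.add_mem_iff_left (hr B.τ s02)).mp t3
  have h01 := (S.add_mem_iff_right s3).mp t03
  have u1 := q1 h32
  have u2 := q1 h34
  have u3 := q1 t2
  have v1 := q2 h01
  have v2 := q2 s1
  have v3 := q2 s2
  simp only [Sq1_jokerUnit, Sq2_jokerUnit, Matrix.cons_val, TensorProduct.zero_tmul, smul_add,
    TensorProduct.tmul_zero, zero_add, add_zero, smul_zero, ← TensorProduct.smul_tmul',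
    TensorProduct.tmul_smul, hf] at u1 u2 u3 v1 v2 v3
  have h21 := (S.add_mem_iff_left (hr B.τ s1)).mp v1
  have h43 := (S.add_mem_iff_left s1).mp u3
  have w1 := q1 h21
  have w2 := q1 v2
  have w3 := q2 h43
  simp only [Sq1_jokerUnit, Sq2_jokerUnit, Matrix.cons_val, TensorProduct.zero_tmul, smul_add,
    TensorProduct.tmul_zero, zero_add, add_zero, smul_zero, ← TensorProduct.smul_tmul',
    TensorProduct.tmul_smul, hf] at w1 w2 w3
  have h31 := (S.add_mem_iff_left w1).mp v3
  have hle : ∀ {t : B.JokerEnd}, t ∈ S →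
      t ∈ S.restrictScalars B.R ⊔ Submodule.span B.R {B.jokerId} :=
    fun h => Submodule.mem_sup_left h
  have d11 : B.jokerUnit 1 1 ∈ S.restrictScalars B.R ⊔ Submodule.span B.R {B.jokerId} := by
    -- a five-term sum minus two disjoint pairs
    have e : B.jokerUnit 1 1 = B.jokerId - (B.jokerUnit 2 2 + B.jokerUnit 0 0) -
        (B.jokerUnit 4 4 + B.jokerUnit 3 3) := by
      rw [jokerId, Fin.sum_univ_five]; abel
    rw [e]
    exact sub_mem (sub_mem (Submodule.mem_sup_right (Submodule.mem_span_singleton_self _))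
      (hle t02)) (hle u2)
  have d00 := (Submodule.add_mem_iff_right _ d11).mp (hle s2)
  have d22 := (Submodule.add_mem_iff_left _ d00).mp (hle t02)
  have d33 := (Submodule.add_mem_iff_left _ d11).mp (hle t2)
  have d44 := (Submodule.add_mem_iff_left _ d33).mp (hle u2)
  fin_cases i <;> fin_cases j
  exacts [d00, hle h01, hle h02, hle h03, hle h04, hle s1, d11, hle s02, hle s03, hle h14,
    hle w1, hle h21, d22, hle s3, hle h24, hle v2, hle h31, hle h32, d33, hle h34,
    hle w2, hle w3, hle u1, hle h43, d44]

/-! ### Freeness -/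

/-- The `A(1)`-linear map from the free module of rank `3` given by the three generators. -/
noncomputable def jokerGenMap : (Fin 3 → B.A) →ₗ[B.A] B.JokerEnd :=
  Fintype.linearCombination B.A B.jokerGen

/-- The `25 = 1 + 3 · 8` elements consisting of the identity and the products of the monomials in
`A(1)` with the three generators. -/
noncomputable def jokerFamily : Unit ⊕ (Fin 3 × Fin 8) → B.JokerEnd :=
  Sum.elim (fun _ => B.jokerId) fun k => B.monomial k.2 • B.jokerGen k.1

variable {B}

theorem linearCombination_jokerFamily (r : B.R) (c : Fin 3 → Fin 8 → B.R) :
    Fintype.linearCombination B.R B.jokerFamily (Sum.elim (fun _ => r) fun k => c k.1 k.2) =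
      r • B.jokerId + B.jokerGenMap fun k => ∑ i, c k i • B.monomial i := by
  simp only [Fintype.linearCombination_apply, jokerGenMap, jokerFamily, Fintype.sum_sum_type,
    Fintype.sum_prod_type, Sum.elim_inl, Sum.elim_inr, Finset.univ_unique, Finset.sum_singleton,
    Finset.sum_smul, smul_assoc]

theorem jokerFamily_surjective :
    Function.Surjective (Fintype.linearCombination B.R B.jokerFamily) := by
  intro t
  have hmem : ∀ k, B.jokerGen k ∈ LinearMap.range B.jokerGenMap := fun k =>
    ⟨Pi.single k 1, by simp [jokerGenMap]⟩
  have ht : t ∈ (LinearMap.range B.jokerGenMap).restrictScalars B.R ⊔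
      Submodule.span B.R {B.jokerId} := by
    induction t using TensorProduct.induction_on with
    | zero => exact zero_mem _
    | add x y hx hy => exact add_mem hx hy
    | tmul x f =>
      have hf : ∑ j, f (B.jokerBasis j) • B.jokerBasis.coord j = f :=
        B.jokerHomogeneousBasis.sum_smul_coord f
      rw [← B.jokerBasis.sum_repr x, ← hf]
      simp only [TensorProduct.sum_tmul, TensorProduct.tmul_sum, ← TensorProduct.smul_tmul',
        TensorProduct.tmul_smul]
      exact sum_mem fun i _ => Submodule.smul_mem _ _ (sum_mem fun j _ =>
        Submodule.smul_mem _ _ (jokerUnit_mem B _ hmem _ _))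
  obtain ⟨_, ⟨a, rfl⟩, y, hy, rfl⟩ := Submodule.mem_sup.mp ht
  obtain ⟨r, rfl⟩ := Submodule.mem_span_singleton.mp hy
  choose c hc using fun k => exists_sum_monomial (a k)
  refine ⟨Sum.elim (fun _ => r) fun k => c k.1 k.2, ?_⟩
  rw [linearCombination_jokerFamily, add_comm]
  simp only [hc]

/-- A spanning family of `25` elements in a free module of rank `25` is a basis. -/
theorem jokerFamily_injective :
    Function.Injective (Fintype.linearCombination B.R B.jokerFamily) := by
  have b := B.jokerBasis.tensorProduct B.jokerBasis.dualBasis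
  have e : B.JokerEnd ≃ₗ[B.R] (Unit ⊕ (Fin 3 × Fin 8) → B.R) :=
    (b.reindex (Fintype.equivOfCardEq (by simp))).equivFun
  have h := OrzechProperty.injective_of_surjective_endomorphism
    (e.toLinearMap ∘ₗ Fintype.linearCombination B.R B.jokerFamily)
    (e.surjective.comp jokerFamily_surjective)
  exact Function.Injective.of_comp h

theorem jokerGenMap_injective : Function.Injective B.jokerGenMap := by
  rw [injective_iff_map_eq_zero]
  intro a ha
  choose c hc using fun k => exists_sum_monomial (a k)
  have h0 : (Sum.elim (fun _ => 0) fun k => c k.1 k.2 : Unit ⊕ (Fin 3 × Fin 8) → B.R) = 0 := by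
    apply jokerFamily_injective
    rw [linearCombination_jokerFamily, map_zero, zero_smul, zero_add]
    simp only [hc]
    exact ha
  funext k
  rw [← hc k]
  exact Finset.sum_eq_zero fun i _ => by
    rw [show c k i = 0 from congrFun h0 (Sum.inr (k, i)), zero_smul]

/-- The eight monomials are linearly independent over the coefficients. -/
theorem linearIndependent_monomial : LinearIndependent B.R B.monomial := by
  rw [Fintype.linearIndependent_iff]
  intro c hc i
  have h0 : (Sum.elim (fun _ => 0) fun k => if k.1 = 0 then c k.2 else 0 :
      Unit ⊕ (Fin 3 × Fin 8) → B.R) = 0 := by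
    apply jokerFamily_injective
    rw [linearCombination_jokerFamily 0 fun k i => if k = 0 then c i else 0, map_zero, zero_smul,
      zero_add, ← map_zero B.jokerGenMap]
    congr 1
    funext k
    split_ifs with h
    · exact hc
    · simp
  exact congrFun h0 (Sum.inr (0, i))

theorem range_jokerGenMap : LinearMap.range B.jokerGenMap = LinearMap.ker B.jokerEv := by
  have hφ : ∀ a, B.jokerEv (B.jokerGenMap a) = 0 := fun a => by
    simp only [jokerGenMap, Fintype.linearCombination_apply, map_sum, map_smul, jokerGen_mem_ker,
      smul_zero, Finset.sum_const_zero]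
  refine le_antisymm ?_ fun t ht => ?_
  · rintro _ ⟨a, rfl⟩
    exact hφ a
  · obtain ⟨d, rfl⟩ := jokerFamily_surjective t
    have hd : d = Sum.elim (fun _ => d (Sum.inl ())) fun k => d (Sum.inr (k.1, k.2)) := by
      funext x
      rcases x with _ | _ <;> rfl
    rw [hd, linearCombination_jokerFamily _ fun k i => d (Sum.inr (k, i))] at ht ⊢
    have h0 : d (Sum.inl ()) = 0 := by
      rw [LinearMap.mem_ker, map_add, map_coeff_smul, hφ, jokerEv_jokerId, smul_eq_mul, mul_one,
        add_zero] at ht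
      exact ht
    rw [h0, zero_smul, zero_add]
    exact ⟨_, rfl⟩

variable (B)

theorem projective_ker_jokerEv : Module.Projective B.A (LinearMap.ker B.jokerEv) :=
  .of_equiv ((LinearEquiv.ofInjective _ jokerGenMap_injective).trans
    (LinearEquiv.ofEq _ _ range_jokerGenMap))

/-- The dual of the joker is its stable inverse. -/
theorem joker_tensor_dual :
    StableEquiv (B.joker.tensor B.jokerHomogeneousBasis.dual) (Obj.unit B) :=
  B.jokerUnitSummand.stableEquiv B.projective_ker_jokerEv

theorem stablyInvertible_joker : StablyInvertible B.joker := ⟨_, B.joker_tensor_dual⟩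

theorem shift_joker_tensor_shift_dual {a b : B.Γ} (h : a + b = 0) :
    StableEquiv ((B.joker.shift a).tensor (B.jokerHomogeneousBasis.dual.shift b)) (Obj.unit B) :=
  (StableEquiv.of_iso (Iso.shiftTensorShift _ _ h)).trans B.joker_tensor_dual

theorem stablyInvertible_shift_joker (d : B.Γ) : StablyInvertible (B.joker.shift d) :=
  ⟨_, B.shift_joker_tensor_shift_dual (add_neg_cancel d)⟩

end SteenrodBase

namespace SteenrodBase

variable {B : SteenrodBase}

/-! ### Degrees of homology classes -/

section detection

variable {k : Type} [CommRing k] {ε : B.R →+* k} {θ : B.A} {X Y : Obj B}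

/-- A `θ`-cycle of degree `e` in `X`, also annihilated by `Sq¹`, that is detected by a functional
to `k` which is semilinear along `ε` and vanishes on `θ`-boundaries; so the cycle represents a
nonzero class in the `θ`-homology of `X` after base change along `ε`. -/
def HasHomologyClass (ε : B.R →+* k) (θ : B.A) (X : Obj B) (e : B.Γ) : Prop :=
  ∃ z ∈ X.gr e, B.Sq1 • z = 0 ∧ θ • z = 0 ∧ ∃ μ : X.carrier →+ k,
    (∀ (r : B.R) x, μ (r • x) = ε r * μ x) ∧ (∀ x, μ (θ • x) = 0) ∧ μ z = 1

theorem HasHomologyClass.shift {e : B.Γ} (h : HasHomologyClass ε θ X e) (d : B.Γ) :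
    HasHomologyClass ε θ (X.shift d) (e + d) := by
  obtain ⟨z, hz, h⟩ := h
  refine ⟨z, ?_, h⟩
  change z ∈ X.gr (e + d - d)
  rwa [add_sub_cancel_right]

/-- The operations that act as derivations on tensor products after base change along `ε`. -/
def IsDerivationAlong (ε : B.R →+* k) (θ : B.A) : Prop :=
  θ = B.Sq1 ∨ θ = B.Sq2 ∧ ε B.τ = 0

theorem HasHomologyClass.tensor (hθ : IsDerivationAlong ε θ) {e e' : B.Γ}
    (h : HasHomologyClass ε θ X e) (h' : HasHomologyClass ε θ Y e') :
    HasHomologyClass ε θ (X.tensor Y) (e + e') := by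
  obtain ⟨z, hz, hz1, hzθ, μ, hμ, hμθ, hμz⟩ := h
  obtain ⟨z', hz', hz1', hzθ', μ', hμ', hμθ', hμz'⟩ := h'
  let ν : X.carrier ⊗[B.R] Y.carrier →+ k := TensorProduct.liftAddHom
    ((AddMonoidHom.mul.comp μ).compl₂ μ') fun r x y => by
      change μ (r • x) * μ' y = μ x * μ' (r • y)
      rw [hμ, hμ']
      ring
  have hν : ∀ x y, ν (x ⊗ₜ y) = μ x * μ' y := fun _ _ => rfl
  have hνr : ∀ (r : B.R) t, ν (r • t) = ε r * ν t := fun r t => by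
    induction t using TensorProduct.induction_on with
    | zero => rw [smul_zero, map_zero, mul_zero]
    | add x y hx hy => rw [smul_add, map_add, map_add, hx, hy, mul_add]
    | tmul x y => rw [TensorProduct.smul_tmul', hν, hν, hμ, mul_assoc]
  have hνθ : ∀ t : X.carrier ⊗[B.R] Y.carrier, ν (θ • t) = 0 := fun t => by
    induction t using TensorProduct.induction_on with
    | zero => rw [smul_zero, map_zero]
    | add x y hx hy => rw [smul_add, map_add, hx, hy, add_zero]
    | tmul x y =>
      rcases hθ with rfl | ⟨rfl, hτ⟩
      · rw [Sq1_tmul, map_add, hν, hν, hμθ, hμθ', zero_mul, mul_zero, add_zero]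
      · rw [Sq2_tmul, map_add, map_add, hνr, hν, hν, hν, hμθ, hμθ', hτ, zero_mul, zero_mul,
          mul_zero, add_zero, add_zero]
  refine ⟨z ⊗ₜ z', Obj.tmul_mem X Y hz hz' rfl, ?_, ?_, ν, hνr, hνθ, ?_⟩
  · change B.Sq1 • (z ⊗ₜ[B.R] z') = 0
    rw [Sq1_tmul, hz1, hz1', TensorProduct.zero_tmul, TensorProduct.tmul_zero, add_zero]
  · change θ • (z ⊗ₜ[B.R] z') = 0
    rcases hθ with rfl | ⟨rfl, -⟩
    · rw [Sq1_tmul, hz1, hz1', TensorProduct.zero_tmul, TensorProduct.tmul_zero, add_zero]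
    · rw [Sq2_tmul, hzθ, hzθ', hz1, TensorProduct.zero_tmul, TensorProduct.zero_tmul,
        TensorProduct.tmul_zero, smul_zero, add_zero, add_zero]
  · exact (hν z z').trans (by rw [hμz, hμz', one_mul])

theorem HasHomologyClass.pow (hθ : IsDerivationAlong ε θ) {e : B.Γ}
    (h : HasHomologyClass ε θ X e) (n : ℕ) :
    ∃ Y : Obj B, Y.cls = X.cls ^ (n + 1) ∧ HasHomologyClass ε θ Y ((n + 1) • e) := by
  induction n with
  | zero => exact ⟨X, by rw [zero_add, pow_one], by rwa [zero_add, one_smul]⟩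
  | succ n ih =>
    obtain ⟨Y, hY, hc⟩ := ih
    refine ⟨Y.tensor X, ?_, ?_⟩
    · rw [pow_succ X.cls (n + 1), ← hY]
      rfl
    · rw [succ_nsmul e (n + 1)]
      exact hc.tensor hθ h

/-- The homology of the unit is concentrated in degree `0` and projective modules have none, so a
stably trivial module has homology classes in degree `0` only. -/
theorem HasHomologyClass.eq_zero {e : B.Γ} [Nontrivial k] (h : HasHomologyClass ε θ X e)
    (hε : ∀ r ∈ B.gr e, e ≠ 0 → ε r = 0) (hθ : ExactAlong ε θ)
    (hX : StableEquiv X (Obj.unit B)) : e = 0 := by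
  by_contra he
  obtain ⟨P, Q, -, hQ, ⟨f⟩⟩ := hX
  obtain ⟨z, hz, -, hzθ, μ, hμ, hμθ, hμz⟩ := h
  let ν : B.R × Q.carrier →+ k :=
    (μ.comp (AddMonoidHom.fst X.carrier P.carrier)).comp f.equiv.symm.toLinearMap.toAddMonoidHom
  have hν : ∀ y, ν y = μ (f.equiv.symm y).1 := fun _ => rfl
  have hνr : ∀ (r : B.R) y, ν (r • y) = ε r * ν y := fun r y => by
    have h1 : f.equiv.symm (r • y) = r • f.equiv.symm y := f.symm.equivR.map_smul r y
    rw [hν, hν, h1, ← hμ]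
    rfl
  have hνθ : ∀ y, ν (θ • y) = 0 := fun y => by
    have h1 : f.equiv.symm (θ • y) = θ • f.equiv.symm y := f.equiv.symm.map_smul θ y
    rw [hν, h1]
    exact hμθ _
  let y : B.R × Q.carrier := f.equiv ((z, 0) : X.carrier × P.carrier)
  have hy : ν y = 1 := by
    rw [hν]
    exact (congrArg (fun w : X.carrier × P.carrier => μ w.1)
      (f.equiv.symm_apply_apply ((z, 0) : X.carrier × P.carrier))).trans hμz
  have hymem : y.1 ∈ B.gr e :=
    (f.map_mem (x := ((z, 0) : X.carrier × P.carrier)) ⟨hz, zero_mem _⟩).1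
  have hyθ : θ • y = 0 := by
    have h1 : θ • ((z, 0) : X.carrier × P.carrier) = 0 := Prod.ext hzθ (smul_zero _)
    exact (f.equiv.map_smul θ ((z, 0) : X.carrier × P.carrier)).symm.trans
      ((congrArg f.equiv h1).trans f.equiv.map_zero)
  have h2 : ν ((0 : B.R), y.2) = 0 :=
    hθ.projective (ν.comp (AddMonoidHom.inr B.R Q.carrier))
      (fun r q => by
        have := hνr r (0, q)
        rwa [Prod.smul_mk, smul_zero] at this)
      (fun q => by
        have := hνθ (0, q)
        rwa [Prod.smul_mk, smul_zero] at this) y.2 (congrArg Prod.snd hyθ)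
  have h1 : ν (y.1, (0 : Q.carrier)) = 0 := by
    have e1 : ((y.1, 0) : B.R × Q.carrier) = y.1 • ((1, 0) : B.R × Q.carrier) := by
      rw [Prod.smul_mk, smul_zero, smul_eq_mul, mul_one]
    rw [e1, hνr, hε _ hymem he, zero_mul]
  have h3 : ν y = ν (y.1, (0 : Q.carrier)) + ν ((0 : B.R), y.2) := by
    rw [← map_add, Prod.mk_add_mk, add_zero, zero_add]
    rfl
  rw [hy, h1, h2, add_zero] at h3
  exact one_ne_zero h3

/-- If the classes of `Sq¹`- and `Sq²`-homology of an invertible module have different degrees,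
then its class in the Picard group has infinite order. -/
theorem StablyInvertible.not_isOfFinOrder [IsAddTorsionFree B.Γ] [Nontrivial k]
    (h : StablyInvertible X) (hε : ∀ e : B.Γ, ∀ r ∈ B.gr e, e ≠ 0 → ε r = 0)
    (h1 : ∀ r, ε (B.sq1 r) = 0) (h2 : ∀ r, ε (B.sq2 r) = 0) (hτ : ε B.τ = 0) {e e' : B.Γ}
    (he : HasHomologyClass ε B.Sq1 X e) (he' : HasHomologyClass ε B.Sq2 X e') (hne : e ≠ e') :
    ¬ IsOfFinOrder h.picClass := by
  rw [isOfFinOrder_iff_pow_eq_one]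
  rintro ⟨n, hn, hpow⟩
  obtain ⟨n, rfl⟩ := Nat.exists_eq_succ_of_ne_zero hn.ne'
  have hX : X.cls ^ (n + 1) = (Obj.unit B).cls := congrArg Units.val hpow
  have key : ∀ {θ : B.A} {d : B.Γ}, IsDerivationAlong ε θ → ExactAlong ε θ →
      HasHomologyClass ε θ X d → d = 0 := fun hθ hex hd => by
    obtain ⟨Y, hY, hc⟩ := hd.pow hθ n
    have hYs : StableEquiv Y (Obj.unit B) :=
      Quotient.exact (s := stableSetoid B) (hY.trans hX)
    exact (smul_eq_zero.mp (hc.eq_zero (hε _) hex hYs)).resolve_left (Nat.succ_ne_zero n)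
  exact hne ((key (.inl rfl) (.of_Sq1 linearIndependent_monomial ε h1) he).trans
    (key (.inr ⟨rfl, hτ⟩) (.of_Sq2 linearIndependent_monomial ε h2 hτ) he').symm)

end detection

/-! ### The joker has infinite order over the real motivic coefficients -/

section joker

variable {k : Type} [CommRing k] (ε : B.R →+* k)

/-- The element `Sq²` of the joker represents a nonzero class in its `Sq¹`-homology. -/
theorem hasHomologyClass_joker_Sq1 (h1 : ∀ r, ε (B.sq1 r) = 0) :
    HasHomologyClass ε B.Sq1 B.joker B.e2 := by
  refine ⟨B.jokerBasis 2, B.jokerHomogeneousBasis.mem 2, B.Sq1_jokerBasis 2, B.Sq1_jokerBasis 2,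
    ε.toAddMonoidHom.comp (B.jokerBasis.coord 2).toAddMonoidHom, fun r x => ?_,
    fun (x : B.JokerModule) => ?_, ?_⟩
  · exact (congrArg ε ((B.jokerBasis.coord 2).map_smul r x)).trans (map_mul ε r _)
  · change ε (B.jc 2 (B.coordOfJoker (B.Sq1 • x))) = 0
    rw [map_smul, Sq1_jokerCoord, jsq1_apply, jc2, h1]
  · exact (congrArg ε (B.jokerBasis_coord_jokerBasis 2 2)).trans (map_one ε)

/-- The element `Sq¹Sq²Sq¹` of the joker represents a nonzero class in its `Sq²`-homology
modulo `τ`. -/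
theorem hasHomologyClass_joker_Sq2 (h2 : ∀ r, ε (B.sq2 r) = 0) (hτ : ε B.τ = 0) :
    HasHomologyClass ε B.Sq2 B.joker (B.e1 + (B.e2 + B.e1)) := by
  refine ⟨B.jokerBasis 4, B.jokerHomogeneousBasis.mem 4, B.Sq1_jokerBasis 4, B.Sq2_jokerBasis 4,
    ε.toAddMonoidHom.comp (B.jokerBasis.coord 4).toAddMonoidHom, fun r x => ?_,
    fun (x : B.JokerModule) => ?_, ?_⟩
  · exact (congrArg ε ((B.jokerBasis.coord 4).map_smul r x)).trans (map_mul ε r _)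
  · change ε (B.jc 4 (B.coordOfJoker (B.Sq2 • x))) = 0
    rw [map_smul, Sq2_jokerCoord, jsq2_apply, jc4, map_add, map_add, map_mul, map_mul, h2, hτ,
      zero_mul, zero_mul, add_zero, add_zero]
  · exact (congrArg ε (B.jokerBasis_coord_jokerBasis 4 4)).trans (map_one ε)

end joker

section real

open MvPolynomial

/-- The augmentation `𝔽₂[τ, ρ] → 𝔽₂`. -/
noncomputable def realAugmentation : realBase.R →+* ZMod 2 :=
  (constantCoeff : MReal →+* ZMod 2)

theorem realAugmentation_sq1 (r : realBase.R) : realAugmentation (realBase.sq1 r) = 0 :=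
  real_induction (p := fun r => constantCoeff (realSq1 r) = 0) r (by simp)
    (fun x y hx hy => by rw [map_add, map_add, hx, hy, add_zero])
    (fun a b => by rw [realSq1_apply]; simp)

theorem realAugmentation_sq2 (r : realBase.R) : realAugmentation (realBase.sq2 r) = 0 :=
  real_induction (p := fun r => constantCoeff (realSq2 r) = 0) r (by simp)
    (fun x y hx hy => by rw [map_add, map_add, hx, hy, add_zero])
    (fun a b => by rw [realSq2_apply]; simp)

theorem realAugmentation_τ : realAugmentation realBase.τ = 0 := constantCoeff_X ..

theorem realAugmentation_of_mem (e : realBase.Γ) (r : realBase.R) (hr : r ∈ realBase.gr e)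
    (he : e ≠ 0) : realAugmentation r = 0 := by
  by_contra h
  have hw : Finsupp.weight realWeight (0 : Fin 2 →₀ ℕ) = e := hr h
  exact he (hw.symm.trans (map_zero (Finsupp.weight realWeight)))

instance : IsAddTorsionFree realBase.Γ := inferInstanceAs (IsAddTorsionFree (ℤ × ℤ))

theorem realBase_degrees_ne :
    realBase.e2 ≠ realBase.e1 + (realBase.e2 + realBase.e1) := by
  have h : ((2, 1) : ℤ × ℤ) ≠ (1, 0) + ((2, 1) + (1, 0)) := by decide
  exact h

theorem not_isOfFinOrder_real_joker (h : StablyInvertible (joker realBase)) :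
    ¬ IsOfFinOrder h.picClass :=
  h.not_isOfFinOrder realAugmentation_of_mem realAugmentation_sq1 realAugmentation_sq2
    realAugmentation_τ (hasHomologyClass_joker_Sq1 _ realAugmentation_sq1)
    (hasHomologyClass_joker_Sq2 _ realAugmentation_sq2 realAugmentation_τ) realBase_degrees_ne

theorem not_isOfFinOrder_real_shift_joker (d : realBase.Γ)
    (h : StablyInvertible ((joker realBase).shift d)) : ¬ IsOfFinOrder h.picClass :=
  h.not_isOfFinOrder realAugmentation_of_mem realAugmentation_sq1 realAugmentation_sq2
    realAugmentation_τ ((hasHomologyClass_joker_Sq1 _ realAugmentation_sq1).shift d)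
    ((hasHomologyClass_joker_Sq2 _ realAugmentation_sq2 realAugmentation_τ).shift d)
    fun he => realBase_degrees_ne (add_right_cancel he)

end real

end SteenrodBase

namespace SteenrodBase

variable {B : SteenrodBase}

/-! ### The joker has order two over the classical coefficients -/

/-- The reflection of the basis of the joker, as an equivalence with the dual. -/
noncomputable def jokerReflection : B.JokerModule ≃ₗ[B.R] (B.JokerModule →ₗ[B.R] B.R) :=
  B.jokerBasis.equiv B.jokerBasis.dualBasis Fin.revPerm

theorem jokerReflection_jokerBasis (i : Fin 5) :
    jokerReflection (B.jokerBasis i) = B.jokerBasis.coord i.rev := by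
  rw [jokerReflection, Module.Basis.equiv_apply, Module.Basis.coe_dualBasis, Fin.revPerm_apply]

theorem jokerReflection_symm_coord (i : Fin 5) :
    jokerReflection.symm (B.jokerBasis.coord i) = B.jokerBasis i.rev := by
  rw [LinearEquiv.symm_apply_eq, jokerReflection_jokerBasis, Fin.rev_rev]

theorem jokerReflection_Sq1 (x : B.JokerModule) :
    jokerReflection (B.Sq1 • x) = B.Sq1 • jokerReflection x := by
  have hS : ∀ i, jokerReflection (B.Sq1 • B.jokerBasis i) =
      B.Sq1 • jokerReflection (B.jokerBasis i) := fun i => by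
    rw [Sq1_jokerBasis, jokerReflection_jokerBasis, Sq1_jokerBasis_coord]
    fin_cases i <;> first | exact map_zero _ | exact jokerReflection_jokerBasis _
  have hl : ∀ (r : B.R) (y : B.JokerModule), jokerReflection (r • y) = r • jokerReflection y :=
    jokerReflection.map_smul
  rw [← B.jokerBasis.sum_repr x]
  simp only [Finset.smul_sum, map_sum]
  refine Finset.sum_congr rfl fun i _ => ?_
  rw [Sq1_smul_smul, map_add, hl, hl, hl, hS,
    Sq1_smul_smul (M := B.JokerModule →ₗ[B.R] B.R)]

theorem jokerReflection_Sq2 (hτ : B.τ = 1) (x : B.JokerModule) :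
    jokerReflection (B.Sq2 • x) = B.Sq2 • jokerReflection x := by
  have hS : ∀ i, jokerReflection (B.Sq2 • B.jokerBasis i) =
      B.Sq2 • jokerReflection (B.jokerBasis i) := fun i => by
    rw [Sq2_jokerBasis, jokerReflection_jokerBasis, Sq2_jokerBasis_coord, hτ, one_smul, one_smul]
    fin_cases i <;> first | exact map_zero _ | exact jokerReflection_jokerBasis _
  have hl : ∀ (r : B.R) (y : B.JokerModule), jokerReflection (r • y) = r • jokerReflection y :=
    jokerReflection.map_smul
  rw [← B.jokerBasis.sum_repr x]
  simp only [Finset.smul_sum, map_sum]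
  refine Finset.sum_congr rfl fun i _ => ?_
  rw [Sq2_smul_smul, map_add, map_add, hl, hl, hl, hl, hS,
    jokerReflection_Sq1, Sq2_smul_smul (M := B.JokerModule →ₗ[B.R] B.R)]

theorem jdeg_add_jdeg_rev (h : B.e2 = B.e1 + B.e1) (i : Fin 5) :
    B.jdeg i + B.jdeg i.rev = B.e2 + B.e2 := by
  have h5 : ∀ j : Fin 5, B.jdeg j =
      (![0, B.e1, B.e1 + B.e1, B.e1 + B.e1 + B.e1, B.e1 + (B.e1 + B.e1 + B.e1)] :
        Fin 5 → B.Γ) j := fun j => by rw [jdeg, h]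
  rw [h5, h5, h]
  fin_cases i <;> simp [Fin.rev] <;> abel

/-- If `τ = 1`, then the joker placed symmetrically about degree `0` is self-dual. -/
noncomputable def jokerSelfDual (hτ : B.τ = 1) (h : B.e2 = B.e1 + B.e1) :
    Iso (B.joker.shift (-B.e2)) (B.jokerHomogeneousBasis.dual.shift B.e2) :=
  Iso.ofEquiv (X := B.joker.shift (-B.e2)) (Y := B.jokerHomogeneousBasis.dual.shift B.e2)
    (jokerReflection (B := B)) jokerReflection_Sq1 (jokerReflection_Sq2 hτ)
    (fun d (x : B.JokerModule) hx => by
      change jokerReflection x ∈ B.joker.dualGr (d - B.e2)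
      rw [← B.jokerBasis.sum_repr x, map_sum]
      refine sum_mem fun i _ => ?_
      have h1 := B.jokerHomogeneousBasis.smul_coord_mem i.rev
        (B.jokerHomogeneousBasis.coord_mem i hx)
      have e : d - -B.e2 - B.jdeg i - B.jdeg i.rev = d - B.e2 := by
        rw [sub_sub, jdeg_add_jdeg_rev h]; abel
      rw [map_smul, jokerReflection_jokerBasis, ← e]
      exact h1)
    (fun d (f : B.JokerModule →ₗ[B.R] B.R) hf => by
      have hs : ∑ j, f (B.jokerBasis j) • B.jokerBasis.coord j = f :=
        B.jokerHomogeneousBasis.sum_smul_coord f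
      change jokerReflection.symm f ∈ B.joker.gr (d - -B.e2)
      rw [← hs, map_sum]
      refine sum_mem fun i _ => ?_
      have h1 := B.joker.smul_mem (hf _ _ (B.jokerHomogeneousBasis.mem i))
        (B.jokerHomogeneousBasis.mem i.rev)
      have e : B.jdeg i + (d - B.e2) + B.jdeg i.rev = d - -B.e2 := by
        rw [add_right_comm, jdeg_add_jdeg_rev h]; abel
      rw [map_smul, jokerReflection_symm_coord, ← e]
      exact h1)

theorem joker_sq_eq_one (hτ : B.τ = 1) (h : B.e2 = B.e1 + B.e1) :
    (B.joker.shift (-B.e2)).cls ^ 2 = 1 := by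
  rw [sq]
  exact Quotient.sound (s := stableSetoid B)
    ((StableEquiv.of_iso (Iso.tensorCongr (Iso.refl _) (jokerSelfDual hτ h))).trans
      (B.shift_joker_tensor_shift_dual (neg_add_cancel _)))

/-- If the operations vanish on the coefficients, then every element of the joker annihilated by
`Sq¹` and `Sq²` is a `Sq¹`-boundary. -/
theorem exists_Sq1_smul_eq (h1 : ∀ r, B.sq1 r = 0) (h2 : ∀ r, B.sq2 r = 0) (hτ : B.τ = 1)
    (x : B.JokerModule) (hx1 : B.Sq1 • x = 0) (hx2 : B.Sq2 • x = 0) : ∃ y, B.Sq1 • y = x := by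
  have c1 : B.jsq1 (B.coordOfJoker x) = 0 := by
    rw [← Sq1_jokerCoord, ← map_smul, hx1, map_zero]
  have c2 : B.jsq2 (B.coordOfJoker x) = 0 := by
    rw [← Sq2_jokerCoord, ← map_smul, hx2, map_zero]
  rw [jsq1_apply] at c1
  rw [jsq2_apply] at c2
  have x0 := congrArg (B.jc 1) c1
  have x1 := congrArg (B.jc 3) c2
  have x2 := congrArg (B.jc 4) c2
  have x3 := congrArg (B.jc 4) c1
  simp only [jc1, jc3, jc4, h1, h2, hτ, zero_add, mul_zero, one_mul, map_zero] at x0 x1 x2 x3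
  refine ⟨B.jc 4 (B.coordOfJoker x) • B.jokerBasis 3, B.jokerEquiv.injective ?_⟩
  change B.coordOfJoker _ = B.coordOfJoker x
  rw [Sq1_smul_smul, h1, zero_smul, add_zero, Sq1_jokerBasis, map_coeff_smul]
  change _ • B.coordOfJoker (B.jokerBasis 4) = _
  rw [coordOfJoker_jokerBasis]
  apply jext <;> simp [jc_jsingle, x0, x1, x2, x3]

theorem not_stableEquiv_shift_joker_unit [Nontrivial B.R] (h1 : ∀ r, B.sq1 r = 0)
    (h2 : ∀ r, B.sq2 r = 0) (hτ : B.τ = 1) (d : B.Γ) :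
    ¬ StableEquiv (B.joker.shift d) (Obj.unit B) := by
  rintro ⟨P, Q, hP, -, ⟨f⟩⟩
  -- the retraction onto the unit, and the image of `1` in `J ⊕ P`
  let μ : B.JokerModule × P.carrier →ₗ[B.A] B.R :=
    (LinearMap.fst B.A B.R Q.carrier).comp f.equiv.toLinearMap
  let u : B.JokerModule × P.carrier := f.equiv.symm ((1, 0) : B.R × Q.carrier)
  have hu : μ u = 1 := congrArg (fun y : B.R × Q.carrier => y.1)
    (f.equiv.apply_symm_apply ((1, 0) : B.R × Q.carrier))
  have hμ1 : ∀ x, μ (B.Sq1 • x) = 0 := fun x => by rw [map_smul, Sq1_unit, h1]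
  have hzero : ∀ θ : B.A, θ • (1 : B.R) = 0 → θ • u = 0 := fun θ h => by
    have h0 : θ • ((1, 0) : B.R × Q.carrier) = 0 := Prod.ext h (smul_zero _)
    exact (f.equiv.symm.map_smul θ ((1, 0) : B.R × Q.carrier)).symm.trans
      ((congrArg f.equiv.symm h0).trans f.equiv.symm.map_zero)
  have hu1 : B.Sq1 • u = 0 := hzero _ (by rw [Sq1_unit, sq1_one])
  have hu2 : B.Sq2 • u = 0 := hzero _ (by rw [Sq2_unit, sq2_one])
  have hJ : μ (u.1, 0) = 0 := by
    obtain ⟨y, hy⟩ := exists_Sq1_smul_eq h1 h2 hτ u.1 (congrArg Prod.fst hu1)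
      (congrArg Prod.fst hu2)
    have e : ((u.1, 0) : B.JokerModule × P.carrier) =
        B.Sq1 • ((y, 0) : B.JokerModule × P.carrier) := by
      rw [Prod.smul_mk, smul_zero, hy]
    rw [e, hμ1]
  have hPz : μ (0, u.2) = 0 :=
    (ExactAlong.of_Sq1 linearIndependent_monomial (RingHom.id B.R) h1).projective
      (μ.toAddMonoidHom.comp (AddMonoidHom.inr B.JokerModule P.carrier))
      (fun r p => by
        have := map_coeff_smul μ r (0, p)
        rwa [Prod.smul_mk, smul_zero] at this)
      (fun p => by
        have := hμ1 (0, p)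
        rwa [Prod.smul_mk, smul_zero] at this) u.2 (congrArg Prod.snd hu1)
  have hsum : u = (u.1, 0) + (0, u.2) := by
    rw [Prod.mk_add_mk, add_zero, zero_add]
    rfl
  rw [hsum, map_add, hJ, hPz, add_zero] at hu
  exact zero_ne_one hu

theorem orderOf_picClass_shift_joker [Nontrivial B.R] (h1 : ∀ r, B.sq1 r = 0)
    (h2 : ∀ r, B.sq2 r = 0) (hτ : B.τ = 1) (he : B.e2 = B.e1 + B.e1)
    (h : StablyInvertible (B.joker.shift (-B.e2))) : orderOf h.picClass = 2 := by
  have : Fact (Nat.Prime 2) := ⟨Nat.prime_two⟩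
  refine orderOf_eq_prime (Units.ext (joker_sq_eq_one hτ he)) fun hone => ?_
  exact not_stableEquiv_shift_joker_unit h1 h2 hτ _
    (Quotient.exact (s := stableSetoid B) (congrArg Units.val hone))

instance : Nontrivial classicalBase.R := inferInstanceAs (Nontrivial (ZMod 2))

end SteenrodBase

theorem mainTheorem3 :
    (∃ h : SteenrodBase.StablyInvertible (SteenrodBase.joker SteenrodBase.realBase),
      ¬ IsOfFinOrder h.picClass) ∧
    (∀ d : SteenrodBase.realBase.Γ,
      ∃ h : SteenrodBase.StablyInvertible
        (SteenrodBase.Obj.shift d (SteenrodBase.joker SteenrodBase.realBase)),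
      ¬ IsOfFinOrder h.picClass) ∧
    (∃ h : SteenrodBase.StablyInvertible
        (SteenrodBase.Obj.shift (B := SteenrodBase.classicalBase) (-2 : ℤ)
          (SteenrodBase.joker SteenrodBase.classicalBase)),
      orderOf h.picClass = 2) :=
  ⟨⟨SteenrodBase.stablyInvertible_joker _, SteenrodBase.not_isOfFinOrder_real_joker _⟩,
    fun d => ⟨SteenrodBase.stablyInvertible_shift_joker _ d,
      SteenrodBase.not_isOfFinOrder_real_shift_joker d _⟩,
    ⟨SteenrodBase.stablyInvertible_shift_joker SteenrodBase.classicalBase (-2 : ℤ),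
      SteenrodBase.orderOf_picClass_shift_joker (B := SteenrodBase.classicalBase)
        (fun _ => rfl) (fun _ => rfl) rfl rfl _⟩⟩
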